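/- Let $0<p<1/2$, let $Y^n$ be uniform on $GF(2)^n$, let $Z^n$ be i.i.d. Bernoulli$(p)$ independent of $Y^n$, and let $X^n=Y^n+Z^n$. The encoder observes $X^n$, the decoder observes $Y^n$ (side information), and the distortion is the expected normalized Hamming distance. Write $H$ for the binary entropy function in bits, $a\ast b=a(1-b)+b(1-a)$, and $R_1^\ast(D)=H(p\ast D)-H(D)$. *Superposition scheme.* For $n,R_0,R_1,q,D$ and tolerances $0<\varepsilon<\varepsilon'$, let the codebook $\mathcal C_0$ consist of $\lceil 2^{nR_0}\rceil$ i.i.d. uniform words and let $\mathcal C_1$ consist of $\lceil 2^{nR_1}\rceil$ words with i.i.d. Bernoulli$(q)$ letters, all independent of each other and of the source. The encoder chooses uniformly at random a pair $(c_0^n,c_1^n)\in\mathcal C_0\times\mathcal C_1$ among those for which $c_0^n+c_1^n$ is strongly $\varepsilon$-jointly typical with $x^n$ (for a uniform input and additive Bernoulli$(D)$ noise), or among all pairs if there is none, and sends the index of $c_1^n$. There is an encoder error if $d_H(x^n,c_0^n+c_1^n)/n>D+\varepsilon$. For a word $w$ let $T(w)$ be a word of $\mathcal C_0$ that is strongly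 $\varepsilon'$-jointly typical with $w$ (for a uniform input and additive Bernoulli$(p\ast D)$ noise) if there is one, and any word of $\mathcal C_0$ otherwise. The decoder reconstructs $\hat x^n=y^n+\big(T(y^n-c_1^n)-(y^n-c_1^n)\big)$. There is a decoder error if the codeword $c_0^n$ chosen by the encoder is not the one and only codeword of $\mathcal C_0$ that is $\varepsilon'$-jointly typical with $y^n-c_1^n$. The rate region is $$\mathcal R(q,D)=\{(R_0,R_1): R_0>1-H(q\ast D),\ R_0+R_1>1-H(D),\ R_0\le 1-H(p\ast D)\}.$$ *Claim.* 1. Let $0\le D<1/2$. There are $q\in[0,1]$ with $H(q\ast D)>H(p\ast D)$. For every such $q$, a number $R_1$ satisfies $(R_0,R_1)\in\mathcal R(q,D)$ for some $R_0$ if and only if $R_1>R_1^\ast(D)$; and $R_0$ can then be taken with $R_0<1-H(p\ast D)$. For every $(R_0,R_1)\in\mathcal R(q,D)$ with $R_0<1-H(p\ast D)$ there is $\varepsilon_0>0$ such that for all $0<\varepsilon<\varepsilon'<\varepsilon_0$ the probabilities of an encoder error and of a decoder error tend to $0$ as $n\to\infty$. So the scheme can operate with $R_1$ arbitrarily close to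 $R_1^\ast(D)$. 2. There is exactly one $D'\in(0,p)$ at which the tangent to the curve $D\mapsto R_1^\ast(D)$ passes through the point $(p,0)$, i.e. $\frac{dR_1^\ast}{dD}(D')=\frac{R_1^\ast(D')}{D'-p}$. Let $R_{WZ}(D)$ be the Wyner–Ziv rate-distortion function: the least $R$ such that for every $\eta>0$ and all large $n$ there is a code of length $n$ (encoder seeing $X^n$ only; decoder seeing the message and $Y^n$) with at most $2^{n(R+\eta)}$ messages and distortion at most $D+\eta$. Then $R_{WZ}(D)=R_1^\ast(D)$ for $0\le D\le D'$. 3. For $D'<D\le p$, with $t=\frac{p-D}{p-D'}$, so that $D=tD'+(1-t)p$, one has $R_{WZ}(D)=t\,R_1^\ast(D')+(1-t)\cdot 0$, and time-sharing between the working points $(R_1^\ast(D'),D')$ and $(0,p)$ attains it. That is, for every $q\in[0,1]$ with $H(q\ast D')>H(p\ast D')$ and every $\eta>0$ there are $(R_0,R_1)\in\mathcal R(q,D')$ with $R_1<R_1^\ast(D')+\eta$ and tolerances $0<\varepsilon<\varepsilon'<\eta$ such that for all large $n$ some superposition code (fixed codebooks of sizes $\lceil 2^{mR_0}\rceil$,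 $\lceil 2^{mR_1}\rceil$, fixed selections, test distortion $D'$), used on the first $m=\lfloor tn\rfloor$ symbols and combined with the reconstruction $\hat x=y$ at rate zero on the other $n-m$ symbols, has at most $2^{n(R_{WZ}(D)+\eta)}$ messages and distortion at most $D+\eta$. -/

import Mathlib

open Filter Topology

namespace SuperpositionWZ

/-! ### Binary laws and entropies (in bits) -/

/-- Words of length `n` over `GF(2)`. -/
abbrev Word (n : ℕ) : Type := Fin n → ZMod 2

/-- The Bernoulli law `B(p)` on `GF(2)`: probability `p` of the symbol `1`. -/
noncomputable def bern (p : ℝ) : ZMod 2 → ℝ := fun a => if a = 0 then 1 - p else p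

/-- Law of the sum in `GF(2)` of two independent variables with laws `P` and `Q`. -/
noncomputable def conv (P Q : ZMod 2 → ℝ) : ZMod 2 → ℝ := fun c => ∑ a, P a * Q (c - a)

/-- Shannon entropy in bits of a law on `GF(2)`. -/
noncomputable def entropyBits (P : ZMod 2 → ℝ) : ℝ := ∑ a, Real.negMulLog (P a) / Real.log 2

/-- The binary entropy function `H`, in bits. -/
noncomputable def h2 (p : ℝ) : ℝ := Real.binEntropy p / Real.log 2

/-- `p ∗ q = p (1 - q) + q (1 - p)`. -/
def star (p q : ℝ) : ℝ := p * (1 - q) + q * (1 - p)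

/-- `R₁* = H(p ∗ D) - H(D)`. -/
noncomputable def R1star (p D : ℝ) : ℝ := h2 (star p D) - h2 D

/-- The rate region of the superposition scheme over `GF(2)` (so `l = 1`): pairs `(R₀, R₁)` with
`R₀ > l - H(q ∗ d)`, `R₀ + R₁ > l - H(d)` and `R₀ ≤ l - H(p ∗ d)`, where `d = B(D)`. -/
noncomputable def rateRegion (p q D : ℝ) : Set (ℝ × ℝ) :=
  {R | 1 - entropyBits (conv (bern q) (bern D)) < R.1 ∧
    1 - entropyBits (bern D) < R.1 + R.2 ∧
    R.1 ≤ 1 - entropyBits (conv (bern p) (bern D))}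

/-! ### Strong joint typicality -/

/-- Number of positions in which the pair of words `(u, v)` shows the symbols `(a, b)`. -/
def pairCount {n : ℕ} (u v : Word n) (a b : ZMod 2) : ℕ :=
  (Finset.univ.filter fun k : Fin n => u k = a ∧ v k = b).card

/-- Joint law of `(A, A + N)` with `A` uniform on `GF(2)` and `N` independent of `A`. -/
noncomputable def additiveLaw (N : ZMod 2 → ℝ) : ZMod 2 → ZMod 2 → ℝ :=
  fun a b => bern (1 / 2) a * N (b - a)

/-- `(u, v)` is strongly `ε`-jointly typical for the joint law `P` on `GF(2) × GF(2)`: all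
empirical frequencies are within `ε / 4` (4 being the size of the product alphabet) of the
probabilities, and pairs of symbols of probability zero do not occur. -/
def JointlyTypical {n : ℕ} (ε : ℝ) (P : ZMod 2 → ZMod 2 → ℝ) (u v : Word n) : Prop :=
  ∀ a b, (P a b = 0 → pairCount u v a b = 0) ∧ |(pairCount u v a b : ℝ) / n - P a b| < ε / 4

/-! ### The superposition scheme -/

/-- Number of codewords of a code of length `n` and rate `R` bit/symbol. -/
noncomputable def codeSize (R : ℝ) (n : ℕ) : ℕ := ⌈(2 : ℝ) ^ ((n : ℝ) * R)⌉₊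

open Classical in
/-- The elements with property `A`, or all elements if there is none. -/
noncomputable def orAll {α : Type} [Fintype α] (A : α → Prop) : Finset α :=
  if ∃ a, A a then Finset.univ.filter A else Finset.univ

/-- The index pairs among which the encoder chooses for the source word `x`: those with
`c₀ + c₁` jointly typical with `x` (test channel with noise `B(D)`), or all pairs if none is. -/
noncomputable def encChoices {n M₀ M₁ : ℕ} (D ε : ℝ) (c₀ : Fin M₀ → Word n) (c₁ : Fin M₁ → Word n)
    (x : Word n) : Finset (Fin M₀ × Fin M₁) :=
  orAll fun s => JointlyTypical ε (additiveLaw (bern D)) (c₀ s.1 + c₁ s.2) x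

/-- Codeword `i` of the first code is jointly typical with `w`, for additive noise `p ∗ d`. -/
def DecTypical {n M₀ : ℕ} (p D ε : ℝ) (c₀ : Fin M₀ → Word n) (w : Word n) (i : Fin M₀) : Prop :=
  JointlyTypical ε (additiveLaw (conv (bern p) (bern D))) (c₀ i) w

/-- The indices allowed for `T_{C₀}(w)`. -/
noncomputable def decChoices {n M₀ : ℕ} (p D ε : ℝ) (c₀ : Fin M₀ → Word n) (w : Word n) :
    Finset (Fin M₀) :=
  orAll (DecTypical p D ε c₀ w)

/-- Probability of a word with i.i.d. letters of law `P`. -/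
noncomputable def iidProb {n : ℕ} (P : ZMod 2 → ℝ) (u : Word n) : ℝ := ∏ k, P (u k)

open Classical in
/-- Probability of the event `E` when the codewords of `C₀` are i.i.d. uniform, those of `C₁` are
i.i.d. with letters `B(q)`, the side information `y` is uniform, the noise `z` is i.i.d. `B(p)`,
all of these are independent, and the encoder, which sees `x = y + z` and the codes, draws its
index pair `s` uniformly from `encChoices`. -/
noncomputable def schemeProb (p q D ε : ℝ) (n M₀ M₁ : ℕ)
    (E : (Fin M₀ → Word n) → (Fin M₁ → Word n) → Word n → Word n → Fin M₀ × Fin M₁ → Prop) : ℝ :=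
  ∑ c₀ : Fin M₀ → Word n, ∑ c₁ : Fin M₁ → Word n, ∑ y : Word n, ∑ z : Word n,
    (∏ i, iidProb (bern (1 / 2)) (c₀ i)) * (∏ j, iidProb (bern q) (c₁ j)) *
      iidProb (bern (1 / 2)) y * iidProb (bern p) z *
      ((((encChoices D ε c₀ c₁ (y + z)).filter (E c₀ c₁ y z)).card : ℝ) /
        (encChoices D ε c₀ c₁ (y + z)).card)

/-- Probability of an encoder error: the chosen `c₀ + c₁` is at normalized Hamming distance more
than `D + ε` from the source word. -/
noncomputable def encErrorProb (p q D R₀ R₁ ε : ℝ) (n : ℕ) : ℝ :=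
  schemeProb p q D ε n (codeSize R₀ n) (codeSize R₁ n) fun c₀ c₁ y z s =>
    (n : ℝ) * (D + ε) < hammingDist (y + z) (c₀ s.1 + c₁ s.2)

/-- Probability of a decoder error: the chosen codeword of `C₀` is not the one and only codeword
of `C₀` jointly typical (with tolerance `ε'`) with `y - c₁`. -/
noncomputable def decErrorProb (p q D R₀ R₁ ε ε' : ℝ) (n : ℕ) : ℝ :=
  schemeProb p q D ε n (codeSize R₀ n) (codeSize R₁ n) fun c₀ c₁ y _ s =>
    ¬ (DecTypical p D ε' c₀ (y - c₁ s.2) s.1 ∧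
      ∀ i, DecTypical p D ε' c₀ (y - c₁ s.2) i → i = s.1)

/-! ### Source coding with side information at the decoder -/

/-- A code of length `n` with message set `M`: the encoder sees the source word only, the decoder
sees the message and the side information. -/
structure WZCode (n : ℕ) (M : Type) where
  enc : Word n → M
  dec : M → Word n → Word n

/-- `E[d_H(Xⁿ, X̂ⁿ) / n]` for `X = Y + Z`, `Y` uniform, `Z ~ B(p)` independent of `Y`. -/
noncomputable def WZCode.distortion {n : ℕ} {M : Type} (C : WZCode n M) (p : ℝ) : ℝ :=
  ∑ y : Word n, ∑ z : Word n, iidProb (bern (1 / 2)) y * iidProb (bern p) z *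
    ((hammingDist (y + z) (C.dec (C.enc (y + z)) y) : ℝ) / n)

/-- The pair `(R, D)` is achievable for the doubly symmetric binary source with parameter `p` and
side information at the decoder. -/
def WZAchievable (p R D : ℝ) : Prop :=
  ∀ η : ℝ, 0 < η → ∀ᶠ n : ℕ in atTop, ∃ (M : ℕ) (C : WZCode n (Fin M)),
    (M : ℝ) ≤ (2 : ℝ) ^ ((n : ℝ) * (R + η)) ∧ C.distortion p ≤ D + η

/-- `R` is the value at `D` of the Wyner-Ziv rate-distortion function: the least rate `R` for
which `(R, D)` is achievable. -/
def IsWZRate (p D R : ℝ) : Prop := IsLeast {R' : ℝ | WZAchievable p R' D} R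

/-- `C` is a superposition code with test distortion `D`, typicality tolerances `ε` (encoder) and
`ε'` (decoder), and first codebook of size `M₀`: the encoder sends the index of `c₁`, and the
decoder reconstructs `y + [y - c₁]_{C₀}` with `[w]_{C₀} = T_{C₀}(w) - w`. -/
def IsSuperpositionCode {n M₁ : ℕ} (p D ε ε' : ℝ) (M₀ : ℕ) (C : WZCode n (Fin M₁)) : Prop :=
  ∃ (c₀ : Fin M₀ → Word n) (c₁ : Fin M₁ → Word n) (s : Word n → Fin M₀ × Fin M₁)
    (T : Word n → Fin M₀),
    (∀ x, s x ∈ encChoices D ε c₀ c₁ x) ∧ (∀ w, T w ∈ decChoices p D ε' c₀ w) ∧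
    (∀ x, C.enc x = (s x).2) ∧
    ∀ j y, C.dec j y = y + (c₀ (T (y - c₁ j)) - (y - c₁ j))

/-- The code of rate zero that reconstructs the source by the side information. -/
def sideInfoCode (n : ℕ) : WZCode n Unit where
  enc _ := ()
  dec _ y := y

/-- Time-sharing: the first code on the first `m` letters, the second on the last `k` ones. -/
def timeShare {m k : ℕ} {M M' : Type} (C : WZCode m M) (C' : WZCode k M') :
    WZCode (m + k) (M × M') where
  enc x := (C.enc fun i => x (Fin.castAdd k i), C'.enc fun i => x (Fin.natAdd m i))
  dec w y := Fin.append (C.dec w.1 fun i => y (Fin.castAdd k i))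
    (C'.dec w.2 fun i => y (Fin.natAdd m i))

/-- `D'` is a threshold distortion for `p`: `0 < D' < p`, and the tangent to `D ↦ H(p ∗ D) - H(D)`
at `D'` passes through the point `(p, 0)`. -/
def IsThreshold (p D' : ℝ) : Prop :=
  0 < D' ∧ D' < p ∧ HasDerivAt (R1star p) (R1star p D' / (D' - p)) D'

end SuperpositionWZ

open SuperpositionWZ

/-! The proof matches a random-coding bound with a family of linear converse bounds. Write g(d) =
H(p ∗ d) - H(d) in nats (`gainNats`).

The curve. On [0, 1] the function g is strictly convex, because p ∗ d (1 - p ∗ d) exceeds (1 - 2p)²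
d (1 - d) by the constant p (1 - p) (`strictMonoOn_gainDeriv`). Hence the height above p of the
tangent at d strictly increases on (0, p); it is negative near 0, where the slope tends to -∞, and
equals g(p) > 0 at p. Its only zero is the threshold, and tangents touching at or left of the
threshold pass on or below (p, 0).

Converse. Let a - b d be a line below g on [0, 1], with b ≥ 0 and a ≤ b p. For one letter, H(Y) -
H(X) + b E[distortion] ≥ a holds for every law of X and every map from Y to a reconstruction: there
are just four maps, and the two hypotheses on the line handle them (`single_letter_converse`). The
inequality tensorizes by a hybrid argument, which replaces X by Y one letter at a time
(`word_converse`). Conditioning on the message and bounding H(Y | M) - H(X | M) by log |M| gives the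
bound for codes (`WZCode.converse`). Tangents at points up to the threshold are admissible lines:
the tangent at D bounds the rate for D below the threshold, and the tangent at the threshold is the
chord beyond it.

Achievability. For a fixed source word, count the pairs of codewords whose sum is typical with it. A
second-moment bound shows that the count is seldom small. Pairs sharing their first word are
correlated, and controlling them takes R₀ > 1 - H(q ∗ D); the mean count is large if R₀ + R₁ > 1 -
H(D) (`sum_codebooks_lower_tail`, `sum_row_le`). When the count is not small, a uniform choice among
typical pairs errs with probability at most the number of bad typical pairs divided by a fixed
fraction of the mean count, so only an expectation over independent codewords is needed
(`choiceAvg_le`, `schemeProb_le`). For a typical pair, y - c₁ is c₀ plus noise of type p ∗ D, hence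
typical with c₀, and R₀ < 1 - H(p ∗ D) excludes the other words of the first code
(`sum_decError_le`). Derandomizing the codebooks and the selections yields fixed codes
(`exists_superpositionCode`), and concatenation with the code that outputs y gives the chord. -/

namespace SuperpositionWZ

/-! ### The curve `H(p ∗ D) - H(D)` in nats -/

/-- `H(p ∗ d) - H(d)` in nats. -/
noncomputable def gainNats (p d : ℝ) : ℝ := Real.binEntropy (star p d) - Real.binEntropy d

/-- The derivative of `gainNats p`. -/
noncomputable def gainDeriv (p d : ℝ) : ℝ :=
  (1 - 2 * p) * (Real.log (1 - star p d) - Real.log (star p d)) - (Real.log (1 - d) - Real.log d)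

lemma log_two_pos : 0 < Real.log 2 := Real.log_pos (by norm_num)

lemma R1star_eq (p d : ℝ) : R1star p d = gainNats p d / Real.log 2 := by
  simp only [R1star, gainNats, h2]; ring

lemma star_eq (p d : ℝ) : star p d = p + (1 - 2 * p) * d := by unfold star; ring

lemma star_one_sub (p d : ℝ) : star p (1 - d) = 1 - star p d := by unfold star; ring

lemma star_pos {p d : ℝ} (hp0 : 0 < p) (hp : p < 1 / 2) (hd : 0 ≤ d) : 0 < star p d := by
  rw [star_eq]; nlinarith

lemma star_lt_one {p d : ℝ} (hp0 : 0 < p) (hp : p < 1 / 2) (hd : d ≤ 1) : star p d < 1 := by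
  rw [star_eq]; nlinarith

lemma star_mem_Ioo {p q : ℝ} (hp0 : 0 < p) (hp1 : p < 1) (hq0 : 0 ≤ q) (hq1 : q ≤ 1) :
    0 < star p q ∧ star p q < 1 := by
  unfold star; constructor <;> nlinarith [mul_nonneg hp0.le hq0, mul_nonneg hp0.le (sub_nonneg.2 hq1)]

lemma gainNats_one_sub (p d : ℝ) : gainNats p (1 - d) = gainNats p d := by
  simp [gainNats, star_one_sub]

lemma gainNats_nonneg {p d : ℝ} (hp0 : 0 < p) (hp : p < 1 / 2) (hd0 : 0 ≤ d) (hd1 : d ≤ 1) :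
    0 ≤ gainNats p d := by
  have hd : d ∈ Set.Icc (0 : ℝ) 1 := ⟨hd0, hd1⟩
  have hd' : 1 - d ∈ Set.Icc (0 : ℝ) 1 := ⟨by linarith, by linarith⟩
  have h := Real.strictConcave_binEntropy.concaveOn.2 hd hd' (show 0 ≤ 1 - p by linarith) hp0.le
    (by ring)
  simp only [smul_eq_mul, Real.binEntropy_one_sub] at h
  have e : (1 - p) * d + p * (1 - d) = star p d := by unfold star; ring
  rw [e] at h
  unfold gainNats; linarith

lemma gainNats_pos {p d : ℝ} (hp0 : 0 < p) (hp : p < 1 / 2) (hd0 : 0 ≤ d) (hd1 : d < 1 / 2) :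
    0 < gainNats p d := by
  have h : d < star p d := by rw [star_eq]; nlinarith
  have h' : star p d < 1 / 2 := by rw [star_eq]; nlinarith
  have := Real.binEntropy_strictMonoOn (a := d) ⟨hd0, by linarith⟩ (b := star p d)
    ⟨by linarith, by linarith⟩ h
  unfold gainNats; linarith

lemma hasDerivAt_gainNats {p d : ℝ} (hp0 : 0 < p) (hp : p < 1 / 2) (hd0 : 0 < d) (hd1 : d < 1) :
    HasDerivAt (gainNats p) (gainDeriv p d) d := by
  have hs0 := star_pos hp0 hp hd0.le
  have hs1 := star_lt_one hp0 hp hd1.le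
  have h1 : HasDerivAt (star p) (1 - 2 * p) d := by
    have : star p = fun d => p + (1 - 2 * p) * d := funext (star_eq p)
    rw [this]
    simpa using ((hasDerivAt_id d).const_mul (1 - 2 * p)).const_add p
  have h2 := (Real.hasDerivAt_binEntropy hs0.ne' hs1.ne).comp d h1
  have h3 := h2.sub (Real.hasDerivAt_binEntropy hd0.ne' hd1.ne)
  unfold gainDeriv
  rw [mul_comm]
  exact h3

/-- With s = p ∗ d, the second derivative of the curve is 1/(d(1-d)) - (1-2p)²/(s(1-s)). It is
positive because s(1-s) = (1-2p)² d(1-d) + p(1-p). -/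
lemma strictMonoOn_gainDeriv {p : ℝ} (hp0 : 0 < p) (hp : p < 1 / 2) :
    StrictMonoOn (gainDeriv p) (Set.Ioo 0 1) := by
  have hder : ∀ d ∈ Set.Ioo (0 : ℝ) 1, HasDerivAt (gainDeriv p)
      ((1 - 2 * p) * (-(1 - 2 * p) / (1 - star p d) - (1 - 2 * p) / star p d) -
        (-1 / (1 - d) - 1 / d)) d := by
    rintro d ⟨hd0, hd1⟩
    have hs0 := star_pos hp0 hp hd0.le
    have hs1 := star_lt_one hp0 hp hd1.le
    have h1 : HasDerivAt (star p) (1 - 2 * p) d := by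
      have : star p = fun d => p + (1 - 2 * p) * d := funext (star_eq p)
      rw [this]
      simpa using ((hasDerivAt_id d).const_mul (1 - 2 * p)).const_add p
    exact ((((h1.const_sub 1).log (by linarith)).sub (h1.log hs0.ne')).const_mul _).sub
      ((((hasDerivAt_id d).const_sub 1).log (by simp; linarith)).sub
        ((hasDerivAt_id d).log hd0.ne'))
  refine strictMonoOn_of_deriv_pos (convex_Ioo 0 1)
    (fun d hd => (hder d hd).continuousAt.continuousWithinAt) fun d hd => ?_
  rw [interior_Ioo] at hd
  rw [(hder d hd).deriv]
  obtain ⟨hd0, hd1⟩ := hd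
  have hs0 := star_pos hp0 hp hd0.le
  have hs1 := star_lt_one hp0 hp hd1.le
  have e : (1 - 2 * p) * (-(1 - 2 * p) / (1 - star p d) - (1 - 2 * p) / star p d) -
        (-1 / (1 - d) - 1 / d) = 1 / (d * (1 - d)) - (1 - 2 * p) ^ 2 / (star p d * (1 - star p d)) := by
    have : 1 - star p d ≠ 0 := by linarith
    have : 1 - d ≠ 0 := by linarith
    field_simp
    ring
  rw [e, sub_pos, div_lt_div_iff₀ (mul_pos hs0 (by linarith)) (mul_pos hd0 (by linarith))]
  have : star p d * (1 - star p d) - (1 - 2 * p) ^ 2 * (d * (1 - d)) = p * (1 - p) := by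
    unfold star; ring
  nlinarith [mul_pos hp0 (show 0 < 1 - p by linarith)]

lemma continuous_gainNats (p : ℝ) : Continuous (gainNats p) := by
  have : star p = fun d => p + (1 - 2 * p) * d := funext (star_eq p)
  unfold gainNats
  rw [this]
  fun_prop

lemma convexOn_gainNats {p : ℝ} (hp0 : 0 < p) (hp : p < 1 / 2) :
    StrictConvexOn ℝ (Set.Icc 0 1) (gainNats p) := by
  refine StrictMonoOn.strictConvexOn_of_deriv (convex_Icc 0 1)
    (continuous_gainNats p).continuousOn ?_
  rw [interior_Icc]
  exact (strictMonoOn_gainDeriv hp0 hp).congr fun d hd =>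
    ((hasDerivAt_gainNats hp0 hp hd.1 hd.2).deriv).symm

lemma gainNats_tangent_le {p d₀ d : ℝ} (hp0 : 0 < p) (hp : p < 1 / 2) (h0 : 0 < d₀) (h1 : d₀ < 1)
    (hd0 : 0 ≤ d) (hd1 : d ≤ 1) :
    gainNats p d₀ + gainDeriv p d₀ * (d - d₀) ≤ gainNats p d := by
  have hc := (convexOn_gainNats hp0 hp).convexOn
  have hd := hasDerivAt_gainNats hp0 hp h0 h1
  rcases lt_trichotomy d d₀ with h | rfl | h
  · have := hc.slope_le_of_hasDerivAt ⟨hd0, hd1⟩ ⟨h0.le, h1.le⟩ h hd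
    rw [slope_def_field, div_le_iff₀ (by linarith)] at this
    linarith
  · simp
  · have := hc.le_slope_of_hasDerivAt ⟨h0.le, h1.le⟩ ⟨hd0, hd1⟩ h hd
    rw [slope_def_field, le_div_iff₀ (by linarith)] at this
    linarith

/-- The negative of the height over `p` of the tangent to `gainNats p` at `d`. -/
noncomputable def tangentGap (p d : ℝ) : ℝ := gainDeriv p d * (d - p) - gainNats p d

/-- The derivative would be g''(d)(d - p) < 0. No second derivative is needed: g(d₂) lies above the
tangent at d₁, and the larger slope at d₂ is multiplied by d₂ - p < 0. -/
lemma tangentGap_strictAnti {p d₁ d₂ : ℝ} (hp0 : 0 < p) (hp : p < 1 / 2) (h0 : 0 < d₁)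
    (h12 : d₁ < d₂) (h2 : d₂ < p) : tangentGap p d₂ < tangentGap p d₁ := by
  have h := gainNats_tangent_le hp0 hp h0 (by linarith) (d := d₂) (by linarith) (by linarith)
  have h' := strictMonoOn_gainDeriv hp0 hp (a := d₁) ⟨h0, by linarith⟩ (b := d₂)
    ⟨by linarith, by linarith⟩ h12
  unfold tangentGap
  nlinarith

lemma exists_tangentGap_eq_zero {p : ℝ} (hp0 : 0 < p) (hp : p < 1 / 2) :
    ∃ d, 0 < d ∧ d < p ∧ tangentGap p d = 0 := by
  -- K is chosen so that at exp(-K) the slope is at most -(2 log 2 / p + 1). Over a horizontal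
  -- distance of at least p/2 the tangent then falls by at least log 2 + p/2, more than the height
  -- of the curve.
  set K := Real.log 2 - Real.log p + 2 * Real.log 2 / p + 1 with hK
  have hl2 := log_two_pos
  have hquot : 0 < 2 * Real.log 2 / p := by positivity
  set d₀ := Real.exp (-K) with hd₀
  have hd0 : 0 < d₀ := Real.exp_pos _
  have hdp : d₀ < p / 2 := by
    rw [hd₀, ← Real.lt_log_iff_exp_lt (by positivity), Real.log_div hp0.ne' (by norm_num)]
    linarith
  have hs0 := star_pos hp0 hp hd0.le
  have hs1 := star_lt_one hp0 hp (d := d₀) (by linarith)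
  have hsp : p ≤ star p d₀ := by rw [star_eq]; nlinarith
  have hpos : 0 < tangentGap p d₀ := by
    have e1 : Real.log (1 - star p d₀) ≤ 0 := Real.log_nonpos (by linarith) (by linarith)
    have e2 : Real.log p ≤ Real.log (star p d₀) := Real.log_le_log hp0 hsp
    have e3 : -Real.log 2 ≤ Real.log (1 - d₀) := by
      rw [← Real.log_inv]; exact Real.log_le_log (by norm_num) (by norm_num; linarith)
    have e4 : Real.log d₀ = -K := Real.log_exp _
    have elp : Real.log p ≤ 0 := Real.log_nonpos hp0.le (by linarith)
    have e5 : gainDeriv p d₀ ≤ -Real.log p + Real.log 2 - K := by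
      unfold gainDeriv
      rw [e4]
      nlinarith
    have e6 : gainNats p d₀ ≤ Real.log 2 := by
      have := Real.binEntropy_nonneg hd0.le (by linarith)
      have := Real.binEntropy_le_log_two (p := star p d₀)
      unfold gainNats; linarith
    have e7 : gainDeriv p d₀ ≤ -(2 * Real.log 2 / p + 1) := by linarith
    have e8 : (2 * Real.log 2 / p + 1) * (p / 2) = Real.log 2 + p / 2 := by field_simp
    unfold tangentGap
    nlinarith
  have hneg : tangentGap p p < 0 := by
    have := gainNats_pos hp0 hp hp0.le hp
    simp [tangentGap, this]
  have hcont : ContinuousOn (tangentGap p) (Set.Icc d₀ p) := by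
    have hst : Continuous (star p) := by
      have : star p = fun d => p + (1 - 2 * p) * d := funext (star_eq p)
      rw [this]; fun_prop
    have hmem : ∀ d ∈ Set.Icc d₀ p, 0 < d ∧ d < 1 ∧ 0 < star p d ∧ star p d < 1 := fun d hd =>
      ⟨by linarith [hd.1], by linarith [hd.2], star_pos hp0 hp (by linarith [hd.1]),
        star_lt_one hp0 hp (by linarith [hd.2])⟩
    refine ContinuousOn.sub (ContinuousOn.mul ?_ (by fun_prop)) (continuous_gainNats p).continuousOn
    refine ContinuousOn.sub (ContinuousOn.mul continuousOn_const (ContinuousOn.sub ?_ ?_))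
      (ContinuousOn.sub ?_ ?_)
    · exact ContinuousOn.log (by fun_prop) fun d hd => by linarith [(hmem d hd).2.2.2]
    · exact ContinuousOn.log (by fun_prop) fun d hd => (hmem d hd).2.2.1.ne'
    · exact ContinuousOn.log (by fun_prop) fun d hd => by linarith [(hmem d hd).2.1]
    · exact ContinuousOn.log (by fun_prop) fun d hd => (hmem d hd).1.ne'
  obtain ⟨d, hd, hd'⟩ := intermediate_value_Icc' (by linarith) hcont ⟨hneg.le, hpos.le⟩
  refine ⟨d, by linarith [hd.1], lt_of_le_of_ne hd.2 ?_, hd'⟩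
  rintro rfl
  linarith

lemma isThreshold_iff {p d : ℝ} (hp0 : 0 < p) (hp : p < 1 / 2) :
    IsThreshold p d ↔ 0 < d ∧ d < p ∧ tangentGap p d = 0 := by
  refine and_congr_right fun h0 => and_congr_right fun h1 => ?_
  have hl2 := log_two_pos
  have hder : HasDerivAt (R1star p) (gainDeriv p d / Real.log 2) d := by
    rw [show R1star p = fun d => gainNats p d / Real.log 2 from funext (R1star_eq p)]
    exact (hasDerivAt_gainNats hp0 hp h0 (by linarith)).div_const _
  have hne : d - p ≠ 0 := by linarith
  have key : gainDeriv p d / Real.log 2 = R1star p d / (d - p) ↔ tangentGap p d = 0 := by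
    rw [R1star_eq, tangentGap, sub_eq_zero]
    field_simp
  rw [← key]
  exact ⟨fun h => hder.unique h, fun h => h ▸ hder⟩

lemma existsUnique_isThreshold {p : ℝ} (hp0 : 0 < p) (hp : p < 1 / 2) :
    ∃! D', IsThreshold p D' := by
  obtain ⟨d, h⟩ := exists_tangentGap_eq_zero hp0 hp
  refine ⟨d, (isThreshold_iff hp0 hp).2 h, fun e he => ?_⟩
  replace he := (isThreshold_iff hp0 hp).1 he
  rcases lt_trichotomy e d with hlt | heq | hlt
  · have := tangentGap_strictAnti hp0 hp he.1 hlt h.2.1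
    linarith [h.2.2, he.2.2]
  · exact heq
  · have := tangentGap_strictAnti hp0 hp h.1 hlt he.2.1
    linarith [h.2.2, he.2.2]

/-- This supplies the condition `a ≤ b * p` of the converse for the tangent at d, whose height above
p is minus the gap. -/
lemma tangentGap_nonneg_of_le {p D' d : ℝ} (hp0 : 0 < p) (hp : p < 1 / 2) (h : IsThreshold p D')
    (h0 : 0 < d) (h1 : d ≤ D') : 0 ≤ tangentGap p d := by
  rw [isThreshold_iff hp0 hp] at h
  rcases h1.lt_or_eq with hlt | rfl
  · linarith [tangentGap_strictAnti hp0 hp h0 hlt h.2.1, h.2.2]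
  · exact h.2.2.ge

/-! ### The rate region -/

lemma sum_zmod_two {M : Type*} [AddCommMonoid M] (f : ZMod 2 → M) : ∑ a, f a = f 0 + f 1 :=
  Fin.sum_univ_two f

@[simp] lemma bern_zero (p : ℝ) : bern p 0 = 1 - p := by simp [bern]

@[simp] lemma bern_one (p : ℝ) : bern p 1 = p := by simp [bern]

lemma conv_bern (p q : ℝ) : conv (bern p) (bern q) = bern (star p q) := by
  funext c
  fin_cases c
  · change conv (bern p) (bern q) 0 = bern (star p q) 0
    have : (0 : ZMod 2) - 1 = 1 := by decide
    simp only [conv, sum_zmod_two, this, sub_zero, bern_zero, bern_one, star]; ring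
  · change conv (bern p) (bern q) 1 = bern (star p q) 1
    simp only [conv, sum_zmod_two, sub_zero, sub_self, bern_zero, bern_one, star]; ring

lemma entropyBits_bern (p : ℝ) : entropyBits (bern p) = h2 p := by
  simp only [entropyBits, sum_zmod_two, bern_zero, bern_one, h2,
    Real.binEntropy_eq_negMulLog_add_negMulLog_one_sub]
  ring

lemma mem_rateRegion {p q D R₀ R₁ : ℝ} : (R₀, R₁) ∈ rateRegion p q D ↔
    1 - h2 (star q D) < R₀ ∧ 1 - h2 D < R₀ + R₁ ∧ R₀ ≤ 1 - h2 (star p D) := by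
  simp only [rateRegion, conv_bern, entropyBits_bern, Set.mem_ofPred_eq]

lemma setOf_rate_eq_Ioi {p q D : ℝ} (h : h2 (star p D) < h2 (star q D)) :
    {R₁ : ℝ | ∃ R₀ : ℝ, (R₀, R₁) ∈ rateRegion p q D} = Set.Ioi (R1star p D) := by
  ext R₁
  simp only [mem_rateRegion, Set.mem_ofPred_eq, Set.mem_Ioi, R1star]
  constructor
  · rintro ⟨R₀, -, h2, h3⟩; linarith
  · exact fun h1 => ⟨1 - h2 (star p D), by linarith, by linarith, le_rfl⟩

/-- Both lower bounds on R₀ lie strictly below 1 - H(p ∗ D): one by the choice of q, the other since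
R₁ > R₁*. The strict upper bound is what the decoder's union bound needs. -/
lemma exists_rate_lt {p q D R₁ : ℝ} (h : h2 (star p D) < h2 (star q D)) (hR : R1star p D < R₁) :
    ∃ R₀ : ℝ, (R₀, R₁) ∈ rateRegion p q D ∧ R₀ < 1 - h2 (star p D) := by
  simp only [R1star] at hR
  obtain ⟨R₀, h1, h2⟩ := exists_between
    (show max (1 - h2 (star q D)) (1 - h2 D - R₁) < 1 - h2 (star p D) by
      rw [max_lt_iff]; constructor <;> linarith)
  rw [max_lt_iff] at h1
  exact ⟨R₀, mem_rateRegion.2 ⟨h1.1, by linarith, h2.le⟩, h2⟩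

lemma setOf_rate_lt_eq_Ioi {p q D : ℝ} (h : h2 (star p D) < h2 (star q D)) :
    {R₁ : ℝ | ∃ R₀ : ℝ, (R₀, R₁) ∈ rateRegion p q D ∧ R₀ < 1 - h2 (star p D)} =
      Set.Ioi (R1star p D) := by
  refine Set.Subset.antisymm ?_ fun R₁ hR => exists_rate_lt h hR
  rw [← setOf_rate_eq_Ioi h]
  exact fun R₁ ⟨R₀, h1, _⟩ => ⟨R₀, h1⟩

/-- For q = 1/2 the sum with any noise is uniform, so its entropy is maximal, whereas p ∗ D < 1/2.
-/
lemma h2_star_half {p D : ℝ} (hp : p < 1 / 2) (hD1 : D < 1 / 2) :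
    h2 (star p D) < h2 (star (1 / 2) D) := by
  have e : star (1 / 2) D = 2⁻¹ := by unfold star; ring
  have h' : star p D < 1 / 2 := by rw [star_eq]; nlinarith
  rw [e, h2, h2, Real.binEntropy_two_inv]
  have := log_two_pos
  gcongr
  exact Real.binEntropy_lt_log_two.2 (by norm_num at h' ⊢; linarith)

/-! ### Sums over words -/

lemma bern_nonneg {p : ℝ} (h0 : 0 ≤ p) (h1 : p ≤ 1) (a : ZMod 2) : 0 ≤ bern p a := by
  unfold bern; split_ifs <;> linarith

lemma sum_bern (p : ℝ) : ∑ a, bern p a = 1 := by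
  rw [sum_zmod_two, bern_zero, bern_one]; ring

lemma iidProb_nonneg {n : ℕ} {P : ZMod 2 → ℝ} (hP : ∀ a, 0 ≤ P a) (u : Word n) :
    0 ≤ iidProb P u := Finset.prod_nonneg fun k _ => hP (u k)

lemma sum_iidProb {n : ℕ} {P : ZMod 2 → ℝ} (hP : ∑ a, P a = 1) :
    ∑ u : Word n, iidProb P u = 1 := by
  have := Finset.prod_univ_sum (fun _ : Fin n => (Finset.univ : Finset (ZMod 2))) fun _ a => P a
  rw [Fintype.piFinset_univ] at this
  simp only [iidProb, ← this, hP, Finset.prod_const_one]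

lemma sum_iidProb_sub {n : ℕ} {P : ZMod 2 → ℝ} (hP : ∑ a, P a = 1) (x : Word n) :
    ∑ y : Word n, iidProb P (x - y) = 1 := by
  rw [← sum_iidProb hP]
  exact (Equiv.subLeft x).sum_comp (iidProb P)

lemma iidProb_half {n : ℕ} (u : Word n) : iidProb (bern (1 / 2)) u = (1 / 2) ^ n := by
  have : bern (1 / 2) = fun _ => 1 / 2 := by funext a; unfold bern; split_ifs <;> norm_num
  simp only [iidProb, this, Finset.prod_const, Finset.card_univ, Fintype.card_fin]

lemma sum_word_succ {M : Type*} [AddCommMonoid M] {n : ℕ} (F : Word (n + 1) → M) :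
    ∑ x, F x = ∑ a : ZMod 2, ∑ x' : Word n, F (Fin.cons a x') := by
  rw [← Fintype.sum_prod_type']
  exact ((Fin.consEquiv fun _ => ZMod 2).sum_comp F).symm

lemma iidProb_cons_sub_cons {n : ℕ} (P : ZMod 2 → ℝ) (a b : ZMod 2) (x y : Word n) :
    iidProb P ((Fin.cons a x : Word (n + 1)) - (Fin.cons b y : Word (n + 1))) =
      P (a - b) * iidProb P (x - y) := by
  simp [iidProb, Fin.prod_univ_succ]

lemma hammingDist_cons {n : ℕ} (a : ZMod 2) (x : Word n) (w : Word (n + 1)) :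
    hammingDist (Fin.cons a x : Word (n + 1)) w =
      (if a ≠ w 0 then 1 else 0) + hammingDist x (Fin.tail w) := by
  rw [hammingDist, Finset.card_filter, Fin.sum_univ_succ, hammingDist, Finset.card_filter]
  rfl

/-! ### The converse -/

open Real in
-- Lagrangian form of the one-letter bound, for an unnormalized law μ of X so that it can be summed
-- over conditioning events. The map f is the decoder of this letter. If f is constant, the
-- distortion is θ or 1 - θ, and the line lies below g at that point; if f is the identity or the
-- flip, the distortion is p or 1 - p, and a ≤ b p with g ≥ 0 suffices.
lemma single_letter_converse {p a b : ℝ} (hp0 : 0 < p) (hp : p < 1 / 2) (hb : 0 ≤ b)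
    (hG : ∀ d, 0 ≤ d → d ≤ 1 → a - b * d ≤ gainNats p d) (hab : a ≤ b * p)
    (μ : ZMod 2 → ℝ) (hμ : ∀ x, 0 ≤ μ x) (f : ZMod 2 → ZMod 2) :
    a * ∑ x, μ x ≤ ∑ y, negMulLog (∑ x, μ x * bern p (x - y)) - ∑ x, negMulLog (μ x) +
      b * ∑ x, ∑ y, μ x * bern p (x - y) * (if x ≠ f y then 1 else 0) := by
  set s := μ 0 + μ 1 with hs
  have h0 := hμ 0
  have h1 := hμ 1
  have e01 : (0 : ZMod 2) - 1 = 1 := by decide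
  rcases (add_nonneg h0 h1).eq_or_lt with hz | hpos
  · have z0 : μ 0 = 0 := by linarith
    have z1 : μ 1 = 0 := by linarith
    simp [sum_zmod_two, z0, z1]
  · have hs0 : s ≠ 0 := hpos.ne'
    -- Normalization: θ is the conditional probability of a one. The entropy of the total mass s
    -- cancels in the difference because the channel preserves mass.
    obtain ⟨θ, hθ⟩ : ∃ θ, θ = μ 1 / s := ⟨_, rfl⟩
    have t1 : μ 1 = s * θ := by rw [hθ]; field_simp
    have t0 : μ 0 = s * (1 - θ) := by rw [mul_sub, ← t1, hs]; ring
    have hθ0 : 0 ≤ θ := by rw [hθ]; exact div_nonneg h1 hpos.le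
    have hθ1 : θ ≤ 1 := by rw [hθ, div_le_one hpos]; linarith
    have n1 : μ 0 * p + μ 1 * (1 - p) = s * star p θ := by rw [t0, t1]; unfold star; ring
    have n0 : μ 0 * (1 - p) + μ 1 * p = s * (1 - star p θ) := by
      rw [t0, t1]; unfold star; ring
    have hent : ∑ y, negMulLog (∑ x, μ x * bern p (x - y)) - ∑ x, negMulLog (μ x) =
        s * gainNats p θ := by
      simp only [sum_zmod_two, sub_zero, sub_self, e01, bern_zero, bern_one, n0, n1]
      rw [t0, t1]
      simp only [negMulLog_mul, gainNats, binEntropy_eq_negMulLog_add_negMulLog_one_sub]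
      ring
    rw [hent]
    have hsum : ∑ x, μ x = s := sum_zmod_two μ
    rw [hsum]
    have g0 := gainNats_nonneg hp0 hp hθ0 hθ1
    have ga := hG θ hθ0 hθ1
    have gb := hG (1 - θ) (by linarith) (by linarith)
    rw [gainNats_one_sub] at gb
    have hcase : ∀ c : ZMod 2, c = 0 ∨ c = 1 := by decide
    have n01 : (0 : ZMod 2) ≠ 1 := by decide
    have hbp : b * p ≤ b * (1 - p) := by nlinarith
    -- Here d is the conditional error probability of f; the four cases below are d = θ, p, 1 - p, 1
    -- - θ.
    suffices H : ∃ d, ∑ x, ∑ y, μ x * bern p (x - y) * (if x ≠ f y then 1 else 0) = s * d ∧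
        a ≤ gainNats p θ + b * d by
      obtain ⟨d, hd, hd'⟩ := H
      rw [hd]
      nlinarith
    simp only [sum_zmod_two, sub_zero, sub_self, e01, bern_zero, bern_one]
    rcases hcase (f 0) with c0 | c0 <;> rcases hcase (f 1) with c1 | c1 <;>
      simp only [c0, c1, ne_eq, not_true_eq_false, if_false, n01, n01.symm, not_false_eq_true,
        if_true, mul_zero, mul_one, zero_add, add_zero]
    · exact ⟨θ, by rw [t1]; ring, by linarith⟩
    · exact ⟨p, by rw [t0, t1]; ring, by linarith⟩
    · exact ⟨1 - p, by rw [t0, t1]; ring, by linarith⟩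
    · exact ⟨1 - θ, by rw [t0]; ring, by linarith⟩

open Real in
-- Induction on the length with the hybrid (X₀, Y'), where X₀ is the first source letter and Y' the
-- side information of the others: H(Y₀Y') - H(X₀X') is the sum of H(Y₀Y') - H(X₀Y') and H(X₀Y') -
-- H(X₀X'). The first difference is a one-letter problem for each value of Y', the second a shorter
-- problem for each value of X₀.
lemma word_converse {p a b : ℝ} (hp0 : 0 < p) (hp : p < 1 / 2) (hb : 0 ≤ b)
    (hG : ∀ d, 0 ≤ d → d ≤ 1 → a - b * d ≤ gainNats p d) (hab : a ≤ b * p) (n : ℕ) :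
    ∀ (μ : Word n → ℝ), (∀ x, 0 ≤ μ x) → ∀ f : Word n → Word n,
    n * a * ∑ x, μ x ≤ ∑ y, negMulLog (∑ x, μ x * iidProb (bern p) (x - y)) -
      ∑ x, negMulLog (μ x) +
      b * ∑ x, ∑ y, μ x * iidProb (bern p) (x - y) * hammingDist x (f y) := by
  have hk0 := bern_nonneg hp0.le (show p ≤ 1 by linarith)
  induction n with
  | zero =>
    intro μ hμ f
    have : ∀ x y : Word 0, hammingDist x (f y) = 0 := fun x y => by
      rw [hammingDist_eq_zero]; exact Subsingleton.elim _ _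
    simp [this, iidProb]
  | succ n ih =>
    intro μ hμ f
    -- The unnormalized joint law of the hybrid pair (X₀, Y').
    set κ : ZMod 2 → Word n → ℝ := fun a' y' =>
      ∑ x' : Word n, μ (Fin.cons a' x') * iidProb (bern p) (x' - y') with hκ
    have hκ0 : ∀ a' y', 0 ≤ κ a' y' := fun a' y' =>
      Finset.sum_nonneg fun x' _ => mul_nonneg (hμ _) (iidProb_nonneg hk0 _)
    have hκsum : ∀ a', ∑ y', κ a' y' = ∑ x', μ (Fin.cons a' x') := fun a' => by
      simp only [hκ]
      rw [Finset.sum_comm]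
      simp only [← Finset.mul_sum, sum_iidProb_sub (sum_bern p), mul_one]
    -- First letter: for each fixed y' the decoder of this letter is a function of y₀ alone.
    have T1 := Finset.sum_le_sum fun (y' : Word n) (_ : y' ∈ Finset.univ) =>
      single_letter_converse hp0 hp hb hG hab (fun a' => κ a' y') (fun a' => hκ0 a' y')
        fun b' => f (Fin.cons b' y') 0
    -- Remaining letters: the decoder may also use y₀ = b'. Given X₀ = a', the letter Y₀ is
    -- independent of (X', Y'), so the bound can be averaged over b' with the channel weights.
    have T2 := Finset.sum_le_sum fun (a' : ZMod 2) (_ : a' ∈ Finset.univ) =>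
      Finset.sum_le_sum fun (b' : ZMod 2) (_ : b' ∈ Finset.univ) =>
      mul_le_mul_of_nonneg_left (ih (fun x' => μ (Fin.cons a' x')) (fun x' => hμ _)
        fun y' => Fin.tail (f (Fin.cons b' y'))) (hk0 (a' - b'))
    have hk1 : ∀ a' : ZMod 2, ∑ b', bern p (a' - b') = 1 := fun a' => by
      rw [← sum_bern p]; exact (Equiv.subLeft a').sum_comp (bern p)
    have E1 : ∑ y, negMulLog (∑ x, μ x * iidProb (bern p) (x - y)) =
        ∑ y', ∑ b', negMulLog (∑ a', κ a' y' * bern p (a' - b')) := by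
      rw [sum_word_succ, Finset.sum_comm]
      refine Finset.sum_congr rfl fun y' _ => Finset.sum_congr rfl fun b' _ => congrArg _ ?_
      rw [sum_word_succ]
      refine Finset.sum_congr rfl fun a' _ => ?_
      simp only [hκ, Finset.sum_mul]
      exact Finset.sum_congr rfl fun x' _ => by rw [iidProb_cons_sub_cons]; ring
    have E2 : ∑ x, ∑ y, μ x * iidProb (bern p) (x - y) * (hammingDist x (f y) : ℝ) =
        ∑ y', ∑ a', ∑ b', κ a' y' * bern p (a' - b') *
            (if a' ≠ f (Fin.cons b' y') 0 then 1 else 0) +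
          ∑ a', ∑ b', bern p (a' - b') * ∑ x' : Word n, ∑ y', μ (Fin.cons a' x') *
            iidProb (bern p) (x' - y') * (hammingDist x' (Fin.tail (f (Fin.cons b' y'))) : ℝ) := by
      have L : ∑ x, ∑ y, μ x * iidProb (bern p) (x - y) * (hammingDist x (f y) : ℝ) =
          ∑ a', ∑ b', ∑ x' : Word n, ∑ y' : Word n, (μ (Fin.cons a' x') *
            iidProb (bern p) (x' - y') * bern p (a' - b') *
              (if a' ≠ f (Fin.cons b' y') 0 then 1 else 0) +
            bern p (a' - b') * (μ (Fin.cons a' x') *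
            iidProb (bern p) (x' - y') * (hammingDist x' (Fin.tail (f (Fin.cons b' y'))) : ℝ))) := by
        rw [sum_word_succ]
        refine Finset.sum_congr rfl fun a' _ => ?_
        rw [Finset.sum_comm (s := Finset.univ (α := ZMod 2))]
        refine Finset.sum_congr rfl fun x' _ => ?_
        rw [sum_word_succ]
        refine Finset.sum_congr rfl fun b' _ => Finset.sum_congr rfl fun y' _ => ?_
        rw [iidProb_cons_sub_cons, hammingDist_cons]
        push_cast
        ring
      rw [L]
      simp only [Finset.sum_add_distrib, ← Finset.mul_sum]
      congr 1
      rw [Finset.sum_comm (s := Finset.univ (α := Word n)) (t := Finset.univ (α := ZMod 2))]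
      refine Finset.sum_congr rfl fun a' _ => ?_
      rw [Finset.sum_comm (s := Finset.univ (α := Word n)) (t := Finset.univ (α := ZMod 2))]
      refine Finset.sum_congr rfl fun b' _ => ?_
      rw [Finset.sum_comm]
      refine Finset.sum_congr rfl fun y' _ => ?_
      simp only [hκ, Finset.sum_mul]
    have E3 : ∑ x, negMulLog (μ x) = ∑ a', ∑ x' : Word n, negMulLog (μ (Fin.cons a' x')) :=
      sum_word_succ _
    have E4 : ∑ x, μ x = ∑ a', ∑ x' : Word n, μ (Fin.cons a' x') := sum_word_succ _
    have E5 : ∑ y', ∑ a', κ a' y' = ∑ a', ∑ x' : Word n, μ (Fin.cons a' x') := by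
      rw [Finset.sum_comm]; exact Finset.sum_congr rfl fun a' _ => hκsum a'
    have E6 : ∑ y', ∑ a', negMulLog (κ a' y') = ∑ a', ∑ y', negMulLog (κ a' y') :=
      Finset.sum_comm
    rw [← Finset.mul_sum, E5, Finset.sum_add_distrib, Finset.sum_sub_distrib, ← Finset.mul_sum,
      E6] at T1
    simp only [mul_add, mul_sub, Finset.sum_add_distrib, Finset.sum_sub_distrib, ← Finset.sum_mul,
      hk1, one_mul] at T2
    have E7 : ∀ g : ZMod 2 → ZMod 2 → ℝ, ∑ a', ∑ b', bern p (a' - b') * (b * g a' b') =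
        b * ∑ a', ∑ b', bern p (a' - b') * g a' b' := fun g => by
      simp only [Finset.mul_sum]
      exact Finset.sum_congr rfl fun _ _ => Finset.sum_congr rfl fun _ _ => by ring
    rw [E7, ← Finset.mul_sum] at T2
    rw [E1, E2, E3, E4]
    push_cast
    linarith

open Real in
-- `word_converse` is applied to the law of X restricted to each message and summed. Then H(X, M) =
-- H(X) since M is a function of X, and H(Y, M) ≤ H(Y) + log |M|; as X and Y are both uniform, the
-- entropy difference is at most log |M|.
lemma WZCode.converse {p a b : ℝ} (hp0 : 0 < p) (hp : p < 1 / 2) (hb : 0 ≤ b)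
    (hG : ∀ d, 0 ≤ d → d ≤ 1 → a - b * d ≤ gainNats p d) (hab : a ≤ b * p) {n M : ℕ} (hn : 0 < n)
    (C : WZCode n (Fin M)) : n * (a - b * C.distortion p) ≤ log M := by
  have hk0 := bern_nonneg hp0.le (show p ≤ 1 by linarith)
  have hM : 0 < M := Fin.pos (C.enc 0)
  have hM' : (0 : ℝ) < M := by exact_mod_cast hM
  set c : ℝ := (1 / 2) ^ n with hc
  have hc0 : 0 < c := by positivity
  have hcard : (Fintype.card (Word n) : ℝ) * c = 1 := by
    simp [Word, hc]
  -- The uniform source law restricted to the words encoded by m.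
  set μ : Fin M → Word n → ℝ := fun m x => if C.enc x = m then c else 0 with hμ
  have hμ0 : ∀ m x, 0 ≤ μ m x := fun m x => by simp only [hμ]; split_ifs <;> linarith
  have T := Finset.sum_le_sum fun (m : Fin M) (_ : m ∈ Finset.univ) =>
    word_converse hp0 hp hb hG hab n (μ m) (hμ0 m) (C.dec m)
  have S1 : ∀ x, ∑ m, μ m x = c := fun x => by simp [hμ]
  have E1 : ∑ m, ∑ x, μ m x = 1 := by
    rw [Finset.sum_comm]
    simp only [S1, Finset.sum_const, Finset.card_univ, nsmul_eq_mul]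
    exact hcard
  have E2 : ∑ m, ∑ x, negMulLog (μ m x) = -log c := by
    rw [Finset.sum_comm]
    have : ∀ x, ∑ m, negMulLog (μ m x) = negMulLog c := fun x => by
      rw [Finset.sum_eq_single (C.enc x)]
      · simp [hμ]
      · intro m _ hm; simp [hμ, hm.symm]
      · simp
    simp only [this, Finset.sum_const, Finset.card_univ, nsmul_eq_mul]
    rw [negMulLog]
    linear_combination (-log c) * hcard
  have E3 : ∑ m, ∑ y, negMulLog (∑ x, μ m x * iidProb (bern p) (x - y)) ≤ log M - log c := by
    rw [Finset.sum_comm]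
    have hy : ∀ y : Word n, ∑ m, negMulLog (∑ x, μ m x * iidProb (bern p) (x - y)) ≤
        c * (log M - log c) := fun y => by
      -- Jensen over the messages for fixed y: the joint masses of (y, m) add up to c, so they
      -- contribute most when all are equal to c / M.
      have hJ := concaveOn_negMulLog.le_map_sum (t := Finset.univ) (w := fun _ : Fin M => (M : ℝ)⁻¹)
        (p := fun m => ∑ x, μ m x * iidProb (bern p) (x - y)) (fun _ _ => by positivity)
        (by simp [hM'.ne']) (fun m _ => Set.mem_Ici.2 <| Finset.sum_nonneg fun x _ =>
          mul_nonneg (hμ0 m x) (iidProb_nonneg hk0 _))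
      have hs : ∑ m, ∑ x, μ m x * iidProb (bern p) (x - y) = c := by
        rw [Finset.sum_comm]
        simp only [← Finset.sum_mul, S1, ← Finset.mul_sum]
        have : ∑ x : Word n, iidProb (bern p) (x - y) = 1 := by
          rw [← sum_iidProb (n := n) (sum_bern p)]
          exact (Equiv.subRight y).sum_comp (iidProb (bern p))
        rw [this, mul_one]
      simp only [smul_eq_mul, ← Finset.mul_sum, hs] at hJ
      rw [inv_mul_le_iff₀ hM'] at hJ
      refine hJ.trans_eq ?_
      rw [negMulLog, log_mul (by positivity) hc0.ne', log_inv]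
      field_simp
      ring
    refine (Finset.sum_le_sum fun y _ => hy y).trans_eq ?_
    simp only [Finset.sum_const, Finset.card_univ, nsmul_eq_mul]
    linear_combination (log M - log c) * hcard
  have E4 : ∑ m, ∑ x, ∑ y, μ m x * iidProb (bern p) (x - y) * (hammingDist x (C.dec m y) : ℝ) =
      n * C.distortion p := by
    rw [Finset.sum_comm]
    have : ∀ x, ∑ m, ∑ y, μ m x * iidProb (bern p) (x - y) * (hammingDist x (C.dec m y) : ℝ) =
        ∑ y, c * iidProb (bern p) (x - y) * (hammingDist x (C.dec (C.enc x) y) : ℝ) := fun x => by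
      rw [Finset.sum_eq_single (C.enc x)]
      · simp [hμ]
      · intro m _ hm; simp [hμ, hm.symm]
      · simp
    simp only [this, WZCode.distortion]
    rw [Finset.sum_comm, Finset.mul_sum]
    refine Finset.sum_congr rfl fun y _ => ?_
    rw [← Equiv.sum_comp (Equiv.addLeft y), Finset.mul_sum]
    refine Finset.sum_congr rfl fun z _ => ?_
    simp only [Equiv.coe_addLeft, add_sub_cancel_left, iidProb_half]
    have : (n : ℝ) ≠ 0 := by positivity
    field_simp
    rw [hc]; ring
  rw [← Finset.mul_sum, E1, Finset.sum_add_distrib, Finset.sum_sub_distrib, E2, ← Finset.mul_sum,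
    E4] at T
  nlinarith

/-- A line below the curve and passing below `(p, 0)` bounds the rate of every achievable pair. -/
lemma WZAchievable.line_le {p a b R D : ℝ} (hp0 : 0 < p) (hp : p < 1 / 2) (hb : 0 ≤ b)
    (hG : ∀ d, 0 ≤ d → d ≤ 1 → a - b * d ≤ gainNats p d) (hab : a ≤ b * p)
    (h : WZAchievable p R D) : (a - b * D) / Real.log 2 ≤ R := by
  have hl := log_two_pos
  rw [div_le_iff₀ hl]
  refine le_of_forall_pos_le_add fun δ hδ => ?_
  obtain ⟨η, hη, hηδ⟩ : ∃ η : ℝ, 0 < η ∧ η * (b + Real.log 2) = δ :=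
    ⟨δ / (b + Real.log 2), by positivity, by field_simp⟩
  obtain ⟨n, ⟨M, C, hM, hC⟩, hn⟩ := ((h η hη).and (eventually_gt_atTop 0)).exists
  have hc := C.converse hp0 hp hb hG hab hn
  have hM0 : (0 : ℝ) < M := by exact_mod_cast Fin.pos (C.enc 0)
  have hlog := Real.log_le_log hM0 hM
  rw [Real.log_rpow (by norm_num)] at hlog
  have hn' : (0 : ℝ) < n := by exact_mod_cast hn
  have : a - b * C.distortion p ≤ (R + η) * Real.log 2 := by
    refine le_of_mul_le_mul_left ?_ hn'
    linarith
  nlinarith [mul_le_mul_of_nonneg_left hC hb]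

/-- The tangent at d lies below the convex curve, and its height at p is nonpositive for d up to the
threshold. Positivity of the curve then forces a nonpositive slope, so the line is admissible in
`WZAchievable.line_le`. -/
lemma WZAchievable.tangent_le {p R D D' d : ℝ} (hp0 : 0 < p) (hp : p < 1 / 2)
    (hD' : IsThreshold p D') (h : WZAchievable p R D) (hd : 0 < d) (hd' : d ≤ D') :
    (gainNats p d + gainDeriv p d * (D - d)) / Real.log 2 ≤ R := by
  have hgap := tangentGap_nonneg_of_le hp0 hp hD' hd hd'
  have hdp : d < p := hd'.trans_lt hD'.2.1
  have hpos := gainNats_pos hp0 hp hd.le (by linarith)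
  unfold tangentGap at hgap
  have hneg : gainDeriv p d ≤ 0 := by
    by_contra! hc
    nlinarith
  have := h.line_le (a := gainNats p d - gainDeriv p d * d) (b := -gainDeriv p d) hp0 hp
    (by linarith) (fun e h0 h1 => by
      linarith [gainNats_tangent_le hp0 hp hd (by linarith : d < 1) h0 h1]) (by linarith)
  refine le_trans (le_of_eq ?_) this
  ring

/-- For D > 0 the tangent at D itself gives the bound. At D = 0 there is no finite tangent, so
tangents at d → 0+ are used instead. -/
lemma WZAchievable.R1star_le {p R D D' : ℝ} (hp0 : 0 < p) (hp : p < 1 / 2)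
    (hD' : IsThreshold p D') (h : WZAchievable p R D) (h0 : 0 ≤ D) (h1 : D ≤ D') :
    R1star p D ≤ R := by
  have hl := log_two_pos
  rcases h0.eq_or_lt with rfl | hpos
  -- Since the slope at d is nonpositive, the tangent evaluated at 0 is at least its value at the
  -- point of contact.
  · have hle : ∀ d ∈ Set.Ioc 0 D', R1star p d ≤ R := fun d hd => by
      have ht := h.tangent_le hp0 hp hD' hd.1 hd.2
      have hgap := tangentGap_nonneg_of_le hp0 hp hD' hd.1 hd.2
      have hdp : d < p := hd.2.trans_lt hD'.2.1
      have hpos := gainNats_pos hp0 hp hd.1.le (by linarith)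
      have hneg : gainDeriv p d ≤ 0 := by
        unfold tangentGap at hgap
        by_contra! hc
        nlinarith
      rw [R1star_eq]
      refine le_trans ?_ ht
      gcongr
      nlinarith [hd.1]
    have hcont : ContinuousAt (R1star p) 0 := by
      rw [show R1star p = fun d => gainNats p d / Real.log 2 from funext (R1star_eq p)]
      exact ((continuous_gainNats p).div_const _).continuousAt
    have hev : ∀ᶠ d in 𝓝[>] (0 : ℝ), R1star p d ≤ R := by
      filter_upwards [Ioc_mem_nhdsGT hD'.1] with d hd using hle d hd
    exact le_of_tendsto (hcont.tendsto.mono_left nhdsWithin_le_nhds) hev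
  · have ht := h.tangent_le hp0 hp hD' hpos h1
    rwa [sub_self, mul_zero, add_zero, ← R1star_eq] at ht

/-- The tangent at the threshold vanishes at p, so it coincides with the chord from the threshold
point to (p, 0). -/
lemma WZAchievable.chord_le {p R D D' t : ℝ} (hp0 : 0 < p) (hp : p < 1 / 2)
    (hD' : IsThreshold p D') (h : WZAchievable p R D) (ht : D = t * D' + (1 - t) * p) :
    t * R1star p D' ≤ R := by
  have hl := log_two_pos
  refine le_trans (le_of_eq ?_) (h.tangent_le hp0 hp hD' hD'.1 le_rfl)
  have hgap := ((isThreshold_iff hp0 hp).1 hD').2.2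
  unfold tangentGap at hgap
  rw [R1star_eq, ht]
  field_simp
  linear_combination (1 - t) * hgap

/-! ### Finite product distributions -/

open Classical in
/-- The indicator of a proposition, as a real number. -/
noncomputable def ind (P : Prop) : ℝ := if P then 1 else 0

lemma ind_of {P : Prop} (h : P) : ind P = 1 := if_pos h

lemma ind_not {P : Prop} (h : ¬P) : ind P = 0 := if_neg h

lemma ind_nonneg (P : Prop) : 0 ≤ ind P := by unfold ind; split_ifs <;> norm_num

lemma ind_le_one (P : Prop) : ind P ≤ 1 := by unfold ind; split_ifs <;> norm_num

lemma ind_mono {P Q : Prop} (h : P → Q) : ind P ≤ ind Q := by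
  by_cases hP : P
  · rw [ind_of hP, ind_of (h hP)]
  · rw [ind_not hP]; exact ind_nonneg Q

lemma ind_and (P Q : Prop) : ind (P ∧ Q) = ind P * ind Q := by
  by_cases hP : P <;> by_cases hQ : Q <;> simp [ind, hP, hQ]

lemma ind_mul_self (P : Prop) : ind P * ind P = ind P := by
  rw [← ind_and, and_self]

section Product

variable {ι A : Type*} [Fintype ι] [DecidableEq ι] [Fintype A] {α : A → ℝ}

lemma sum_pi_prod_mul_prod (χ : ι → A → ℝ) :
    ∑ c : ι → A, (∏ i, α (c i)) * ∏ i, χ i (c i) = ∏ i, ∑ a, α a * χ i a := by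
  have := Finset.prod_univ_sum (fun _ : ι => (Finset.univ : Finset A)) fun i a => α a * χ i a
  rw [Fintype.piFinset_univ] at this
  simp only [this, Finset.prod_mul_distrib]

lemma sum_pi_prod (hα : ∑ a, α a = 1) : ∑ c : ι → A, ∏ i, α (c i) = 1 := by
  simpa [hα] using sum_pi_prod_mul_prod (α := α) fun (_ : ι) _ => 1

lemma sum_pi_apply (hα : ∑ a, α a = 1) (j : ι) (φ : A → ℝ) :
    ∑ c : ι → A, (∏ i, α (c i)) * φ (c j) = ∑ a, α a * φ a := by
  have := sum_pi_prod_mul_prod (α := α) fun i a => if i = j then φ a else 1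
  rw [Finset.prod_eq_single j (fun i _ hi => by simp [hi, hα]) (by simp)] at this
  simpa [Finset.prod_ite_eq'] using this

lemma sum_pi_apply_two (hα : ∑ a, α a = 1) {j k : ι} (hjk : j ≠ k) (φ ψ : A → ℝ) :
    ∑ c : ι → A, (∏ i, α (c i)) * (φ (c j) * ψ (c k)) =
      (∑ a, α a * φ a) * ∑ a, α a * ψ a := by
  have := sum_pi_prod_mul_prod (α := α) fun i a => if i = j then φ a else if i = k then ψ a else 1
  rw [Finset.prod_eq_mul j k hjk (fun i _ hi => by simp [hi.1, hi.2, hα]) (by simp) (by simp)] at this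
  simp only [if_true, hjk.symm, if_false] at this
  rw [← this]
  refine Finset.sum_congr rfl fun c _ => congrArg _ ?_
  rw [Finset.prod_eq_mul j k hjk (fun i _ hi => by simp [hi.1, hi.2]) (by simp) (by simp)]
  simp [hjk.symm]

lemma sum_pi_sum (hα : ∑ a, α a = 1) (φ : ι → A → ℝ) :
    ∑ c : ι → A, (∏ i, α (c i)) * ∑ k, φ k (c k) = ∑ k, ∑ a, α a * φ k a := by
  simp only [Finset.mul_sum]
  rw [Finset.sum_comm]
  exact Finset.sum_congr rfl fun k _ => by rw [sum_pi_apply hα k]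

lemma sum_pi_sum_sq (hα : ∑ a, α a = 1) (φ : ι → A → ℝ) :
    ∑ c : ι → A, (∏ i, α (c i)) * (∑ k, φ k (c k)) ^ 2 =
      ∑ k, ∑ a, α a * φ k a ^ 2 + (∑ k, ∑ a, α a * φ k a) ^ 2 - ∑ k, (∑ a, α a * φ k a) ^ 2 := by
  have key : ∀ k l, ∑ c : ι → A, (∏ i, α (c i)) * (φ k (c k) * φ l (c l)) =
      (∑ a, α a * φ k a) * (∑ a, α a * φ l a) +
        if k = l then ∑ a, α a * φ k a ^ 2 - (∑ a, α a * φ k a) ^ 2 else 0 := by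
    intro k l
    by_cases h : k = l
    · subst h
      have := sum_pi_apply hα k fun a => φ k a ^ 2
      simp only [if_true, ← sq, this]; ring
    · simp only [h, if_false, add_zero, sum_pi_apply_two hα h]
  have h1 : ∀ c : ι → A, (∏ i, α (c i)) * (∑ k, φ k (c k)) ^ 2 =
      ∑ k, ∑ l, (∏ i, α (c i)) * (φ k (c k) * φ l (c l)) := fun c => by
    rw [sq, Finset.sum_mul_sum, Finset.mul_sum]
    exact Finset.sum_congr rfl fun k _ => by rw [Finset.mul_sum]
  simp only [h1]
  rw [Finset.sum_comm]
  have h2 : ∀ k, ∑ c : ι → A, ∑ l, (∏ i, α (c i)) * (φ k (c k) * φ l (c l)) =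
      ∑ l, ((∑ a, α a * φ k a) * (∑ a, α a * φ l a) +
        if k = l then ∑ a, α a * φ k a ^ 2 - (∑ a, α a * φ k a) ^ 2 else 0) := fun k => by
    rw [Finset.sum_comm]
    exact Finset.sum_congr rfl fun l _ => key k l
  simp only [h2, Finset.sum_add_distrib, Finset.sum_ite_eq, Finset.mem_univ, if_true,
    Finset.sum_sub_distrib, ← Finset.sum_mul_sum]
  ring

lemma sum_pi_iid_sq (hα : ∑ a, α a = 1) (φ : A → ℝ) :
    ∑ c : ι → A, (∏ i, α (c i)) * (∑ k, φ (c k)) ^ 2 =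
      Fintype.card ι * ∑ a, α a * φ a ^ 2 +
        Fintype.card ι * (Fintype.card ι - 1) * (∑ a, α a * φ a) ^ 2 := by
  rw [sum_pi_sum_sq hα fun _ => φ]
  simp only [Finset.sum_const, Finset.card_univ, nsmul_eq_mul]
  ring

/-- Chebyshev's inequality for independent summands bounded by `1`. -/
lemma sum_pi_chebyshev {n : ℕ} (hα0 : ∀ a, 0 ≤ α a) (hα : ∑ a, α a = 1) (φ : Fin n → A → ℝ)
    (hφ : ∀ k a, |φ k a| ≤ 1) (hn : 0 < n) {t : ℝ} (ht : 0 < t) :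
    ∑ c : Fin n → A, (∏ i, α (c i)) *
      ind (n * t ≤ |∑ k, φ k (c k) - ∑ k, ∑ a, α a * φ k a|) ≤ 1 / (n * t ^ 2) := by
  have hn' : (0 : ℝ) < n := by exact_mod_cast hn
  set ψ : Fin n → A → ℝ := fun k a => φ k a - ∑ a, α a * φ k a with hψ
  have hmean : ∀ k, ∑ a, α a * ψ k a = 0 := fun k => by
    simp only [hψ, mul_sub, Finset.sum_sub_distrib, ← Finset.sum_mul, hα]; ring
  have hvar : ∀ k, ∑ a, α a * ψ k a ^ 2 ≤ 1 := fun k => by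
    have e : ∑ a, α a * ψ k a ^ 2 = ∑ a, α a * φ k a ^ 2 - (∑ a, α a * φ k a) ^ 2 := by
      simp only [hψ, sub_sq, mul_add, mul_sub, Finset.sum_sub_distrib, Finset.sum_add_distrib,
        ← Finset.sum_mul, hα]
      have : ∑ x, α x * (2 * φ k x * ∑ a, α a * φ k a) =
          2 * (∑ a, α a * φ k a) * (∑ a, α a * φ k a) := by
        rw [Finset.mul_sum]
        exact Finset.sum_congr rfl fun _ _ => by ring
      rw [this]; ring
    have h1 : ∑ a, α a * φ k a ^ 2 ≤ ∑ a, α a := Finset.sum_le_sum fun a _ => by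
      have := (sq_le_one_iff_abs_le_one _).2 (hφ k a)
      nlinarith [hα0 a]
    rw [e]; nlinarith [sq_nonneg (∑ a, α a * φ k a)]
  have hsecond : ∑ c : Fin n → A, (∏ i, α (c i)) * (∑ k, ψ k (c k)) ^ 2 ≤ n := by
    rw [sum_pi_sum_sq hα ψ]
    simp only [hmean, Finset.sum_const_zero]
    have := Finset.sum_le_sum fun k (_ : k ∈ Finset.univ) => hvar k
    simp at this ⊢
    exact this
  have hpt : ∀ c : Fin n → A, (∏ i, α (c i)) *
      ind (n * t ≤ |∑ k, φ k (c k) - ∑ k, ∑ a, α a * φ k a|) ≤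
      ((∏ i, α (c i)) * (∑ k, ψ k (c k)) ^ 2) * (1 / (n * t) ^ 2) := fun c => by
    rw [mul_assoc]
    refine mul_le_mul_of_nonneg_left ?_ (Finset.prod_nonneg fun i _ => hα0 _)
    have e : ∑ k, ψ k (c k) = ∑ k, φ k (c k) - ∑ k, ∑ a, α a * φ k a := by
      simp only [hψ, Finset.sum_sub_distrib]
    rw [e]
    by_cases h : n * t ≤ |∑ k, φ k (c k) - ∑ k, ∑ a, α a * φ k a|
    · rw [ind_of h, mul_one_div, one_le_div (by positivity), ← sq_abs (_ - _)]
      gcongr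
    · rw [ind_not h]; positivity
  refine (Finset.sum_le_sum fun c _ => hpt c).trans ?_
  rw [← Finset.sum_mul]
  calc _ ≤ (n : ℝ) * (1 / (n * t) ^ 2) := by gcongr
    _ = _ := by field_simp

lemma sum_pi_chebyshev_four {n : ℕ} (hα0 : ∀ a, 0 ≤ α a) (hα : ∑ a, α a = 1)
    (φ : ZMod 2 → ZMod 2 → Fin n → A → ℝ) (hφ : ∀ u v k a, |φ u v k a| ≤ 1) (hn : 0 < n) {t : ℝ}
    (ht : 0 < t) :
    ∑ c : Fin n → A, (∏ i, α (c i)) *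
      ind (∃ u v, n * t ≤ |∑ k, φ u v k (c k) - ∑ k, ∑ a, α a * φ u v k a|) ≤
        4 / (n * t ^ 2) := by
  have hpt : ∀ c : Fin n → A, (∏ i, α (c i)) *
      ind (∃ u v, n * t ≤ |∑ k, φ u v k (c k) - ∑ k, ∑ a, α a * φ u v k a|) ≤
      ∑ u : ZMod 2, ∑ v : ZMod 2, (∏ i, α (c i)) *
        ind (n * t ≤ |∑ k, φ u v k (c k) - ∑ k, ∑ a, α a * φ u v k a|) := fun c => by
    have hw : 0 ≤ ∏ i, α (c i) := Finset.prod_nonneg fun i _ => hα0 _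
    have h0 : ∀ u v, 0 ≤ (∏ i, α (c i)) *
        ind (n * t ≤ |∑ k, φ u v k (c k) - ∑ k, ∑ a, α a * φ u v k a|) := fun u v =>
      mul_nonneg hw (ind_nonneg _)
    by_cases h : ∃ u v, n * t ≤ |∑ k, φ u v k (c k) - ∑ k, ∑ a, α a * φ u v k a|
    · obtain ⟨u, v, huv⟩ := id h
      rw [ind_of h, ← ind_of huv]
      exact (Finset.single_le_sum (fun v _ => h0 u v) (Finset.mem_univ v)).trans
        (Finset.single_le_sum (f := fun u => ∑ v, (∏ i, α (c i)) *
          ind (n * t ≤ |∑ k, φ u v k (c k) - ∑ k, ∑ a, α a * φ u v k a|))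
          (fun u _ => Finset.sum_nonneg fun v _ => h0 u v) (Finset.mem_univ u))
    · rw [ind_not h, mul_zero]
      exact Finset.sum_nonneg fun u _ => Finset.sum_nonneg fun v _ => h0 u v
  refine (Finset.sum_le_sum fun c _ => hpt c).trans ?_
  rw [Finset.sum_comm]
  have h1 : ∀ u v, ∑ c : Fin n → A, (∏ i, α (c i)) *
      ind (n * t ≤ |∑ k, φ u v k (c k) - ∑ k, ∑ a, α a * φ u v k a|) ≤ 1 / (n * t ^ 2) :=
    fun u v => sum_pi_chebyshev hα0 hα (φ u v) (hφ u v) hn ht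
  calc _ ≤ ∑ u : ZMod 2, ∑ v : ZMod 2, 1 / (n * t ^ 2) := by
        refine Finset.sum_le_sum fun u _ => ?_
        rw [Finset.sum_comm]
        exact Finset.sum_le_sum fun v _ => h1 u v
    _ = _ := by simp only [sum_zmod_two]; ring

end Product

/-! ### Types and likelihoods -/

lemma iidProb_eq {n : ℕ} (P : ZMod 2 → ℝ) (u : Word n) : iidProb P u = ∏ k, P (u k) := rfl

lemma zmod_two_cases : ∀ a : ZMod 2, a = 0 ∨ a = 1 := by decide

/-- The number of ones of a word, as a real number. -/
noncomputable def weight {n : ℕ} (w : Word n) : ℝ := ∑ k, ind (w k = 1)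

lemma pairCount_eq {n : ℕ} (u v : Word n) (a b : ZMod 2) :
    (pairCount u v a b : ℝ) = ∑ k, ind (u k = a ∧ v k = b) := by
  rw [pairCount, Finset.card_filter]
  push_cast
  exact Finset.sum_congr rfl fun k _ => by unfold ind; congr

lemma weight_sub {n : ℕ} (u v : Word n) :
    weight (v - u) = pairCount u v 0 1 + pairCount u v 1 0 := by
  rw [pairCount_eq, pairCount_eq, weight, ← Finset.sum_add_distrib]
  refine Finset.sum_congr rfl fun k _ => ?_
  have : ∀ a b : ZMod 2, ind (b - a = 1) = ind (a = 0 ∧ b = 1) + ind (a = 1 ∧ b = 0) := by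
    intro a b
    rcases zmod_two_cases a with rfl | rfl <;> rcases zmod_two_cases b with rfl | rfl <;>
      simp [ind]
  exact this _ _

lemma hammingDist_eq_weight {n : ℕ} (u v : Word n) : (hammingDist v u : ℝ) = weight (v - u) := by
  rw [hammingDist, Finset.card_filter, weight]
  push_cast
  refine Finset.sum_congr rfl fun k _ => ?_
  have : ∀ a b : ZMod 2, (if b ≠ a then (1 : ℝ) else 0) = ind (b - a = 1) := by
    intro a b
    rcases zmod_two_cases a with rfl | rfl <;> rcases zmod_two_cases b with rfl | rfl <;>
      simp [ind]
  exact this _ _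

lemma additiveLaw_bern (r : ℝ) (a b : ZMod 2) :
    additiveLaw (bern r) a b = 1 / 2 * bern r (b - a) := by
  have : bern (1 / 2) a = 1 / 2 := by unfold bern; split_ifs <;> norm_num
  rw [additiveLaw, this]

/-- The condition on w for r = 0 excludes letters of probability zero, for which log 0 = 0 would
make the exponential formula false. -/
lemma iidProb_bern_eq_exp {n : ℕ} {r : ℝ} (hr0 : 0 ≤ r) (hr1 : r < 1) (w : Word n)
    (hw : r = 0 → ∀ k, w k = 0) : iidProb (bern r) w =
      Real.exp (n * Real.log (1 - r) + weight w * (Real.log r - Real.log (1 - r))) := by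
  have hpos : ∀ k, 0 < bern r (w k) := fun k => by
    unfold bern
    split_ifs with h
    · linarith
    · exact lt_of_le_of_ne hr0 fun h0 => h (hw h0.symm k)
  have hlog : ∀ k, bern r (w k) =
      Real.exp (Real.log (1 - r) + ind (w k = 1) * (Real.log r - Real.log (1 - r))) := fun k => by
    rw [← Real.exp_log (hpos k)]
    congr 1
    have : ∀ a : ZMod 2, Real.log (bern r a) =
        Real.log (1 - r) + ind (a = 1) * (Real.log r - Real.log (1 - r)) := by
      intro a
      rcases zmod_two_cases a with rfl | rfl <;> simp [ind]
    exact this _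
  simp only [iidProb, hlog]
  rw [← Real.exp_sum, Finset.sum_add_distrib, weight, Finset.sum_mul]
  simp

lemma two_rpow_eq (x : ℝ) : (2 : ℝ) ^ x = Real.exp (x * Real.log 2) := by
  rw [Real.rpow_def_of_pos (by norm_num), mul_comm]

/-- Words whose type is close to `B(r)` have probability about `2 ^ (-n H(r))`. -/
lemma exists_likelihood_bounds {r δ : ℝ} (hr0 : 0 ≤ r) (hr1 : r < 1) (hδ : 0 < δ) :
    ∃ ε₀ : ℝ, 0 < ε₀ ∧ ∀ (n : ℕ) (w : Word n), (r = 0 → ∀ k, w k = 0) →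
      |weight w - n * r| ≤ n * ε₀ →
      (2 : ℝ) ^ (-(n * (h2 r + δ))) ≤ iidProb (bern r) w ∧
        iidProb (bern r) w ≤ (2 : ℝ) ^ (-(n * (h2 r - δ))) := by
  have hl := log_two_pos
  set L := Real.log r - Real.log (1 - r) with hL
  -- The exponent is affine in the weight with slope L; the added 1 avoids a division by zero at r =
  -- 1/2.
  refine ⟨δ * Real.log 2 / (|L| + 1), by positivity, fun n w hw hdev => ?_⟩
  have hent : h2 r * Real.log 2 = -(r * Real.log r + (1 - r) * Real.log (1 - r)) := by
    rw [h2, div_mul_cancel₀ _ hl.ne', Real.binEntropy_eq_negMulLog_add_negMulLog_one_sub]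
    simp only [Real.negMulLog]; ring
  have e : n * Real.log (1 - r) + weight w * L =
      -(n * (h2 r * Real.log 2)) + (weight w - n * r) * L := by rw [hent, hL]; ring
  have hb : |(weight w - n * r) * L| ≤ n * (δ * Real.log 2) := by
    rw [abs_mul]
    calc |weight w - n * r| * |L| ≤ n * (δ * Real.log 2 / (|L| + 1)) * |L| := by gcongr
      _ = n * (δ * Real.log 2) * (|L| / (|L| + 1)) := by ring
      _ ≤ n * (δ * Real.log 2) * 1 := by
        gcongr
        rw [div_le_one (by positivity)]; linarith
      _ = _ := mul_one _
  rw [abs_le] at hb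
  rw [iidProb_bern_eq_exp hr0 hr1 w hw, two_rpow_eq, two_rpow_eq, Real.exp_le_exp,
    Real.exp_le_exp, e]
  constructor <;> nlinarith

/-- The ones of v - u come from the two off-diagonal cells, each within n ε/4 of its mean. For r = 0
the clause on symbols of probability zero forces u = v. -/
lemma JointlyTypical.abs_weight_sub_le {n : ℕ} {ε r : ℝ} {u v : Word n}
    (h : JointlyTypical ε (additiveLaw (bern r)) u v) (hn : 0 < n) :
    (r = 0 → ∀ k, (v - u) k = 0) ∧ |weight (v - u) - n * r| ≤ n * (ε / 2) := by
  have hn' : (0 : ℝ) < n := by exact_mod_cast hn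
  have h01 := (h 0 1)
  have h10 := (h 1 0)
  have e1 : (0 : ZMod 2) - 1 = 1 := by decide
  simp only [additiveLaw_bern, sub_zero, e1, bern_one] at h01 h10
  constructor
  · intro hr k
    have c1 := h01.1 (by rw [hr]; ring)
    have c2 := h10.1 (by rw [hr]; ring)
    rw [pairCount, Finset.card_eq_zero, Finset.filter_eq_empty_iff] at c1 c2
    have d1 := c1 (Finset.mem_univ k)
    have d2 := c2 (Finset.mem_univ k)
    have : ∀ a b : ZMod 2, ¬(a = 0 ∧ b = 1) → ¬(a = 1 ∧ b = 0) → b - a = 0 := by decide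
    exact this _ _ d1 d2
  · rw [weight_sub]
    have hd : ∀ c : ℝ, |c / n - 1 / 2 * r| < ε / 4 → |c - n * (1 / 2 * r)| ≤ n * (ε / 4) := by
      intro c hc
      have : c - n * (1 / 2 * r) = n * (c / n - 1 / 2 * r) := by field_simp
      rw [this, abs_mul, abs_of_pos hn']
      gcongr
    have a1 := hd _ h01.2
    have a2 := hd _ h10.2
    have e : (pairCount u v 0 1 + pairCount u v 1 0 - n * r : ℝ) =
        (pairCount u v 0 1 - n * (1 / 2 * r)) + (pairCount u v 1 0 - n * (1 / 2 * r)) := by ring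
    rw [e]
    exact (abs_add_le _ _).trans (by linarith)

/-- Joint typicality from non-normalized frequencies. -/
lemma jointlyTypical_of {n : ℕ} {ε : ℝ} {P : ZMod 2 → ZMod 2 → ℝ} {u v : Word n} (hn : 0 < n)
    (h0 : ∀ a b, P a b = 0 → pairCount u v a b = 0)
    (h : ∀ a b, |(pairCount u v a b : ℝ) - n * P a b| < n * (ε / 4)) :
    JointlyTypical ε P u v := fun a b => by
  refine ⟨h0 a b, ?_⟩
  have hn' : (0 : ℝ) < n := by exact_mod_cast hn
  have e : (pairCount u v a b : ℝ) / n - P a b = (pairCount u v a b - n * P a b) / n := by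
    field_simp
  rw [e, abs_div, abs_of_pos hn', div_lt_iff₀ hn']
  linarith [h a b]

lemma JointlyTypical.abs_pairCount_sub_lt {n : ℕ} {ε : ℝ} {P : ZMod 2 → ZMod 2 → ℝ} {u v : Word n}
    (h : JointlyTypical ε P u v) (hn : 0 < n) (a b : ZMod 2) :
    |(pairCount u v a b : ℝ) - n * P a b| < n * (ε / 4) := by
  have hn' : (0 : ℝ) < n := by exact_mod_cast hn
  have e : (pairCount u v a b - n * P a b : ℝ) = n * (pairCount u v a b / n - P a b) := by
    field_simp
  rw [e, abs_mul, abs_of_pos hn']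
  exact mul_lt_mul_of_pos_left (h a b).2 hn'

/-! ### Concentration of the empirical frequencies -/

lemma abs_sum_mul_sub_le {A : Type*} [Fintype A] {w g g' : A → ℝ} {η : ℝ} (hw0 : ∀ c, 0 ≤ w c)
    (hw : ∑ c, w c = 1) (h : ∀ c, |g c - g' c| ≤ η) :
    |∑ c, w c * g c - ∑ c, w c * g' c| ≤ η := by
  rw [← Finset.sum_sub_distrib]
  calc |∑ c, (w c * g c - w c * g' c)| ≤ ∑ c, |w c * g c - w c * g' c| :=
        Finset.abs_sum_le_sum_abs _ _
    _ ≤ ∑ c, w c * η := Finset.sum_le_sum fun c _ => by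
        rw [← mul_sub, abs_mul, abs_of_nonneg (hw0 c)]
        exact mul_le_mul_of_nonneg_left (h c) (hw0 c)
    _ = η := by rw [← Finset.sum_mul, hw, one_mul]

lemma abs_ind_le_one (P : Prop) : |ind P| ≤ 1 := by
  rw [abs_of_nonneg (ind_nonneg P)]; exact ind_le_one P

lemma sum_mul_ind_mono {A : Type*} [Fintype A] {w : A → ℝ} (hw : ∀ c, 0 ≤ w c)
    {P Q : A → Prop} (h : ∀ c, P c → Q c) : ∑ c, w c * ind (P c) ≤ ∑ c, w c * ind (Q c) :=
  Finset.sum_le_sum fun c _ => mul_le_mul_of_nonneg_left (ind_mono (h c)) (hw c)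

/-- Both symbols occur in `x` with frequency within `δ` of `1 / 2`. -/
def Balanced {n : ℕ} (δ : ℝ) (x : Word n) : Prop :=
  ∀ b, |∑ k, ind (x k = b) - n * (1 / 2)| < n * δ

lemma sum_not_balanced_le {n : ℕ} (hn : 0 < n) {δ : ℝ} (hδ : 0 < δ) :
    ∑ x : Word n, iidProb (bern (1 / 2)) x * ind (¬Balanced δ x) ≤ 4 / (n * δ ^ 2) := by
  have h0 := bern_nonneg (p := 1 / 2) (by norm_num) (by norm_num)
  refine le_trans (sum_mul_ind_mono (fun x => iidProb_nonneg h0 x) fun x hx => ?_)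
    (sum_pi_chebyshev_four h0 (sum_bern _) (fun _ b _ a => ind (a = b))
      (fun _ _ _ _ => abs_ind_le_one _) hn hδ)
  simp only [Balanced, not_forall, not_lt] at hx
  obtain ⟨b, hb⟩ := hx
  refine ⟨0, b, hb.trans_eq ?_⟩
  have : ∑ a : ZMod 2, bern (1 / 2) a * ind (a = b) = 1 / 2 := by
    rcases zmod_two_cases b with rfl | rfl
    · simp [ind]; norm_num
    · simp [ind]
  simp only [this, Finset.sum_const, Finset.card_univ, Fintype.card_fin, nsmul_eq_mul]

/-- The tolerance n ε/4 is split in two halves: the fluctuation of the noise counts about their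
means given x, and the deviation of those means caused by the imbalance of x. -/
lemma sum_noise_jointlyTypical_ge {n : ℕ} (hn : 0 < n) {D ε : ℝ} (hD0 : 0 ≤ D) (hD1 : D < 1)
    (hε : 0 < ε) {x : Word n} (hx : Balanced (ε / 8) x) :
    1 - 4 / (n * (ε / 8) ^ 2) ≤ ∑ s : Word n, iidProb (bern D) s *
      ind (JointlyTypical ε (additiveLaw (bern D)) (x - s) x) := by
  have h0 := bern_nonneg hD0 hD1.le
  have hn' : (0 : ℝ) < n := by exact_mod_cast hn
  have hc := sum_pi_chebyshev_four h0 (sum_bern D)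
    (fun a b k s => ind (x k - s = a ∧ x k = b)) (fun _ _ _ _ => abs_ind_le_one _) hn
    (show 0 < ε / 8 by positivity)
  rw [sub_le_iff_le_add, ← sum_iidProb (n := n) (sum_bern D)]
  refine le_trans ?_ (add_le_add_right hc _)
  rw [← Finset.sum_add_distrib]
  refine Finset.sum_le_sum fun s _ => ?_
  rw [← iidProb_eq, ← mul_add]
  rcases (iidProb_nonneg h0 s).eq_or_lt with hz | hpos
  · rw [← hz]; simp
  refine le_mul_of_one_le_right hpos.le ?_
  -- A noise word of positive probability uses no impossible letter; this gives the clause on zero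
  -- probabilities when D = 0.
  have hpos' : ∀ k, bern D (s k) ≠ 0 := fun k hk =>
    hpos.ne' (Finset.prod_eq_zero (Finset.mem_univ k) hk)
  by_cases hdev : ∃ a b, n * (ε / 8) ≤ |∑ k, ind (x k - s k = a ∧ x k = b) -
      ∑ k, ∑ c, bern D c * ind (x k - c = a ∧ x k = b)|
  · rw [ind_of hdev]; linarith [ind_nonneg (JointlyTypical ε (additiveLaw (bern D)) (x - s) x)]
  suffices h : JointlyTypical ε (additiveLaw (bern D)) (x - s) x by
    rw [ind_of h]; linarith [ind_nonneg (∃ a b, n * (ε / 8) ≤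
      |∑ k, ind (x k - s k = a ∧ x k = b) - ∑ k, ∑ c, bern D c * ind (x k - c = a ∧ x k = b)|)]
  refine jointlyTypical_of hn (fun a b hab => ?_) fun a b => ?_
  · rw [pairCount, Finset.card_eq_zero, Finset.filter_eq_empty_iff]
    rintro k - ⟨h1, h2⟩
    rw [additiveLaw_bern] at hab
    apply hpos' k
    have : s k = b - a := by rw [← h1, ← h2]; simp
    rw [this]; linarith
  · push Not at hdev
    have h1 := hdev a b
    have hmean : ∑ k, ∑ c, bern D c * ind (x k - c = a ∧ x k = b) =
        bern D (b - a) * ∑ k, ind (x k = b) := by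
      rw [Finset.mul_sum]
      refine Finset.sum_congr rfl fun k _ => ?_
      rw [Finset.sum_eq_single (b - a)]
      · congr 2
        refine propext ⟨fun h => h.2, fun h => ⟨by rw [h]; abel, h⟩⟩
      · intro c _ hc
        rw [ind_not, mul_zero]
        rintro ⟨h1, h2⟩
        exact hc (by rw [← h1, ← h2]; abel)
      · simp
    rw [hmean] at h1
    rw [pairCount_eq, additiveLaw_bern]
    have h2 : |bern D (b - a) * ∑ k, ind (x k = b) - n * (1 / 2 * bern D (b - a))| ≤
        n * (ε / 8) := by
      have e : bern D (b - a) * ∑ k, ind (x k = b) - n * (1 / 2 * bern D (b - a)) =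
          bern D (b - a) * (∑ k, ind (x k = b) - n * (1 / 2)) := by ring
      have hle : bern D (b - a) ≤ 1 := by unfold bern; split_ifs <;> linarith
      rw [e, abs_mul, abs_of_nonneg (h0 _)]
      calc _ ≤ 1 * (n * (ε / 8)) :=
            mul_le_mul hle (hx b).le (abs_nonneg _) zero_le_one
        _ = _ := one_mul _
    calc _ ≤ _ := abs_sub_le _ (bern D (b - a) * ∑ k, ind (x k = b)) _
      _ < n * (ε / 8) + n * (ε / 8) := add_lt_add_of_lt_of_le h1 h2
      _ = n * (ε / 4) := by ring

/-- The pair frequencies of `(u, m)` are within `ε / 4` of those of independent letters, the first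
uniform and the second `B(D)`. -/
def ProductTypical {n : ℕ} (ε D : ℝ) (u m : Word n) : Prop :=
  ∀ a s, |(pairCount u m a s : ℝ) - n * (1 / 2 * bern D s)| < n * (ε / 4)

/-- Change of coordinates from (u, x) to (u, x - u), in which the additive channel becomes a product
law. It prepares for randomizing u while x - u stays fixed. -/
lemma JointlyTypical.productTypical {n : ℕ} (hn : 0 < n) {D ε : ℝ} {u x : Word n}
    (h : JointlyTypical ε (additiveLaw (bern D)) u x) : ProductTypical ε D u (x - u) := fun a s => by
  have h1 := h.abs_pairCount_sub_lt hn a (s + a)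
  rw [additiveLaw_bern, add_sub_cancel_right] at h1
  have : pairCount u (x - u) a s = pairCount u x a (s + a) := by
    unfold pairCount
    congr 1
    refine Finset.filter_congr fun k _ => and_congr_right fun hk => ?_
    rw [Pi.sub_apply, hk, sub_eq_iff_eq_add]
  rwa [this]

/-- Subtracting independent `B(q)` noise from the first word nearly preserves typicality. -/
lemma sum_not_productTypical_le {n : ℕ} (hn : 0 < n) {q D ε ε' : ℝ} (hq0 : 0 ≤ q) (hq1 : q ≤ 1)
    (hε : ε < ε') {u m : Word n} (h : ProductTypical ε D u m) :
    ∑ c : Word n, iidProb (bern q) c * ind (¬ProductTypical ε' D (u - c) m) ≤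
      4 / (n * ((ε' - ε) / 4) ^ 2) := by
  have h0 := bern_nonneg hq0 hq1
  refine le_trans (sum_mul_ind_mono (fun x => iidProb_nonneg h0 x) fun c hc => ?_)
    (sum_pi_chebyshev_four h0 (sum_bern q) (fun a s k c => ind (u k - c = a ∧ m k = s))
      (fun _ _ _ _ => abs_ind_le_one _) hn (show 0 < (ε' - ε) / 4 by linarith))
  simp only [ProductTypical, not_forall, not_lt] at hc
  obtain ⟨a, s, has⟩ := hc
  refine ⟨a, s, ?_⟩
  have hmean : ∑ k, ∑ c, bern q c * ind (u k - c = a ∧ m k = s) =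
      ∑ c, bern q c * pairCount u m (a + c) s := by
    rw [Finset.sum_comm]
    refine Finset.sum_congr rfl fun c _ => ?_
    rw [pairCount_eq, Finset.mul_sum]
    refine Finset.sum_congr rfl fun k _ => ?_
    rw [sub_eq_iff_eq_add]
  have hav := abs_sum_mul_sub_le (g := fun c => (pairCount u m (a + c) s : ℝ))
    (g' := fun _ => n * (1 / 2 * bern D s)) h0 (sum_bern q) fun c => (h (a + c) s).le
  rw [← Finset.sum_mul, sum_bern, one_mul, ← hmean] at hav
  rw [pairCount_eq] at has
  have htri := abs_sub_le (∑ k, ind ((u - c) k = a ∧ m k = s))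
    (∑ k, ∑ c, bern q c * ind (u k - c = a ∧ m k = s)) (n * (1 / 2 * bern D s))
  simp only [Pi.sub_apply] at has htri
  linarith

/-- Adding `B(q)` noise to a word of weight about `n D` gives weight about `n (q ∗ D)`. -/
lemma sum_weight_dev_le {n : ℕ} (hn : 0 < n) {q D ε δ : ℝ} (hq0 : 0 ≤ q) (hq1 : q ≤ 1)
    (hδ : 0 < δ) (hε : ε ≤ δ) {u x : Word n} (h : |weight (x - u) - n * D| ≤ n * (ε / 2)) :
    ∑ c : Word n, iidProb (bern q) c * ind (¬|weight (x - (u - c)) - n * star q D| ≤ n * δ) ≤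
      1 / (n * (δ / 2) ^ 2) := by
  have h0 := bern_nonneg hq0 hq1
  have hn' : (0 : ℝ) < n := by exact_mod_cast hn
  refine le_trans (sum_mul_ind_mono (fun x => iidProb_nonneg h0 x) fun c hc => ?_)
    (sum_pi_chebyshev h0 (sum_bern q) (fun k c => ind (x k - (u k - c) = 1))
      (fun _ _ => abs_ind_le_one _) hn (show 0 < δ / 2 by linarith))
  have hmean : ∑ k, ∑ c, bern q c * ind (x k - (u k - c) = 1) =
      (1 - q) * weight (x - u) + q * (n - weight (x - u)) := by
    have hk : ∀ a b : ZMod 2, ∑ c, bern q c * ind (b - (a - c) = 1) =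
        (1 - q) * ind (b - a = 1) + q * (1 - ind (b - a = 1)) := by
      intro a b
      rw [sum_zmod_two, bern_zero, bern_one]
      rcases zmod_two_cases a with rfl | rfl <;> rcases zmod_two_cases b with rfl | rfl <;>
        simp [ind]
    simp only [hk, Finset.sum_add_distrib, ← Finset.mul_sum, Finset.sum_sub_distrib]
    simp [weight]
  rw [not_le] at hc
  have hm : |(1 - q) * weight (x - u) + q * (n - weight (x - u)) - n * star q D| ≤
      n * (δ / 2) := by
    have e : (1 - q) * weight (x - u) + q * (n - weight (x - u)) - n * star q D =
        (1 - 2 * q) * (weight (x - u) - n * D) := by unfold star; ring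
    have hq : |1 - 2 * q| ≤ 1 := by rw [abs_le]; constructor <;> linarith
    rw [e, abs_mul]
    calc _ ≤ 1 * (n * (ε / 2)) := mul_le_mul hq h (abs_nonneg _) zero_le_one
      _ ≤ n * (δ / 2) := by rw [one_mul]; gcongr
  rw [← hmean] at hm
  have htri := abs_sub_le (weight (x - (u - c)))
    (∑ k, ∑ c, bern q c * ind (x k - (u k - c) = 1)) (n * star q D)
  simp only [weight, Pi.sub_apply] at hc htri
  linarith

/-- Here c is the chosen word of the first code, m the quantization noise and c + m - z = y - c₁.
Averaging the product-like frequencies of (c, m) over the independent z convolves `bern D` with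
`bern p`. -/
lemma sum_not_decTypical_le {n : ℕ} (hn : 0 < n) {p D ε ε' : ℝ} (hp0 : 0 < p) (hp1 : p < 1)
    (hD0 : 0 ≤ D) (hD1 : D ≤ 1) (hε : ε < ε') {c m : Word n} (h : ProductTypical ε D c m) :
    ∑ z : Word n, iidProb (bern p) z *
      ind (¬JointlyTypical ε' (additiveLaw (conv (bern p) (bern D))) c (c + m - z)) ≤
      4 / (n * ((ε' - ε) / 4) ^ 2) := by
  have h0 := bern_nonneg hp0.le hp1.le
  refine le_trans (sum_mul_ind_mono (fun x => iidProb_nonneg h0 x) fun z hz => ?_)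
    (sum_pi_chebyshev_four h0 (sum_bern p) (fun a b k z => ind (c k = a ∧ c k + m k - z = b))
      (fun _ _ _ _ => abs_ind_le_one _) hn (show 0 < (ε' - ε) / 4 by linarith))
  by_contra! hdev
  refine hz (jointlyTypical_of hn (fun a b hab => ?_) fun a b => ?_)
  -- Since 0 < p < 1, the noise p ∗ D charges both symbols, so no pair has probability zero.
  · exfalso
    rw [conv_bern, additiveLaw_bern] at hab
    have hs := star_mem_Ioo hp0 hp1 hD0 hD1
    rcases zmod_two_cases (b - a) with e | e <;> rw [e] at hab <;> simp at hab <;> linarith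
  · have hmean : ∑ k, ∑ z, bern p z * ind (c k = a ∧ c k + m k - z = b) =
        ∑ z, bern p z * pairCount c m a (b - a + z) := by
      rw [Finset.sum_comm]
      refine Finset.sum_congr rfl fun z _ => ?_
      rw [pairCount_eq, Finset.mul_sum]
      refine Finset.sum_congr rfl fun k _ => ?_
      congr 2
      refine propext (and_congr_right fun hk => ?_)
      rw [hk, sub_eq_iff_eq_add, ← eq_sub_iff_add_eq']
      constructor <;> intro h <;> rw [h] <;> abel
    have hlaw : n * additiveLaw (conv (bern p) (bern D)) a b =
        ∑ z, bern p z * (n * (1 / 2 * bern D (b - a + z))) := by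
      have hz : ∀ z : ZMod 2, b - a + z = b - a - z := fun z => by
        rcases zmod_two_cases z with rfl | rfl
        · simp
        · rw [sub_eq_add_neg _ (1 : ZMod 2)]; congr 1
      rw [conv_bern, additiveLaw_bern, ← conv_bern, conv, Finset.mul_sum, Finset.mul_sum]
      refine Finset.sum_congr rfl fun z _ => ?_
      rw [hz]; ring
    have hav := abs_sum_mul_sub_le (g := fun z => (pairCount c m a (b - a + z) : ℝ))
      (g' := fun z => n * (1 / 2 * bern D (b - a + z))) h0 (sum_bern p)
      fun z => (h a (b - a + z)).le
    rw [← hmean, ← hlaw] at hav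
    have h1 := hdev a b
    rw [pairCount_eq]
    have htri := abs_sub_le (∑ k, ind (c k = a ∧ (c + m - z) k = b))
      (∑ k, ∑ z, bern p z * ind (c k = a ∧ c k + m k - z = b))
      (n * additiveLaw (conv (bern p) (bern D)) a b)
    simp only [Pi.sub_apply, Pi.add_apply] at htri ⊢
    linarith

/-! ### Pairs of random codebooks -/

section Codebooks

variable {A B : Type*} [Fintype A] [Fintype B] {α : A → ℝ} {β : B → ℝ} {M₀ M₁ : ℕ}

lemma sum_codebooks_apply (hα : ∑ a, α a = 1) (hβ : ∑ b, β b = 1) (i : Fin M₀) (j : Fin M₁)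
    (g : A → B → ℝ) :
    ∑ c₀ : Fin M₀ → A, ∑ c₁ : Fin M₁ → B, (∏ i, α (c₀ i)) * (∏ j, β (c₁ j)) * g (c₀ i) (c₁ j) =
      ∑ a, ∑ b, α a * β b * g a b := by
  have h1 : ∀ c₀ : Fin M₀ → A, ∑ c₁ : Fin M₁ → B,
      (∏ i, α (c₀ i)) * (∏ j, β (c₁ j)) * g (c₀ i) (c₁ j) =
      (∏ i, α (c₀ i)) * ∑ b, β b * g (c₀ i) b := fun c₀ => by
    rw [← sum_pi_apply hβ j, Finset.mul_sum]
    exact Finset.sum_congr rfl fun _ _ => by ring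
  simp only [h1]
  rw [sum_pi_apply hα i fun a => ∑ b, β b * g a b]
  refine Finset.sum_congr rfl fun a _ => ?_
  rw [Finset.mul_sum]
  exact Finset.sum_congr rfl fun _ _ => by ring

lemma sum_codebooks_one (hα : ∑ a, α a = 1) (hβ : ∑ b, β b = 1) :
    ∑ c₀ : Fin M₀ → A, ∑ c₁ : Fin M₁ → B, (∏ i, α (c₀ i)) * (∏ j, β (c₁ j)) = 1 := by
  simp only [← Finset.mul_sum, sum_pi_prod hβ, mul_one, sum_pi_prod hα]

lemma sum_codebooks_sum (hα : ∑ a, α a = 1) (hβ : ∑ b, β b = 1) (g : A → B → ℝ) :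
    ∑ c₀ : Fin M₀ → A, ∑ c₁ : Fin M₁ → B,
        (∏ i, α (c₀ i)) * (∏ j, β (c₁ j)) * ∑ i, ∑ j, g (c₀ i) (c₁ j) =
      M₀ * M₁ * ∑ a, ∑ b, α a * β b * g a b := by
  have h1 : ∀ c₀ : Fin M₀ → A, ∑ c₁ : Fin M₁ → B,
      (∏ i, α (c₀ i)) * (∏ j, β (c₁ j)) * ∑ i, ∑ j, g (c₀ i) (c₁ j) =
      (∏ i, α (c₀ i)) * ∑ i, M₁ * ∑ b, β b * g (c₀ i) b := fun c₀ => by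
    have := sum_pi_sum (ι := Fin M₁) hβ fun _ b => ∑ i, g (c₀ i) b
    simp only [Finset.sum_const, Finset.card_univ, Fintype.card_fin, nsmul_eq_mul] at this
    simp only [mul_assoc, ← Finset.mul_sum]
    rw [Finset.sum_congr rfl fun (c₁ : Fin M₁ → B) _ => by rw [Finset.sum_comm], this]
    simp only [Finset.mul_sum]
    rw [Finset.sum_comm]
  simp only [h1]
  rw [sum_pi_sum hα fun _ a => M₁ * ∑ b, β b * g a b]
  simp only [Finset.sum_const, Finset.card_univ, Fintype.card_fin, nsmul_eq_mul, mul_assoc,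
    Finset.mul_sum]
  exact Finset.sum_congr rfl fun _ _ => Finset.sum_congr rfl fun _ _ => by ring

/-- The four terms are the ordered pairs of index pairs that agree in both indices, only in the
first, only in the second, or in neither. -/
lemma sum_codebooks_sum_sq (hα : ∑ a, α a = 1) (hβ : ∑ b, β b = 1) (g : A → B → ℝ) :
    ∑ c₀ : Fin M₀ → A, ∑ c₁ : Fin M₁ → B,
        (∏ i, α (c₀ i)) * (∏ j, β (c₁ j)) * (∑ i, ∑ j, g (c₀ i) (c₁ j)) ^ 2 =
      M₀ * M₁ * ∑ a, ∑ b, α a * β b * g a b ^ 2 +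
      M₀ * (M₁ * (M₁ - 1)) * ∑ a, α a * (∑ b, β b * g a b) ^ 2 +
      M₀ * (M₀ - 1) * M₁ * ∑ b, β b * (∑ a, α a * g a b) ^ 2 +
      M₀ * (M₀ - 1) * (M₁ * (M₁ - 1)) * (∑ a, ∑ b, α a * β b * g a b) ^ 2 := by
  rw [Finset.sum_comm]
  have h1 : ∀ c₁ : Fin M₁ → B, ∑ c₀ : Fin M₀ → A,
      (∏ i, α (c₀ i)) * (∏ j, β (c₁ j)) * (∑ i, ∑ j, g (c₀ i) (c₁ j)) ^ 2 =
      M₀ * ∑ a, α a * ((∏ j, β (c₁ j)) * (∑ j, g a (c₁ j)) ^ 2) +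
        M₀ * (M₀ - 1) * ((∏ j, β (c₁ j)) * (∑ j, ∑ a, α a * g a (c₁ j)) ^ 2) := fun c₁ => by
    have := sum_pi_iid_sq (ι := Fin M₀) hα fun a => ∑ j, g a (c₁ j)
    simp only [Fintype.card_fin] at this
    have e1 : ∀ c₀ : Fin M₀ → A, (∏ i, α (c₀ i)) * (∏ j, β (c₁ j)) *
        (∑ i, ∑ j, g (c₀ i) (c₁ j)) ^ 2 = (∏ j, β (c₁ j)) * ((∏ i, α (c₀ i)) *
        (∑ i, ∑ j, g (c₀ i) (c₁ j)) ^ 2) := fun c₀ => by ring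
    have e2 : ∑ a, α a * ∑ j, g a (c₁ j) = ∑ j, ∑ a, α a * g a (c₁ j) := by
      rw [Finset.sum_comm]; exact Finset.sum_congr rfl fun _ _ => Finset.mul_sum ..
    have e3 : ∑ a, α a * ((∏ j, β (c₁ j)) * (∑ j, g a (c₁ j)) ^ 2) =
        (∏ j, β (c₁ j)) * ∑ a, α a * (∑ j, g a (c₁ j)) ^ 2 := by
      rw [Finset.mul_sum]; exact Finset.sum_congr rfl fun _ _ => by ring
    simp only [e1, ← Finset.mul_sum, this, e2, e3]
    ring
  simp only [h1, Finset.sum_add_distrib, ← Finset.mul_sum]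
  rw [Finset.sum_comm, sum_pi_iid_sq hβ fun b => ∑ a, α a * g a b]
  have h2 : ∀ a, ∑ c₁ : Fin M₁ → B, (∏ j, β (c₁ j)) * (∑ j, g a (c₁ j)) ^ 2 =
      M₁ * ∑ b, β b * g a b ^ 2 + M₁ * (M₁ - 1) * (∑ b, β b * g a b) ^ 2 := fun a => by
    simpa using sum_pi_iid_sq (ι := Fin M₁) hβ (g a)
  have h3 : ∑ b, β b * ∑ a, α a * g a b = ∑ a, ∑ b, α a * β b * g a b := by
    rw [Finset.sum_comm]
    refine Finset.sum_congr rfl fun b _ => ?_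
    rw [Finset.mul_sum]; exact Finset.sum_congr rfl fun _ _ => by ring
  have h4 : ∑ a, α a * ∑ b, β b * g a b ^ 2 = ∑ a, ∑ b, α a * β b * g a b ^ 2 :=
    Finset.sum_congr rfl fun a _ => by
      rw [Finset.mul_sum]; exact Finset.sum_congr rfl fun _ _ => by ring
  have h5 : ∀ K L : ℝ, ∑ a, α a * (K * ∑ b, β b * g a b ^ 2 + L * (∑ b, β b * g a b) ^ 2) =
      K * ∑ a, α a * ∑ b, β b * g a b ^ 2 + L * ∑ a, α a * (∑ b, β b * g a b) ^ 2 := fun K L => by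
    rw [Finset.mul_sum, Finset.mul_sum, ← Finset.sum_add_distrib]
    exact Finset.sum_congr rfl fun _ _ => by ring
  simp only [← Finset.mul_sum, h2, h3, h5, Fintype.card_fin]
  rw [h4]
  ring

/-- If a pair of codewords is good with probability at least `π / 2`, then the fraction of good pairs
is unlikely to be less than `π / 4`. -/
lemma sum_codebooks_lower_tail (hα0 : ∀ a, 0 ≤ α a) (hβ0 : ∀ b, 0 ≤ β b) (hα : ∑ a, α a = 1)
    (hβ : ∑ b, β b = 1) (hM₀ : 0 < M₀) (hM₁ : 0 < M₁) (G : A → B → Prop) {π K : ℝ} (hπ : 0 < π)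
    (hmean : π / 2 ≤ ∑ a, ∑ b, α a * β b * ind (G a b))
    (hrow : ∀ a, ∑ b, β b * ind (G a b) ≤ K) (hcol : ∀ b, ∑ a, α a * ind (G a b) ≤ π) :
    ∑ c₀ : Fin M₀ → A, ∑ c₁ : Fin M₁ → B, (∏ i, α (c₀ i)) * (∏ j, β (c₁ j)) *
        ind (∑ i, ∑ j, ind (G (c₀ i) (c₁ j)) < M₀ * M₁ * π / 4) ≤
      4 * (2 / (M₀ * M₁ * π) + 2 * K / (M₀ * π) + 2 / M₁) := by
  set ρ := ∑ a, ∑ b, α a * β b * ind (G a b) with hρ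
  have hm0 : (1 : ℝ) ≤ M₀ := by exact_mod_cast hM₀
  have hm1 : (1 : ℝ) ≤ M₁ := by exact_mod_cast hM₁
  have hρ0 : 0 < ρ := lt_of_lt_of_le (by positivity) hmean
  set μ := M₀ * M₁ * ρ with hμ
  have hμ0 : 0 < μ := by positivity
  have hK : 0 ≤ K := by
    have : ∑ a, ∑ b, α a * β b * ind (G a b) ≤ ∑ a, α a * K := Finset.sum_le_sum fun a _ => by
      simp only [mul_assoc, ← Finset.mul_sum]
      exact mul_le_mul_of_nonneg_left (hrow a) (hα0 a)
    rw [← Finset.sum_mul, hα, one_mul, ← hρ] at this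
    linarith
  have hw : ∀ (c₀ : Fin M₀ → A) (c₁ : Fin M₁ → B), 0 ≤ (∏ i, α (c₀ i)) * (∏ j, β (c₁ j)) :=
    fun c₀ c₁ => mul_nonneg (Finset.prod_nonneg fun _ _ => hα0 _)
      (Finset.prod_nonneg fun _ _ => hβ0 _)
  -- Chebyshev: the event puts the count N below μ/2, half its mean, so its indicator is at most 4
  -- (N/μ - 1)². After expansion the contribution of pairs sharing no index cancels against the
  -- square of the mean.
  have hpt : ∀ (c₀ : Fin M₀ → A) (c₁ : Fin M₁ → B), (∏ i, α (c₀ i)) * (∏ j, β (c₁ j)) *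
      ind (∑ i, ∑ j, ind (G (c₀ i) (c₁ j)) < M₀ * M₁ * π / 4) ≤
      4 / μ ^ 2 * ((∏ i, α (c₀ i)) * (∏ j, β (c₁ j)) * (∑ i, ∑ j, ind (G (c₀ i) (c₁ j))) ^ 2) -
      8 / μ * ((∏ i, α (c₀ i)) * (∏ j, β (c₁ j)) * (∑ i, ∑ j, ind (G (c₀ i) (c₁ j)))) +
      4 * ((∏ i, α (c₀ i)) * (∏ j, β (c₁ j))) := fun c₀ c₁ => by
    set N := ∑ i, ∑ j, ind (G (c₀ i) (c₁ j)) with hN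
    have h1 : ind (N < M₀ * M₁ * π / 4) ≤ 4 * (N / μ - 1) ^ 2 := by
      by_cases h : N < M₀ * M₁ * π / 4
      · have h2 : N < μ / 2 := by
          have : M₀ * M₁ * (π / 2) ≤ μ := mul_le_mul_of_nonneg_left hmean (by positivity)
          linarith
        have h3 : N / μ ≤ 1 / 2 := by rw [div_le_iff₀ hμ0]; linarith
        rw [ind_of h]; nlinarith
      · rw [ind_not h]; positivity
    refine (mul_le_mul_of_nonneg_left h1 (hw c₀ c₁)).trans_eq ?_
    field_simp; ring
  refine (Finset.sum_le_sum fun c₀ _ => Finset.sum_le_sum fun c₁ _ => hpt c₀ c₁).trans ?_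
  simp only [Finset.sum_add_distrib, Finset.sum_sub_distrib, ← Finset.mul_sum (a := 4 / μ ^ 2),
    ← Finset.mul_sum (a := 8 / μ), ← Finset.mul_sum (a := (4 : ℝ)),
    sum_codebooks_sum_sq hα hβ fun a b => ind (G a b), sum_codebooks_one hα hβ, sum_codebooks_sum hα hβ fun a b => ind (G a b)]
  have hsq : ∀ a b, ind (G a b) ^ 2 = ind (G a b) := fun a b => by rw [sq, ind_mul_self]
  simp only [hsq, ← hρ, ← hμ]
  -- Pairs sharing an index: one factor of the square is bounded uniformly, by K or π, and the other
  -- averages to ρ.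
  have hrow' : ∑ a, α a * (∑ b, β b * ind (G a b)) ^ 2 ≤ K * ρ := by
    rw [hρ, Finset.mul_sum]
    refine Finset.sum_le_sum fun a _ => ?_
    have e : ∑ b, α a * β b * ind (G a b) = α a * ∑ b, β b * ind (G a b) := by
      rw [Finset.mul_sum]; exact Finset.sum_congr rfl fun _ _ => by ring
    rw [e, sq]
    have h0 : 0 ≤ ∑ b, β b * ind (G a b) :=
      Finset.sum_nonneg fun b _ => mul_nonneg (hβ0 b) (ind_nonneg _)
    have := mul_le_mul_of_nonneg_right (hrow a) h0
    nlinarith [mul_le_mul_of_nonneg_left this (hα0 a)]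
  have hcol' : ∑ b, β b * (∑ a, α a * ind (G a b)) ^ 2 ≤ π * ρ := by
    rw [hρ, Finset.sum_comm, Finset.mul_sum]
    refine Finset.sum_le_sum fun b _ => ?_
    have e : ∑ a, α a * β b * ind (G a b) = β b * ∑ a, α a * ind (G a b) := by
      rw [Finset.mul_sum]; exact Finset.sum_congr rfl fun _ _ => by ring
    rw [e, sq]
    have h0 : 0 ≤ ∑ a, α a * ind (G a b) :=
      Finset.sum_nonneg fun a _ => mul_nonneg (hα0 a) (ind_nonneg _)
    have := mul_le_mul_of_nonneg_right (hcol b) h0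
    nlinarith [mul_le_mul_of_nonneg_left this (hβ0 b)]
  have hrow0 : 0 ≤ ∑ a, α a * (∑ b, β b * ind (G a b)) ^ 2 :=
    Finset.sum_nonneg fun a _ => mul_nonneg (hα0 a) (sq_nonneg _)
  have hcol0 : 0 ≤ ∑ b, β b * (∑ a, α a * ind (G a b)) ^ 2 :=
    Finset.sum_nonneg fun b _ => mul_nonneg (hβ0 b) (sq_nonneg _)
  set X := ∑ a, α a * (∑ b, β b * ind (G a b)) ^ 2
  set Y := ∑ b, β b * (∑ a, α a * ind (G a b)) ^ 2
  have b1 : M₀ * (M₁ * (M₁ - 1)) * X ≤ M₀ * M₁ * M₁ * (K * ρ) := by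
    calc M₀ * (M₁ * (M₁ - 1)) * X ≤ M₀ * M₁ * M₁ * X := by
          rw [← mul_assoc]; gcongr; linarith
      _ ≤ _ := by gcongr
  have b2 : M₀ * (M₀ - 1) * M₁ * Y ≤ M₀ * M₀ * M₁ * (π * ρ) := by
    calc M₀ * (M₀ - 1) * M₁ * Y ≤ M₀ * M₀ * M₁ * Y := by
          gcongr; linarith
      _ ≤ _ := by gcongr
  have b3 : M₀ * (M₀ - 1) * (M₁ * (M₁ - 1)) * ρ ^ 2 ≤ μ ^ 2 := by
    calc M₀ * (M₀ - 1) * (M₁ * (M₁ - 1)) * ρ ^ 2 ≤ M₀ * M₀ * (M₁ * M₁) * ρ ^ 2 := by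
          have h1 : (0 : ℝ) ≤ M₁ - 1 := by linarith
          gcongr <;> linarith
      _ = μ ^ 2 := by rw [hμ]; ring
  calc _ ≤ 4 / μ ^ 2 * (μ + M₀ * M₁ * M₁ * (K * ρ) + M₀ * M₀ * M₁ * (π * ρ) + μ ^ 2) -
        8 / μ * μ + 4 * 1 := by
        gcongr
    _ = 4 * (1 / (M₀ * M₁ * ρ) + K / (M₀ * ρ) + π / (M₁ * ρ)) := by
        rw [hμ]; field_simp; ring
    _ ≤ 4 * (1 / (M₀ * M₁ * (π / 2)) + K / (M₀ * (π / 2)) + π / (M₁ * (π / 2))) := by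
        gcongr
    _ = _ := by field_simp

end Codebooks

/-! ### Averages over the encoder's choices -/

open Classical in
/-- The probability of `S` when the index pair is drawn uniformly from `encChoices`. -/
noncomputable def choiceAvg {n M₀ M₁ : ℕ} (D ε : ℝ) (c₀ : Fin M₀ → Word n) (c₁ : Fin M₁ → Word n)
    (x : Word n) (S : Fin M₀ × Fin M₁ → Prop) : ℝ :=
  (((encChoices D ε c₀ c₁ x).filter S).card : ℝ) / (encChoices D ε c₀ c₁ x).card

lemma choiceAvg_nonneg {n M₀ M₁ : ℕ} (D ε : ℝ) (c₀ : Fin M₀ → Word n) (c₁ : Fin M₁ → Word n)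
    (x : Word n) (S : Fin M₀ × Fin M₁ → Prop) : 0 ≤ choiceAvg D ε c₀ c₁ x S := by
  unfold choiceAvg; positivity

lemma choiceAvg_eq_sum {n M₀ M₁ : ℕ} (D ε : ℝ) (c₀ : Fin M₀ → Word n) (c₁ : Fin M₁ → Word n)
    (x : Word n) (S : Fin M₀ × Fin M₁ → Prop) : choiceAvg D ε c₀ c₁ x S =
      (∑ s ∈ encChoices D ε c₀ c₁ x, ind (S s)) / (encChoices D ε c₀ c₁ x).card := by
  unfold choiceAvg
  rw [Finset.card_filter]
  push_cast
  rfl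

lemma choiceAvg_le_one {n M₀ M₁ : ℕ} (D ε : ℝ) (c₀ : Fin M₀ → Word n) (c₁ : Fin M₁ → Word n)
    (x : Word n) (S : Fin M₀ × Fin M₁ → Prop) : choiceAvg D ε c₀ c₁ x S ≤ 1 := by
  rw [choiceAvg_eq_sum]
  refine div_le_one_of_le₀ ?_ (by positivity)
  simpa using Finset.sum_le_sum fun s (_ : s ∈ encChoices D ε c₀ c₁ x) => ind_le_one (S s)

/-- Either fewer than τ pairs are typical, which costs at most 1, or the uniform choice is among at
least τ pairs and hits S with probability at most (typical pairs in S)/τ. This replaces the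
selection by a sum over all pairs. -/
lemma choiceAvg_le {n M₀ M₁ : ℕ} (D ε : ℝ) (c₀ : Fin M₀ → Word n) (c₁ : Fin M₁ → Word n)
    (x : Word n) (S : Fin M₀ × Fin M₁ → Prop) {τ : ℝ} (hτ : 0 < τ) :
    choiceAvg D ε c₀ c₁ x S ≤
      ind (∑ i, ∑ j, ind (JointlyTypical ε (additiveLaw (bern D)) (c₀ i + c₁ j) x) < τ) +
      (∑ i, ∑ j, ind (JointlyTypical ε (additiveLaw (bern D)) (c₀ i + c₁ j) x ∧ S (i, j))) / τ := by
  classical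
  set F : Fin M₀ × Fin M₁ → Prop := fun s =>
    JointlyTypical ε (additiveLaw (bern D)) (c₀ s.1 + c₁ s.2) x with hF
  have h0 : 0 ≤ (∑ i, ∑ j, ind (F (i, j) ∧ S (i, j))) / τ :=
    div_nonneg (Finset.sum_nonneg fun i _ => Finset.sum_nonneg fun j _ => ind_nonneg _) hτ.le
  by_cases hN : ∑ i, ∑ j, ind (F (i, j)) < τ
  · have := choiceAvg_le_one D ε c₀ c₁ x S
    rw [ind_of hN]
    exact this.trans (le_add_of_nonneg_right h0)
  rw [ind_not hN, zero_add]
  have hex : ∃ s, F s := by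
    by_contra! hno
    apply hN
    simpa [ind_not (hno _)] using hτ
  have hch : encChoices D ε c₀ c₁ x = Finset.univ.filter F := by
    unfold encChoices orAll
    rw [if_pos hex]
  have e1 : ((Finset.univ.filter F).card : ℝ) = ∑ i, ∑ j, ind (F (i, j)) := by
    rw [← Fintype.sum_prod_type' (f := fun i j => ind (F (i, j))), Finset.card_filter]
    push_cast
    exact Finset.sum_congr rfl fun s _ => by unfold ind; congr
  have e2 : ∑ s ∈ Finset.univ.filter F, ind (S s) = ∑ i, ∑ j, ind (F (i, j) ∧ S (i, j)) := by
    rw [← Fintype.sum_prod_type' (f := fun i j => ind (F (i, j) ∧ S (i, j))), Finset.sum_filter]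
    refine Finset.sum_congr rfl fun s _ => ?_
    rw [ind_and]
    by_cases h : F s
    · rw [if_pos h, ind_of (show F (s.1, s.2) from h), one_mul]
    · rw [if_neg h, ind_not (show ¬F (s.1, s.2) from h), zero_mul]
  rw [choiceAvg_eq_sum, hch, e1, e2]
  rw [not_lt] at hN
  gcongr
  exact Finset.sum_nonneg fun i _ => Finset.sum_nonneg fun j _ => ind_nonneg _

/-- Since y is uniform, x = y + z is uniform and independent of z. In these coordinates the set
offered to the encoder depends on x and the codes only, so z is fresh noise. -/
lemma schemeProb_eq {p q D ε : ℝ} {n M₀ M₁ : ℕ}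
    (E : (Fin M₀ → Word n) → (Fin M₁ → Word n) → Word n → Word n → Fin M₀ × Fin M₁ → Prop) :
    schemeProb p q D ε n M₀ M₁ E = ∑ x : Word n, iidProb (bern (1 / 2)) x *
      ∑ c₀ : Fin M₀ → Word n, ∑ c₁ : Fin M₁ → Word n,
        (∏ i, iidProb (bern (1 / 2)) (c₀ i)) * (∏ j, iidProb (bern q) (c₁ j)) *
          ∑ z : Word n, iidProb (bern p) z * choiceAvg D ε c₀ c₁ x (E c₀ c₁ (x - z) z) := by
  have h1 : ∀ (c₀ : Fin M₀ → Word n) (c₁ : Fin M₁ → Word n), ∑ y : Word n, ∑ z : Word n,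
      (∏ i, iidProb (bern (1 / 2)) (c₀ i)) * (∏ j, iidProb (bern q) (c₁ j)) *
        iidProb (bern (1 / 2)) y * iidProb (bern p) z * choiceAvg D ε c₀ c₁ (y + z) (E c₀ c₁ y z) =
      ∑ x : Word n, iidProb (bern (1 / 2)) x *
        ((∏ i, iidProb (bern (1 / 2)) (c₀ i)) * (∏ j, iidProb (bern q) (c₁ j)) *
          ∑ z : Word n, iidProb (bern p) z * choiceAvg D ε c₀ c₁ x (E c₀ c₁ (x - z) z)) := by
    intro c₀ c₁
    simp only [Finset.mul_sum]
    rw [Finset.sum_comm]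
    conv_rhs => rw [Finset.sum_comm]
    refine Finset.sum_congr rfl fun z _ => ?_
    rw [← Equiv.sum_comp (Equiv.subRight z)]
    refine Finset.sum_congr rfl fun x _ => ?_
    simp only [Equiv.subRight_apply, sub_add_cancel, iidProb_half]
    ring
  have h2 : schemeProb p q D ε n M₀ M₁ E =
      ∑ c₀ : Fin M₀ → Word n, ∑ c₁ : Fin M₁ → Word n, ∑ y : Word n, ∑ z : Word n,
      (∏ i, iidProb (bern (1 / 2)) (c₀ i)) * (∏ j, iidProb (bern q) (c₁ j)) *
        iidProb (bern (1 / 2)) y * iidProb (bern p) z *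
          choiceAvg D ε c₀ c₁ (y + z) (E c₀ c₁ y z) := rfl
  rw [h2]
  simp only [h1]
  rw [Finset.sum_congr rfl fun c₀ _ => Finset.sum_comm, Finset.sum_comm]
  simp only [Finset.mul_sum]

/-! ### Covering a source word -/

lemma bern_half_nonneg (a : ZMod 2) : 0 ≤ bern (1 / 2) a :=
  bern_nonneg (by norm_num) (by norm_num) a

lemma sum_iidProb_mul_iidProb_sub {n : ℕ} (P Q : ZMod 2 → ℝ) (v : Word n) :
    ∑ b : Word n, iidProb P b * iidProb Q (v - b) = iidProb (conv P Q) v :=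
  sum_pi_prod_mul_prod (α := P) fun k a => Q (v k - a)

lemma sum_half_sub {n : ℕ} (b : Word n) (φ : Word n → ℝ) :
    ∑ a : Word n, iidProb (bern (1 / 2)) a * φ a =
      ∑ u : Word n, iidProb (bern (1 / 2)) u * φ (u - b) := by
  rw [← Equiv.sum_comp (Equiv.subRight b)]
  simp only [Equiv.subRight_apply, iidProb_half]

/-- The probability that a uniform word is jointly typical with `x`. -/
noncomputable def coverProb {n : ℕ} (D ε : ℝ) (x : Word n) : ℝ :=
  ∑ u : Word n, iidProb (bern (1 / 2)) u * ind (JointlyTypical ε (additiveLaw (bern D)) u x)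

lemma sum_half_add_eq_coverProb {n : ℕ} (D ε : ℝ) (x b : Word n) :
    ∑ a : Word n, iidProb (bern (1 / 2)) a *
      ind (JointlyTypical ε (additiveLaw (bern D)) (a + b) x) = coverProb D ε x := by
  rw [sum_half_sub b]
  simp only [sub_add_cancel, coverProb]

/-- `ε₀` is a tolerance within which the likelihoods of `B(r)` are `2 ^ (-n (H(r) ± δ))`. -/
def LikelihoodTolerance (r δ ε₀ : ℝ) : Prop :=
  ∀ (n : ℕ) (w : Word n), (r = 0 → ∀ k, w k = 0) → |weight w - n * r| ≤ n * ε₀ →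
    (2 : ℝ) ^ (-(n * (h2 r + δ))) ≤ iidProb (bern r) w ∧
      iidProb (bern r) w ≤ (2 : ℝ) ^ (-(n * (h2 r - δ)))

lemma JointlyTypical.likelihood {n : ℕ} {r δ ε ε₀ : ℝ} (hr : LikelihoodTolerance r δ ε₀)
    (hn : 0 < n) (hε : ε / 2 ≤ ε₀) {u v : Word n}
    (h : JointlyTypical ε (additiveLaw (bern r)) u v) :
    (2 : ℝ) ^ (-(n * (h2 r + δ))) ≤ iidProb (bern r) (v - u) ∧
      iidProb (bern r) (v - u) ≤ (2 : ℝ) ^ (-(n * (h2 r - δ))) := by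
  obtain ⟨h1, h2⟩ := h.abs_weight_sub_le hn
  exact hr n _ h1 (h2.trans (by gcongr))

lemma half_pow_eq (n : ℕ) : ((1 : ℝ) / 2) ^ n = (2 : ℝ) ^ (-(n : ℝ)) := by
  rw [Real.rpow_neg (by norm_num), Real.rpow_natCast, one_div, inv_pow]

/-- At least half of the noise mass makes x - s typical with x, and each such s has probability at
most 2^(-n(H(D) - δ)). This bounds the number of typical words from below; multiplication by 2^(-n)
gives the probability. -/
lemma coverProb_ge {n : ℕ} (hn : 0 < n) {D ε δ ε₀ : ℝ} (hD0 : 0 ≤ D) (hD1 : D < 1) (hε : 0 < ε)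
    (hr : LikelihoodTolerance D δ ε₀) (hε₀ : ε / 2 ≤ ε₀) (hlarge : 4 / (n * (ε / 8) ^ 2) ≤ 1 / 2)
    {x : Word n} (hx : Balanced (ε / 8) x) :
    1 / 2 * (2 : ℝ) ^ (-(n * (1 - h2 D + δ))) ≤ coverProb D ε x := by
  have h1 := sum_noise_jointlyTypical_ge hn hD0 hD1 hε hx
  have h2' : ∑ s : Word n, iidProb (bern D) s *
      ind (JointlyTypical ε (additiveLaw (bern D)) (x - s) x) ≤
      ∑ s : Word n, (2 : ℝ) ^ (-(n * (h2 D - δ))) *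
        ind (JointlyTypical ε (additiveLaw (bern D)) (x - s) x) := by
    refine Finset.sum_le_sum fun s _ => ?_
    by_cases h : JointlyTypical ε (additiveLaw (bern D)) (x - s) x
    · have := (h.likelihood hr hn hε₀).2
      rw [sub_sub_cancel] at this
      exact mul_le_mul_of_nonneg_right this (ind_nonneg _)
    · simp [ind_not h]
  rw [← Finset.mul_sum] at h2'
  have h3 : coverProb D ε x = (2 : ℝ) ^ (-(n : ℝ)) *
      ∑ s : Word n, ind (JointlyTypical ε (additiveLaw (bern D)) (x - s) x) := by
    simp only [coverProb, iidProb_half, ← Finset.mul_sum, half_pow_eq]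
    congr 1
    exact (Equiv.sum_comp (Equiv.subLeft x) fun u =>
      ind (JointlyTypical ε (additiveLaw (bern D)) u x)).symm
  have h4 : (2 : ℝ) ^ (-(n * (1 - h2 D + δ))) * (2 : ℝ) ^ (-(n * (h2 D - δ))) =
      (2 : ℝ) ^ (-(n : ℝ)) := by
    rw [← Real.rpow_add (by norm_num)]; congr 1; ring
  rw [h3, ← h4]
  have h5 : (0 : ℝ) < (2 : ℝ) ^ (-(n * (1 - h2 D + δ))) := by positivity
  nlinarith

/-- With u = a + b, the word u is uniform and independent of b. Given a typical u, the noise b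
brings x - a = x - u + b to weight about n (q ∗ D), so the weight condition loses at most half of
the mass. -/
lemma sum_good_ge {n : ℕ} (hn : 0 < n) {q D ε δ : ℝ} (hq0 : 0 ≤ q) (hq1 : q ≤ 1) (hδ : 0 < δ)
    (hε : ε ≤ δ) (hlarge : 1 / (n * (δ / 2) ^ 2) ≤ 1 / 2) (x : Word n) :
    coverProb D ε x / 2 ≤ ∑ a : Word n, ∑ b : Word n,
      iidProb (bern (1 / 2)) a * iidProb (bern q) b *
        ind (JointlyTypical ε (additiveLaw (bern D)) (a + b) x ∧
          |weight (x - a) - n * star q D| ≤ n * δ) := by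
  have h0 := bern_nonneg hq0 hq1
  rw [Finset.sum_comm]
  have e : ∀ b : Word n, ∑ a : Word n, iidProb (bern (1 / 2)) a * iidProb (bern q) b *
        ind (JointlyTypical ε (additiveLaw (bern D)) (a + b) x ∧
          |weight (x - a) - n * star q D| ≤ n * δ) =
      ∑ u : Word n, iidProb (bern (1 / 2)) u * (iidProb (bern q) b *
        ind (JointlyTypical ε (additiveLaw (bern D)) u x ∧
          |weight (x - (u - b)) - n * star q D| ≤ n * δ)) := fun b => by
    simp only [mul_assoc]
    rw [sum_half_sub b]
    simp only [sub_add_cancel]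
  simp only [e]
  rw [Finset.sum_comm, coverProb, Finset.sum_div]
  refine Finset.sum_le_sum fun u _ => ?_
  rw [← Finset.mul_sum, mul_div_assoc]
  refine mul_le_mul_of_nonneg_left ?_ (iidProb_nonneg bern_half_nonneg u)
  by_cases h : JointlyTypical ε (additiveLaw (bern D)) u x
  · have h1 := sum_weight_dev_le hn hq0 hq1 hδ hε (h.abs_weight_sub_le hn).2
    have h2 : ∑ b : Word n, iidProb (bern q) b *
        ind (JointlyTypical ε (additiveLaw (bern D)) u x ∧
          |weight (x - (u - b)) - n * star q D| ≤ n * δ) +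
        ∑ b : Word n, iidProb (bern q) b *
          ind (¬|weight (x - (u - b)) - n * star q D| ≤ n * δ) = 1 := by
      rw [← Finset.sum_add_distrib, ← sum_iidProb (n := n) (sum_bern q)]
      refine Finset.sum_congr rfl fun b _ => ?_
      by_cases hb : |weight (x - (u - b)) - n * star q D| ≤ n * δ <;> simp [ind, h, hb]
    rw [ind_of h]
    linarith
  · rw [ind_not h, zero_div]
    exact Finset.sum_nonneg fun b _ => mul_nonneg (iidProb_nonneg h0 b) (ind_nonneg _)

/-- The convolution identity writes the B(q ∗ D) probability of x - a as a sum over b of the B(q)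
probability of b times the B(D) probability of x - a - b. Typical terms have second factor at least
2^(-n(H(D) + δ)), while the weight condition bounds the total by 2^(-n(H(q ∗ D) - δ)). Without that
condition an a too close to x could have far too many typical partners. -/
lemma sum_row_le {n : ℕ} (hn : 0 < n) {q D ε δ ε₀ ε₁ : ℝ} (hq0 : 0 ≤ q) (hq1 : q ≤ 1)
    (hD0 : 0 ≤ D) (hD1 : D ≤ 1) (hs : 0 < star q D) (hr : LikelihoodTolerance D δ ε₀)
    (hε₀ : ε / 2 ≤ ε₀) (hr' : LikelihoodTolerance (star q D) δ ε₁) (x a : Word n) :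
    ∑ b : Word n, iidProb (bern q) b *
      ind (JointlyTypical ε (additiveLaw (bern D)) (a + b) x ∧
        |weight (x - a) - n * star q D| ≤ n * ε₁) ≤
      (2 : ℝ) ^ (-(n * (h2 (star q D) - h2 D - 2 * δ))) := by
  have h0 := bern_nonneg hq0 hq1
  have h0' := bern_nonneg hD0 hD1
  by_cases ha : |weight (x - a) - n * star q D| ≤ n * ε₁
  · have h1 : (2 : ℝ) ^ (-(n * (h2 D + δ))) * ∑ b : Word n, iidProb (bern q) b *
        ind (JointlyTypical ε (additiveLaw (bern D)) (a + b) x ∧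
          |weight (x - a) - n * star q D| ≤ n * ε₁) ≤ iidProb (bern (star q D)) (x - a) := by
      rw [← conv_bern, ← sum_iidProb_mul_iidProb_sub, Finset.mul_sum]
      refine Finset.sum_le_sum fun b _ => ?_
      by_cases h : JointlyTypical ε (additiveLaw (bern D)) (a + b) x
      · have := (h.likelihood hr hn hε₀).1
        rw [← sub_sub] at this
        rw [ind_of ⟨h, ha⟩, mul_one, mul_comm]
        exact mul_le_mul_of_nonneg_left this (iidProb_nonneg h0 b)
      · rw [ind_not fun h' => h h'.1, mul_zero, mul_zero]
        exact mul_nonneg (iidProb_nonneg h0 b) (iidProb_nonneg h0' _)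
    have h2' := (hr' n (x - a) (fun h => absurd h hs.ne') ha).2
    have h3 : (2 : ℝ) ^ (-(n * (h2 (star q D) - δ))) = (2 : ℝ) ^ (-(n * (h2 D + δ))) *
        (2 : ℝ) ^ (-(n * (h2 (star q D) - h2 D - 2 * δ))) := by
      rw [← Real.rpow_add (by norm_num)]; congr 1; ring
    rw [h3] at h2'
    exact le_of_mul_le_mul_left (h1.trans h2') (by positivity)
  · refine le_trans (le_of_eq ?_) (by positivity : (0 : ℝ) ≤ _)
    exact Finset.sum_eq_zero fun b _ => by rw [ind_not fun h' => ha h'.2, mul_zero]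

/-- The lower tail of the number of pairs of codewords whose sum is jointly typical with `x`. -/
lemma sum_cover_lower_tail {n M₀ M₁ : ℕ} (hn : 0 < n) (hM₀ : 0 < M₀) (hM₁ : 0 < M₁)
    {q D ε δ ε₀ ε₁ : ℝ} (hq0 : 0 ≤ q) (hq1 : q ≤ 1) (hD0 : 0 ≤ D) (hD1 : D < 1)
    (hs : 0 < star q D) (hr : LikelihoodTolerance D δ ε₀) (hε₀ : ε / 2 ≤ ε₀)
    (hr' : LikelihoodTolerance (star q D) δ ε₁) (hε₁ : 0 < ε₁) (hεε₁ : ε ≤ ε₁)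
    (hlarge' : 1 / (n * (ε₁ / 2) ^ 2) ≤ 1 / 2) {x : Word n} (hpos : 0 < coverProb D ε x) :
    ∑ c₀ : Fin M₀ → Word n, ∑ c₁ : Fin M₁ → Word n,
      (∏ i, iidProb (bern (1 / 2)) (c₀ i)) * (∏ j, iidProb (bern q) (c₁ j)) *
        ind (∑ i, ∑ j, ind (JointlyTypical ε (additiveLaw (bern D)) (c₀ i + c₁ j) x) <
          M₀ * M₁ * coverProb D ε x / 4) ≤
      4 * (2 / (M₀ * M₁ * coverProb D ε x) +
        2 * (2 : ℝ) ^ (-(n * (h2 (star q D) - h2 D - 2 * δ))) / (M₀ * coverProb D ε x) +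
          2 / M₁) := by
  have h0 := bern_nonneg hq0 hq1
  have hα0 : ∀ a : Word n, 0 ≤ iidProb (bern (1 / 2)) a := iidProb_nonneg bern_half_nonneg
  have hβ0 : ∀ a : Word n, 0 ≤ iidProb (bern q) a := iidProb_nonneg h0
  -- The tail bound is proved for pairs that also satisfy the weight condition; all typical pairs
  -- are at least as many, so the bound carries over.
  have h := sum_codebooks_lower_tail hα0 hβ0
    (sum_iidProb (n := n) (sum_bern _)) (sum_iidProb (sum_bern q)) hM₀ hM₁
    (fun a b => JointlyTypical ε (additiveLaw (bern D)) (a + b) x ∧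
      |weight (x - a) - n * star q D| ≤ n * ε₁) hpos
    (sum_good_ge hn hq0 hq1 hε₁ hεε₁ hlarge' x)
    (sum_row_le hn hq0 hq1 hD0 hD1.le hs hr hε₀ hr' x) (fun b => ?_)
  · refine le_trans (Finset.sum_le_sum fun c₀ _ => Finset.sum_le_sum fun c₁ _ => ?_) h
    refine mul_le_mul_of_nonneg_left (ind_mono fun hlt => lt_of_le_of_lt ?_ hlt)
      (mul_nonneg (Finset.prod_nonneg fun _ _ => hα0 _) (Finset.prod_nonneg fun _ _ => hβ0 _))
    exact Finset.sum_le_sum fun i _ => Finset.sum_le_sum fun j _ => ind_mono fun h => h.1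
  · rw [← sum_half_add_eq_coverProb D ε x b]
    exact sum_mul_ind_mono hα0 fun a h => h.1

/-! ### Errors of the decoder -/

/-- For fixed typical u = a + b, typicality survives two independent perturbations: b, which turns u
into a, and then z. Each uses one of the gaps ε < ε'' < ε'. The factor `coverProb` is the
probability of a typical u. -/
lemma sum_first_not_decTypical_le {n : ℕ} (hn : 0 < n) {p q D ε ε'' ε' : ℝ} (hp0 : 0 < p)
    (hp1 : p < 1) (hq0 : 0 ≤ q) (hq1 : q ≤ 1) (hD0 : 0 ≤ D) (hD1 : D ≤ 1) (hε : ε < ε'')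
    (hε' : ε'' < ε') (x : Word n) :
    ∑ a : Word n, ∑ b : Word n, iidProb (bern (1 / 2)) a * iidProb (bern q) b *
      ∑ z : Word n, iidProb (bern p) z * ind (JointlyTypical ε (additiveLaw (bern D)) (a + b) x ∧
        ¬JointlyTypical ε' (additiveLaw (conv (bern p) (bern D))) a (x - z - b)) ≤
      coverProb D ε x * (4 / (n * ((ε'' - ε) / 4) ^ 2) + 4 / (n * ((ε' - ε'') / 4) ^ 2)) := by
  have h0 := bern_nonneg hq0 hq1
  have h0' := bern_nonneg hp0.le hp1.le
  rw [Finset.sum_comm]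
  have e : ∀ b : Word n, ∑ a : Word n, iidProb (bern (1 / 2)) a * iidProb (bern q) b *
      ∑ z : Word n, iidProb (bern p) z * ind (JointlyTypical ε (additiveLaw (bern D)) (a + b) x ∧
        ¬JointlyTypical ε' (additiveLaw (conv (bern p) (bern D))) a (x - z - b)) =
      ∑ u : Word n, iidProb (bern (1 / 2)) u * (iidProb (bern q) b *
      ∑ z : Word n, iidProb (bern p) z * ind (JointlyTypical ε (additiveLaw (bern D)) u x ∧
        ¬JointlyTypical ε' (additiveLaw (conv (bern p) (bern D))) (u - b) (x - z - b))) :=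
      fun b => by
    simp only [mul_assoc]
    rw [sum_half_sub b]
    simp only [sub_add_cancel]
  simp only [e]
  rw [Finset.sum_comm, coverProb, Finset.sum_mul]
  refine Finset.sum_le_sum fun u _ => ?_
  rw [← Finset.mul_sum, mul_assoc]
  refine mul_le_mul_of_nonneg_left ?_ (iidProb_nonneg bern_half_nonneg u)
  by_cases h : JointlyTypical ε (additiveLaw (bern D)) u x
  swap
  · simp [h, ind]
  rw [ind_of h, one_mul]
  have hb : ∀ b : Word n, iidProb (bern q) b *
      ∑ z : Word n, iidProb (bern p) z * ind (JointlyTypical ε (additiveLaw (bern D)) u x ∧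
        ¬JointlyTypical ε' (additiveLaw (conv (bern p) (bern D))) (u - b) (x - z - b)) ≤
      iidProb (bern q) b * ind (¬ProductTypical ε'' D (u - b) (x - u)) +
        iidProb (bern q) b * (4 / (n * ((ε' - ε'') / 4) ^ 2)) := fun b => by
    rw [← mul_add]
    refine mul_le_mul_of_nonneg_left ?_ (iidProb_nonneg h0 b)
    by_cases hP : ProductTypical ε'' D (u - b) (x - u)
    · have := sum_not_decTypical_le hn hp0 hp1 hD0 hD1 hε' hP
      have hxz : ∀ z, u - b + (x - u) - z = x - z - b := fun z => by abel
      simp only [hxz] at this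
      have hle := sum_mul_ind_mono (iidProb_nonneg (n := n) h0')
        (P := fun z => JointlyTypical ε (additiveLaw (bern D)) u x ∧
        ¬JointlyTypical ε' (additiveLaw (conv (bern p) (bern D))) (u - b) (x - z - b))
        (Q := fun z => ¬JointlyTypical ε' (additiveLaw (conv (bern p) (bern D))) (u - b) (x - z - b))
        fun z hz => hz.2
      have := ind_nonneg (¬ProductTypical ε'' D (u - b) (x - u))
      linarith
    · rw [ind_of hP]
      have : ∑ z : Word n, iidProb (bern p) z *
          ind (JointlyTypical ε (additiveLaw (bern D)) u x ∧
        ¬JointlyTypical ε' (additiveLaw (conv (bern p) (bern D))) (u - b) (x - z - b)) ≤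
          ∑ z : Word n, iidProb (bern p) z := Finset.sum_le_sum fun z _ =>
        mul_le_of_le_one_right (iidProb_nonneg h0' z) (ind_le_one _)
      rw [sum_iidProb (sum_bern p)] at this
      have : 0 ≤ 4 / (n * ((ε' - ε'') / 4) ^ 2) := by positivity
      linarith
  refine (Finset.sum_le_sum fun b _ => hb b).trans ?_
  rw [Finset.sum_add_distrib, ← Finset.sum_mul, sum_iidProb (sum_bern q), one_mul]
  exact add_le_add_left (sum_not_productTypical_le hn hq0 hq1 hε (h.productTypical hn)) _

/-- Each typical a gives w - a probability at least 2^(-n(H(r) + δ)), so there are at most 2^(n(H(r)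
+ δ)) of them among the 2^n words. -/
lemma sum_half_decTypical_le {n : ℕ} (hn : 0 < n) {r δ ε ε₀ : ℝ} (hr0 : 0 ≤ r) (hr1 : r ≤ 1)
    (hr : LikelihoodTolerance r δ ε₀) (hε₀ : ε / 2 ≤ ε₀) (w : Word n) :
    ∑ a : Word n, iidProb (bern (1 / 2)) a * ind (JointlyTypical ε (additiveLaw (bern r)) a w) ≤
      (2 : ℝ) ^ (-(n * (1 - h2 r - δ))) := by
  have h1 : (2 : ℝ) ^ (-(n * (h2 r + δ))) *
      ∑ a : Word n, ind (JointlyTypical ε (additiveLaw (bern r)) a w) ≤ 1 := by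
    rw [← sum_iidProb_sub (sum_bern r) w, Finset.mul_sum]
    refine Finset.sum_le_sum fun a _ => ?_
    by_cases h : JointlyTypical ε (additiveLaw (bern r)) a w
    · rw [ind_of h, mul_one]; exact (h.likelihood hr hn hε₀).1
    · rw [ind_not h, mul_zero]; exact iidProb_nonneg (bern_nonneg hr0 hr1) _
  simp only [iidProb_half, ← Finset.mul_sum, half_pow_eq]
  have h2 : (2 : ℝ) ^ (-(n : ℝ)) = (2 : ℝ) ^ (-(n * (1 - h2 r - δ))) *
      (2 : ℝ) ^ (-(n * (h2 r + δ))) := by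
    rw [← Real.rpow_add (by norm_num)]; congr 1; ring
  rw [h2, mul_assoc]
  exact mul_le_of_le_one_right (by positivity) h1

lemma sum_mul_sum_mul_sum_comm {I X Y Z : Type*} [Fintype X] [Fintype Y] [Fintype Z]
    (S : Finset I) (u : X → Y → ℝ) (v : Z → ℝ) (g : I → X → Y → Z → ℝ) :
    ∑ x, ∑ y, u x y * ∑ z, v z * ∑ i ∈ S, g i x y z =
      ∑ i ∈ S, ∑ x, ∑ y, u x y * ∑ z, v z * g i x y z := by
  simp only [Finset.mul_sum]
  rw [Finset.sum_congr rfl fun x _ => Finset.sum_congr rfl fun y _ => Finset.sum_comm,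
    Finset.sum_congr rfl fun x _ => Finset.sum_comm, Finset.sum_comm]

/-- The expected number of jointly typical pairs of codewords that lead to a decoder error. -/
lemma sum_decError_le {n M₀ M₁ : ℕ} (hn : 0 < n) {p q D ε ε'' ε' δ ε₂ : ℝ} (hp0 : 0 < p)
    (hp1 : p < 1) (hq0 : 0 ≤ q) (hq1 : q ≤ 1) (hD0 : 0 ≤ D) (hD1 : D ≤ 1) (hε : ε < ε'')
    (hε' : ε'' < ε') (hr : LikelihoodTolerance (star p D) δ ε₂) (hε₂ : ε' / 2 ≤ ε₂) (x : Word n) :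
    ∑ c₀ : Fin M₀ → Word n, ∑ c₁ : Fin M₁ → Word n,
      (∏ i, iidProb (bern (1 / 2)) (c₀ i)) * (∏ j, iidProb (bern q) (c₁ j)) *
        ∑ z : Word n, iidProb (bern p) z *
          ∑ i, ∑ j, ind (JointlyTypical ε (additiveLaw (bern D)) (c₀ i + c₁ j) x ∧
            ¬(DecTypical p D ε' c₀ (x - z - c₁ j) i ∧
              ∀ i', DecTypical p D ε' c₀ (x - z - c₁ j) i' → i' = i)) ≤
      M₀ * M₁ * coverProb D ε x * (4 / (n * ((ε'' - ε) / 4) ^ 2) +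
        4 / (n * ((ε' - ε'') / 4) ^ 2) + M₀ * (2 : ℝ) ^ (-(n * (1 - h2 (star p D) - δ)))) := by
  have h0 := bern_nonneg hq0 hq1
  have h0' := bern_nonneg hp0.le hp1.le
  have hα0 : ∀ a : Word n, 0 ≤ iidProb (bern (1 / 2)) a := iidProb_nonneg bern_half_nonneg
  have hβ0 : ∀ a : Word n, 0 ≤ iidProb (bern q) a := iidProb_nonneg h0
  have hα := sum_iidProb (n := n) (sum_bern (1 / 2))
  have hβ := sum_iidProb (n := n) (sum_bern q)
  have hstar := star_mem_Ioo hp0 hp1 hD0 hD1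
  set κ := 4 / (n * ((ε'' - ε) / 4) ^ 2) + 4 / (n * ((ε' - ε'') / 4) ^ 2) with hκ
  set ρ := (2 : ℝ) ^ (-(n * (1 - h2 (star p D) - δ))) with hρ
  set π := coverProb D ε x with hπ
  have hπ0 : 0 ≤ π := Finset.sum_nonneg fun u _ => mul_nonneg (hα0 u) (ind_nonneg _)
  set F : Word n → Word n → Prop := fun a b => JointlyTypical ε (additiveLaw (bern D)) (a + b) x
  set V : Word n → Word n → Prop := fun a w =>
    JointlyTypical ε' (additiveLaw (conv (bern p) (bern D))) a w with hV
  -- A typical pair leads to a decoder error only if its own first word fails the test or some other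
  -- first word passes it; the latter event is bounded by a union bound.
  have hpt : ∀ (c₀ : Fin M₀ → Word n) (c₁ : Fin M₁ → Word n) (z : Word n) (i : Fin M₀)
      (j : Fin M₁), ind (F (c₀ i) (c₁ j) ∧ ¬(DecTypical p D ε' c₀ (x - z - c₁ j) i ∧
              ∀ i', DecTypical p D ε' c₀ (x - z - c₁ j) i' → i' = i)) ≤
      ind (F (c₀ i) (c₁ j) ∧ ¬V (c₀ i) (x - z - c₁ j)) +
        ∑ i' ∈ Finset.univ.erase i, ind (F (c₀ i) (c₁ j)) * ind (V (c₀ i') (x - z - c₁ j)) := by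
    intro c₀ c₁ z i j
    have hnn : ∀ i' ∈ Finset.univ.erase i,
        0 ≤ ind (F (c₀ i) (c₁ j)) * ind (V (c₀ i') (x - z - c₁ j)) := fun i' _ =>
      mul_nonneg (ind_nonneg _) (ind_nonneg _)
    by_cases hF : F (c₀ i) (c₁ j)
    swap
    · rw [ind_not fun h => hF h.1]
      exact add_nonneg (ind_nonneg _) (Finset.sum_nonneg hnn)
    by_cases hVi : V (c₀ i) (x - z - c₁ j)
    swap
    · rw [ind_of (show F (c₀ i) (c₁ j) ∧ ¬V (c₀ i) (x - z - c₁ j) from ⟨hF, hVi⟩)]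
      exact (ind_le_one _).trans (le_add_of_nonneg_right (Finset.sum_nonneg hnn))
    by_cases hex : ∃ i', V (c₀ i') (x - z - c₁ j) ∧ i' ≠ i
    · obtain ⟨i', h1, h2⟩ := hex
      have := Finset.single_le_sum hnn (Finset.mem_erase.2 ⟨h2, Finset.mem_univ i'⟩)
      rw [ind_of hF, ind_of h1, one_mul] at this
      refine (ind_le_one _).trans ?_
      rw [ind_of hF]
      exact this.trans (le_add_of_nonneg_left (ind_nonneg _))
    · push Not at hex
      rw [ind_not fun h => h.2 ⟨hVi, hex⟩]
      exact add_nonneg (ind_nonneg _) (Finset.sum_nonneg hnn)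
  have hfirst : ∀ (i : Fin M₀) (j : Fin M₁), ∑ c₀ : Fin M₀ → Word n, ∑ c₁ : Fin M₁ → Word n,
      (∏ i, iidProb (bern (1 / 2)) (c₀ i)) * (∏ j, iidProb (bern q) (c₁ j)) *
        ∑ z : Word n, iidProb (bern p) z *
          ind (F (c₀ i) (c₁ j) ∧ ¬V (c₀ i) (x - z - c₁ j)) ≤ π * κ := fun i j => by
    have := sum_codebooks_apply hα hβ i j fun a b => ∑ z : Word n, iidProb (bern p) z *
          ind (F a b ∧ ¬V a (x - z - b))
    rw [this]
    exact sum_first_not_decTypical_le hn hp0 hp1 hq0 hq1 hD0 hD1 hε hε' x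
  -- For i' ≠ i the two first words are independent given c₁ and z, so the expectation factors into
  -- the covering probability and the probability of a false match.
  have hsecond : ∀ (i i' : Fin M₀) (j : Fin M₁), i' ≠ i →
      ∑ c₀ : Fin M₀ → Word n, ∑ c₁ : Fin M₁ → Word n,
      (∏ i, iidProb (bern (1 / 2)) (c₀ i)) * (∏ j, iidProb (bern q) (c₁ j)) *
        ∑ z : Word n, iidProb (bern p) z *
          (ind (F (c₀ i) (c₁ j)) * ind (V (c₀ i') (x - z - c₁ j))) ≤ π * ρ := by
    intro i i' j hne
    have e : ∀ (c₁ : Fin M₁ → Word n), ∑ c₀ : Fin M₀ → Word n,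
        (∏ i, iidProb (bern (1 / 2)) (c₀ i)) * (∏ j, iidProb (bern q) (c₁ j)) *
        ∑ z : Word n, iidProb (bern p) z *
          (ind (F (c₀ i) (c₁ j)) * ind (V (c₀ i') (x - z - c₁ j))) =
        (∏ j, iidProb (bern q) (c₁ j)) * ∑ z : Word n, iidProb (bern p) z *
          ((∑ a, iidProb (bern (1 / 2)) a * ind (F a (c₁ j))) *
            ∑ a, iidProb (bern (1 / 2)) a * ind (V a (x - z - c₁ j))) := fun c₁ => by
      simp only [← sum_pi_apply_two hα hne.symm, Finset.mul_sum]
      rw [Finset.sum_comm]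
      refine Finset.sum_congr rfl fun z _ => Finset.sum_congr rfl fun c₀ _ => ?_
      ring
    rw [Finset.sum_comm]
    simp only [e]
    have hle : ∀ (c₁ : Fin M₁ → Word n) (z : Word n),
        (∑ a, iidProb (bern (1 / 2)) a * ind (F a (c₁ j))) *
            ∑ a, iidProb (bern (1 / 2)) a * ind (V a (x - z - c₁ j)) ≤ π * ρ := fun c₁ z => by
      rw [sum_half_add_eq_coverProb D ε x (c₁ j)]
      refine mul_le_mul_of_nonneg_left ?_ hπ0
      simp only [hV, conv_bern]
      exact sum_half_decTypical_le hn hstar.1.le hstar.2.le hr hε₂ _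
    calc _ ≤ ∑ c₁ : Fin M₁ → Word n, (∏ j, iidProb (bern q) (c₁ j)) *
          ∑ z : Word n, iidProb (bern p) z * (π * ρ) := by
          refine Finset.sum_le_sum fun c₁ _ => mul_le_mul_of_nonneg_left
            (Finset.sum_le_sum fun z _ => mul_le_mul_of_nonneg_left (hle c₁ z)
              (iidProb_nonneg h0' z)) (Finset.prod_nonneg fun _ _ => hβ0 _)
      _ = π * ρ := by
          rw [← Finset.sum_mul, ← Finset.sum_mul, sum_iidProb (sum_bern p), one_mul,
            sum_pi_prod hβ, one_mul]
  calc _ ≤ ∑ c₀ : Fin M₀ → Word n, ∑ c₁ : Fin M₁ → Word n,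
      (∏ i, iidProb (bern (1 / 2)) (c₀ i)) * (∏ j, iidProb (bern q) (c₁ j)) *
        ∑ z : Word n, iidProb (bern p) z * ∑ i, ∑ j,
          (ind (F (c₀ i) (c₁ j) ∧ ¬V (c₀ i) (x - z - c₁ j)) +
            ∑ i' ∈ Finset.univ.erase i,
              ind (F (c₀ i) (c₁ j)) * ind (V (c₀ i') (x - z - c₁ j))) := by
        refine Finset.sum_le_sum fun c₀ _ => Finset.sum_le_sum fun c₁ _ =>
          mul_le_mul_of_nonneg_left (Finset.sum_le_sum fun z _ => mul_le_mul_of_nonneg_left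
            (Finset.sum_le_sum fun i _ => Finset.sum_le_sum fun j _ => hpt c₀ c₁ z i j)
            (iidProb_nonneg h0' z)) (mul_nonneg (Finset.prod_nonneg fun _ _ => hα0 _)
              (Finset.prod_nonneg fun _ _ => hβ0 _))
    _ = ∑ i, ∑ j, (∑ c₀ : Fin M₀ → Word n, ∑ c₁ : Fin M₁ → Word n,
      (∏ i, iidProb (bern (1 / 2)) (c₀ i)) * (∏ j, iidProb (bern q) (c₁ j)) *
        ∑ z : Word n, iidProb (bern p) z *
          ind (F (c₀ i) (c₁ j) ∧ ¬V (c₀ i) (x - z - c₁ j)) +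
        ∑ i' ∈ Finset.univ.erase i, ∑ c₀ : Fin M₀ → Word n, ∑ c₁ : Fin M₁ → Word n,
      (∏ i, iidProb (bern (1 / 2)) (c₀ i)) * (∏ j, iidProb (bern q) (c₁ j)) *
        ∑ z : Word n, iidProb (bern p) z *
          (ind (F (c₀ i) (c₁ j)) * ind (V (c₀ i') (x - z - c₁ j)))) := by
        rw [sum_mul_sum_mul_sum_comm]
        refine Finset.sum_congr rfl fun i _ => ?_
        rw [sum_mul_sum_mul_sum_comm]
        refine Finset.sum_congr rfl fun j _ => ?_
        simp only [mul_add, Finset.sum_add_distrib]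
        rw [sum_mul_sum_mul_sum_comm]
    _ ≤ ∑ i : Fin M₀, ∑ j : Fin M₁, (π * κ + M₀ * (π * ρ)) := by
        refine Finset.sum_le_sum fun i _ => Finset.sum_le_sum fun j _ =>
          add_le_add (hfirst i j) ?_
        refine (Finset.sum_le_sum fun i' hi' => hsecond i i' j (Finset.mem_erase.1 hi').1).trans ?_
        rw [Finset.sum_const, nsmul_eq_mul]
        have hρ0 : 0 ≤ ρ := by positivity
        have : (((Finset.univ.erase i).card : ℕ) : ℝ) ≤ M₀ := by
          have := Finset.card_erase_le (s := Finset.univ) (a := i)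
          rw [Finset.card_univ, Fintype.card_fin] at this
          exact_mod_cast this
        gcongr
    _ = _ := by
        simp only [Finset.sum_const, Finset.card_univ, Fintype.card_fin, nsmul_eq_mul]
        ring

/-! ### The error probabilities of the superposition scheme -/

lemma schemeProb_nonneg {p q D ε : ℝ} {n M₀ M₁ : ℕ} (hp0 : 0 ≤ p) (hp1 : p ≤ 1) (hq0 : 0 ≤ q)
    (hq1 : q ≤ 1)
    (E : (Fin M₀ → Word n) → (Fin M₁ → Word n) → Word n → Word n → Fin M₀ × Fin M₁ → Prop) :
    0 ≤ schemeProb p q D ε n M₀ M₁ E := by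
  rw [schemeProb_eq]
  have h1 := iidProb_nonneg (n := n) bern_half_nonneg
  have h2 := iidProb_nonneg (n := n) (bern_nonneg hq0 hq1)
  have h3 := iidProb_nonneg (n := n) (bern_nonneg hp0 hp1)
  exact Finset.sum_nonneg fun x _ => mul_nonneg (h1 x) <| Finset.sum_nonneg fun c₀ _ =>
    Finset.sum_nonneg fun c₁ _ => mul_nonneg (mul_nonneg (Finset.prod_nonneg fun i _ => h1 _)
      (Finset.prod_nonneg fun i _ => h2 _)) <| Finset.sum_nonneg fun z _ =>
        mul_nonneg (h3 z) (choiceAvg_nonneg ..)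

/-- Unbalanced source words cost their probability. For balanced ones, `choiceAvg_le` with τ a
quarter of the mean number of typical pairs leaves the lower tail T and the expected number of bad
typical pairs over τ, which is 4β. -/
lemma schemeProb_le {p q D ε : ℝ} {n M₀ M₁ : ℕ} (hp0 : 0 ≤ p) (hp1 : p ≤ 1) (hq0 : 0 ≤ q)
    (hq1 : q ≤ 1) (hn : 0 < n) (hε : 0 < ε) (hM₀ : 0 < M₀) (hM₁ : 0 < M₁)
    (E : (Fin M₀ → Word n) → (Fin M₁ → Word n) → Word n → Word n → Fin M₀ × Fin M₁ → Prop)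
    {T β : ℝ} (hT0 : 0 ≤ T) (hβ0 : 0 ≤ β)
    (hpos : ∀ x : Word n, Balanced (ε / 8) x → 0 < coverProb D ε x)
    (hT : ∀ x : Word n, Balanced (ε / 8) x →
      ∑ c₀ : Fin M₀ → Word n, ∑ c₁ : Fin M₁ → Word n,
      (∏ i, iidProb (bern (1 / 2)) (c₀ i)) * (∏ j, iidProb (bern q) (c₁ j)) *
        ind (∑ i, ∑ j, ind (JointlyTypical ε (additiveLaw (bern D)) (c₀ i + c₁ j) x) <
          M₀ * M₁ * coverProb D ε x / 4) ≤ T)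
    (hβ : ∀ x : Word n, ∑ c₀ : Fin M₀ → Word n, ∑ c₁ : Fin M₁ → Word n,
      (∏ i, iidProb (bern (1 / 2)) (c₀ i)) * (∏ j, iidProb (bern q) (c₁ j)) *
        ∑ z : Word n, iidProb (bern p) z *
          ∑ i, ∑ j, ind (JointlyTypical ε (additiveLaw (bern D)) (c₀ i + c₁ j) x ∧
            E c₀ c₁ (x - z) z (i, j)) ≤ M₀ * M₁ * coverProb D ε x * β) :
    schemeProb p q D ε n M₀ M₁ E ≤ 4 / (n * (ε / 8) ^ 2) + (T + 4 * β) := by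
  have h1 := iidProb_nonneg (n := n) bern_half_nonneg
  have h2 := iidProb_nonneg (n := n) (bern_nonneg hq0 hq1)
  have h3 := iidProb_nonneg (n := n) (bern_nonneg hp0 hp1)
  have hα := sum_iidProb (n := n) (sum_bern (1 / 2))
  have hq := sum_iidProb (n := n) (sum_bern q)
  have hp := sum_iidProb (n := n) (sum_bern p)
  have hw : ∀ (c₀ : Fin M₀ → Word n) (c₁ : Fin M₁ → Word n), 0 ≤
      (∏ i, iidProb (bern (1 / 2)) (c₀ i)) * (∏ j, iidProb (bern q) (c₁ j)) := fun c₀ c₁ =>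
    mul_nonneg (Finset.prod_nonneg fun i _ => h1 _) (Finset.prod_nonneg fun i _ => h2 _)
  have hm0 : (0 : ℝ) < M₀ := by exact_mod_cast hM₀
  have hm1 : (0 : ℝ) < M₁ := by exact_mod_cast hM₁
  have key : ∀ x : Word n, ∑ c₀ : Fin M₀ → Word n, ∑ c₁ : Fin M₁ → Word n,
        (∏ i, iidProb (bern (1 / 2)) (c₀ i)) * (∏ j, iidProb (bern q) (c₁ j)) *
          ∑ z : Word n, iidProb (bern p) z * choiceAvg D ε c₀ c₁ x (E c₀ c₁ (x - z) z) ≤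
      ind (¬Balanced (ε / 8) x) + (T + 4 * β) := by
    intro x
    by_cases hx : Balanced (ε / 8) x
    swap
    · rw [ind_of hx]
      refine le_trans ?_ (le_add_of_nonneg_right (by positivity : 0 ≤ T + 4 * β))
      refine le_trans ?_ (sum_codebooks_one (M₀ := M₀) (M₁ := M₁) hα hq).le
      refine Finset.sum_le_sum fun c₀ _ => Finset.sum_le_sum fun c₁ _ =>
        mul_le_of_le_one_right (hw c₀ c₁) ?_
      refine le_trans ?_ hp.le
      exact Finset.sum_le_sum fun z _ => mul_le_of_le_one_right (h3 z) (choiceAvg_le_one ..)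
    rw [ind_not (not_not.2 hx), zero_add]
    have hc := hpos x hx
    set τ := M₀ * M₁ * coverProb D ε x / 4 with hτ
    have hτ0 : 0 < τ := by positivity
    have hpt : ∀ (c₀ : Fin M₀ → Word n) (c₁ : Fin M₁ → Word n),
        (∏ i, iidProb (bern (1 / 2)) (c₀ i)) * (∏ j, iidProb (bern q) (c₁ j)) *
          ∑ z : Word n, iidProb (bern p) z * choiceAvg D ε c₀ c₁ x (E c₀ c₁ (x - z) z) ≤
        (∏ i, iidProb (bern (1 / 2)) (c₀ i)) * (∏ j, iidProb (bern q) (c₁ j)) *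
          ind (∑ i, ∑ j, ind (JointlyTypical ε (additiveLaw (bern D)) (c₀ i + c₁ j) x) < τ) +
        ((∏ i, iidProb (bern (1 / 2)) (c₀ i)) * (∏ j, iidProb (bern q) (c₁ j)) *
          ∑ z : Word n, iidProb (bern p) z *
          ∑ i, ∑ j, ind (JointlyTypical ε (additiveLaw (bern D)) (c₀ i + c₁ j) x ∧
            E c₀ c₁ (x - z) z (i, j))) * τ⁻¹ := fun c₀ c₁ => by
      rw [mul_assoc (_ * _) (∑ z : Word n, _) τ⁻¹, ← mul_add]
      refine mul_le_mul_of_nonneg_left ?_ (hw c₀ c₁)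
      calc _ ≤ ∑ z : Word n, iidProb (bern p) z *
            (ind (∑ i, ∑ j, ind (JointlyTypical ε (additiveLaw (bern D)) (c₀ i + c₁ j) x) < τ) +
              (∑ i, ∑ j, ind (JointlyTypical ε (additiveLaw (bern D)) (c₀ i + c₁ j) x ∧
                E c₀ c₁ (x - z) z (i, j))) / τ) :=
            Finset.sum_le_sum fun z _ => mul_le_mul_of_nonneg_left
              (choiceAvg_le D ε c₀ c₁ x _ hτ0) (h3 z)
        _ = _ := by
            simp only [mul_add, Finset.sum_add_distrib, ← Finset.sum_mul, hp, one_mul,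
              div_eq_mul_inv, ← mul_assoc]
    refine (Finset.sum_le_sum fun c₀ _ => Finset.sum_le_sum fun c₁ _ => hpt c₀ c₁).trans ?_
    simp only [Finset.sum_add_distrib, ← Finset.sum_mul]
    refine add_le_add (hT x hx) ?_
    refine (mul_le_mul_of_nonneg_right (hβ x) (inv_nonneg.2 hτ0.le)).trans_eq ?_
    rw [hτ]; field_simp
  rw [schemeProb_eq]
  refine (Finset.sum_le_sum fun x _ => mul_le_mul_of_nonneg_left (key x) (h1 x)).trans ?_
  simp only [mul_add (iidProb _ _) (ind _), Finset.sum_add_distrib, ← Finset.sum_mul, hα, one_mul]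
  exact add_le_add_left (sum_not_balanced_le hn (by positivity)) _

lemma two_rpow_le_codeSize (R : ℝ) (n : ℕ) : (2 : ℝ) ^ (n * R) ≤ codeSize R n := Nat.le_ceil _

lemma codeSize_pos (R : ℝ) (n : ℕ) : 0 < codeSize R n := Nat.ceil_pos.2 (by positivity)

lemma codeSize_le {R : ℝ} (hR : 0 ≤ R) (n : ℕ) : (codeSize R n : ℝ) ≤ 2 * (2 : ℝ) ^ (n * R) := by
  have h1 : (1 : ℝ) ≤ (2 : ℝ) ^ (n * R) := Real.one_le_rpow (by norm_num) (by positivity)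
  have h2 := Nat.ceil_lt_add_one (show (0 : ℝ) ≤ (2 : ℝ) ^ (n * R) by positivity)
  unfold codeSize
  linarith

lemma h2_nonneg {r : ℝ} (h0 : 0 ≤ r) (h1 : r ≤ 1) : 0 ≤ h2 r :=
  div_nonneg (Real.binEntropy_nonneg h0 h1) log_two_pos.le

lemma h2_le_one (r : ℝ) : h2 r ≤ 1 := by
  unfold h2
  rw [div_le_one log_two_pos]
  exact Real.binEntropy_le_log_two

/-- At 0 and 1 the entropy vanishes, which contradicts an entropy strictly above the nonnegative H(p
∗ D). -/
lemma star_pos_of_h2_lt {p q D : ℝ} (hp0 : 0 < p) (hp : p < 1 / 2) (hD0 : 0 ≤ D) (hD1 : D < 1 / 2)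
    (hq0 : 0 ≤ q) (hq1 : q ≤ 1) (h : h2 (star p D) < h2 (star q D)) :
    0 < star q D ∧ star q D < 1 := by
  have h1 := h2_nonneg (star_pos hp0 hp hD0).le (star_lt_one hp0 hp (by linarith)).le
  have h2' : 0 ≤ star q D := by
    unfold star
    nlinarith [mul_nonneg hq0 (show 0 ≤ 1 - D by linarith), mul_nonneg hD0 (sub_nonneg.2 hq1)]
  have h3 : 0 ≤ 1 - star q D := by
    have : 1 - star q D = q * D + (1 - q) * (1 - D) := by unfold star; ring
    rw [this]
    nlinarith [mul_nonneg hq0 hD0, mul_nonneg (sub_nonneg.2 hq1) (show 0 ≤ 1 - D by linarith)]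
  refine ⟨lt_of_le_of_ne h2' fun h0 => ?_, lt_of_le_of_ne (by linarith) fun h0 => ?_⟩
  · rw [← h0] at h; simp [h2] at h; unfold h2 at h1; linarith
  · rw [h0] at h; simp [h2] at h; unfold h2 at h1; linarith

lemma tendsto_const_div_nat_mul (c C : ℝ) : Tendsto (fun n : ℕ => C / (n * c)) atTop (𝓝 0) :=
  (tendsto_const_div_atTop_nhds_zero_nat (C / c)).congr fun n => by rw [div_div, mul_comm]

lemma tendsto_two_rpow_neg {δ : ℝ} (hδ : 0 < δ) :
    Tendsto (fun n : ℕ => (2 : ℝ) ^ (-(n * δ))) atTop (𝓝 0) := by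
  have h : (2 : ℝ) ^ (-δ) < 1 := Real.rpow_lt_one_of_one_lt_of_neg (by norm_num) (by linarith)
  refine (tendsto_pow_atTop_nhds_zero_of_lt_one (by positivity) h).congr fun n => ?_
  rw [← Real.rpow_natCast, ← Real.rpow_mul (by norm_num)]
  congr 1; ring

/-- Explicit bounds on the error probabilities, valid for small tolerances and large `n`. -/
lemma exists_errorProb_le {p q D R₀ R₁ : ℝ} (hp0 : 0 < p) (hp : p < 1 / 2) (hD0 : 0 ≤ D)
    (hD1 : D < 1 / 2) (hq0 : 0 ≤ q) (hq1 : q ≤ 1) (hpq : h2 (star p D) < h2 (star q D))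
    (hR : (R₀, R₁) ∈ rateRegion p q D) (hR₀ : R₀ < 1 - h2 (star p D)) :
    ∃ ε₀ δ : ℝ, 0 < ε₀ ∧ 0 < δ ∧ ∀ ε ε' : ℝ, 0 < ε → ε < ε' → ε' < ε₀ → ∀ᶠ n : ℕ in atTop,
      encErrorProb p q D R₀ R₁ ε n ≤ 4 / (n * (ε / 8) ^ 2) + 40 * (2 : ℝ) ^ (-(n * δ)) ∧
      decErrorProb p q D R₀ R₁ ε ε' n ≤ 4 / (n * (ε / 8) ^ 2) + (40 * (2 : ℝ) ^ (-(n * δ)) +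
        4 * (4 / (n * ((ε' - ε) / 8) ^ 2) + 4 / (n * ((ε' - ε) / 8) ^ 2) +
          2 * (2 : ℝ) ^ (-(n * δ)))) := by
  obtain ⟨hr1, hr2, hr3⟩ := mem_rateRegion.1 hR
  obtain ⟨hs0, hs1⟩ := star_pos_of_h2_lt hp0 hp hD0 hD1 hq0 hq1 hpq
  have hR₀0 : 0 ≤ R₀ := by linarith [h2_le_one (star q D)]
  have hR₁0 : 0 < R₁ := by
    have := gainNats_pos hp0 hp hD0 hD1
    have h3 : 0 < R1star p D := by rw [R1star_eq]; exact div_pos this log_two_pos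
    unfold R1star at h3
    linarith
  -- Every gap pays one δ for the final decay. In addition the row bound pays 2δ and the covering
  -- probability δ, which makes 4δ for the q-condition and 2δ for the sum rate; the false-match
  -- bound pays δ, which makes 2δ again.
  obtain ⟨δ, hδ0, hδ1, hδ2, hδ3, hδ4⟩ : ∃ δ : ℝ, 0 < δ ∧ 4 * δ ≤ R₀ - (1 - h2 (star q D)) ∧
      2 * δ ≤ R₀ + R₁ - (1 - h2 D) ∧ 2 * δ ≤ 1 - h2 (star p D) - R₀ ∧ δ ≤ R₁ := by
    refine ⟨min (min ((R₀ - (1 - h2 (star q D))) / 4) ((R₀ + R₁ - (1 - h2 D)) / 2))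
      (min ((1 - h2 (star p D) - R₀) / 2) R₁), ?_, ?_, ?_, ?_, ?_⟩
    · simp only [lt_min_iff]; refine ⟨⟨?_, ?_⟩, ?_, hR₁0⟩ <;> linarith
    · linarith [min_le_left (min ((R₀ - (1 - h2 (star q D))) / 4) ((R₀ + R₁ - (1 - h2 D)) / 2))
        (min ((1 - h2 (star p D) - R₀) / 2) R₁),
        min_le_left ((R₀ - (1 - h2 (star q D))) / 4) ((R₀ + R₁ - (1 - h2 D)) / 2)]
    · linarith [min_le_left (min ((R₀ - (1 - h2 (star q D))) / 4) ((R₀ + R₁ - (1 - h2 D)) / 2))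
        (min ((1 - h2 (star p D) - R₀) / 2) R₁),
        min_le_right ((R₀ - (1 - h2 (star q D))) / 4) ((R₀ + R₁ - (1 - h2 D)) / 2)]
    · linarith [min_le_right (min ((R₀ - (1 - h2 (star q D))) / 4) ((R₀ + R₁ - (1 - h2 D)) / 2))
        (min ((1 - h2 (star p D) - R₀) / 2) R₁), min_le_left ((1 - h2 (star p D) - R₀) / 2) R₁]
    · linarith [min_le_right (min ((R₀ - (1 - h2 (star q D))) / 4) ((R₀ + R₁ - (1 - h2 D)) / 2))
        (min ((1 - h2 (star p D) - R₀) / 2) R₁), min_le_right ((1 - h2 (star p D) - R₀) / 2) R₁]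
  have hsp0 := star_pos hp0 hp hD0
  have hsp1 := star_lt_one hp0 hp (show D ≤ 1 by linarith)
  obtain ⟨e₀, he₀, hL₀⟩ := exists_likelihood_bounds hD0 (show D < 1 by linarith) hδ0
  obtain ⟨e₁, he₁, hL₁⟩ := exists_likelihood_bounds hs0.le hs1 hδ0
  obtain ⟨e₂, he₂, hL₂⟩ := exists_likelihood_bounds hsp0.le hsp1 hδ0
  refine ⟨min e₀ (min e₁ e₂), δ, by positivity, hδ0, fun ε ε' hε hεε' hε' => ?_⟩
  have hε'0 : ε' < e₀ := hε'.trans_le (min_le_left _ _)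
  have hε'1 : ε' < e₁ := hε'.trans_le ((min_le_right _ _).trans (min_le_left _ _))
  have hε'2 : ε' < e₂ := hε'.trans_le ((min_le_right _ _).trans (min_le_right _ _))
  have hev1 := (tendsto_const_div_nat_mul ((ε / 8) ^ 2) 4).eventually
    (ge_mem_nhds (show (0 : ℝ) < 1 / 2 by norm_num))
  have hev2 := (tendsto_const_div_nat_mul ((e₁ / 2) ^ 2) 1).eventually
    (ge_mem_nhds (show (0 : ℝ) < 1 / 2 by norm_num))
  filter_upwards [hev1, hev2, eventually_gt_atTop 0] with n hn1 hn2 hn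
  set M₀ := codeSize R₀ n with hM₀
  set M₁ := codeSize R₁ n with hM₁
  have hM₀p : 0 < M₀ := codeSize_pos R₀ n
  have hM₁p : 0 < M₁ := codeSize_pos R₁ n
  have hm0 : (2 : ℝ) ^ (n * R₀) ≤ M₀ := two_rpow_le_codeSize R₀ n
  have hm1 : (2 : ℝ) ^ (n * R₁) ≤ M₁ := two_rpow_le_codeSize R₁ n
  have hm0' : (M₀ : ℝ) ≤ 2 * (2 : ℝ) ^ (n * R₀) := codeSize_le hR₀0 n
  have hn' : (0 : ℝ) < n := by exact_mod_cast hn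
  have hcov : ∀ x : Word n, Balanced (ε / 8) x →
      1 / 2 * (2 : ℝ) ^ (-(n * (1 - h2 D + δ))) ≤ coverProb D ε x := fun x hx =>
    coverProb_ge hn hD0 (by linarith) hε hL₀ (by linarith) hn1 hx
  have hcov0 : ∀ x : Word n, Balanced (ε / 8) x → 0 < coverProb D ε x := fun x hx =>
    lt_of_lt_of_le (by positivity) (hcov x hx)
  have hmono : ∀ y z : ℝ, y ≤ z → (2 : ℝ) ^ (n * y) ≤ (2 : ℝ) ^ (n * z) := fun y z h =>
    Real.rpow_le_rpow_of_exponent_le (by norm_num) (by gcongr)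
  have hT : ∀ x : Word n, Balanced (ε / 8) x →
      ∑ c₀ : Fin M₀ → Word n, ∑ c₁ : Fin M₁ → Word n,
      (∏ i, iidProb (bern (1 / 2)) (c₀ i)) * (∏ j, iidProb (bern q) (c₁ j)) *
        ind (∑ i, ∑ j, ind (JointlyTypical ε (additiveLaw (bern D)) (c₀ i + c₁ j) x) <
          M₀ * M₁ * coverProb D ε x / 4) ≤ 40 * (2 : ℝ) ^ (-(n * δ)) := by
    intro x hx
    refine (sum_cover_lower_tail hn hM₀p hM₁p hq0 hq1 hD0 (by linarith) hs0 hL₀ (by linarith)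
      hL₁ he₁ (by linarith) hn2 (hcov0 x hx)).trans ?_
    have hc := hcov x hx
    -- The three terms of the tail bound use the gaps in R₀ + R₁, in R₀ against 1 - H(q ∗ D), and in
    -- R₁ against 0. Together they give 4 (4 + 4 + 2) = 40.
    have t1 : 2 / (M₀ * M₁ * coverProb D ε x) ≤ 4 * (2 : ℝ) ^ (-(n * δ)) := by
      rw [div_le_iff₀ (by have := hcov0 x hx; positivity)]
      have : (2 : ℝ) ^ (-(n * δ)) * ((2 : ℝ) ^ (n * R₀) * (2 : ℝ) ^ (n * R₁) *
          (1 / 2 * (2 : ℝ) ^ (-(n * (1 - h2 D + δ))))) ≤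
          (2 : ℝ) ^ (-(n * δ)) * (M₀ * M₁ * coverProb D ε x) := by
        gcongr
      have h1 : 1 / 2 ≤ (2 : ℝ) ^ (-(n * δ)) * ((2 : ℝ) ^ (n * R₀) * (2 : ℝ) ^ (n * R₁) *
          (1 / 2 * (2 : ℝ) ^ (-(n * (1 - h2 D + δ))))) := by
        have e : (2 : ℝ) ^ (-(n * δ)) * ((2 : ℝ) ^ (n * R₀) * (2 : ℝ) ^ (n * R₁) *
          (1 / 2 * (2 : ℝ) ^ (-(n * (1 - h2 D + δ))))) =
            1 / 2 * (2 : ℝ) ^ (n * (R₀ + R₁ - (1 - h2 D) - 2 * δ)) := by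
          have : (2 : ℝ) ^ (n * (R₀ + R₁ - (1 - h2 D) - 2 * δ)) = (2 : ℝ) ^ (-(n * δ)) *
              ((2 : ℝ) ^ (n * R₀) * (2 : ℝ) ^ (n * R₁) *
                (2 : ℝ) ^ (-(n * (1 - h2 D + δ)))) := by
            simp only [← Real.rpow_add (show (0 : ℝ) < 2 by norm_num)]; congr 1; ring
          rw [this]; ring
        have := Real.one_le_rpow (show (1 : ℝ) ≤ 2 by norm_num)
          (mul_nonneg hn'.le (show 0 ≤ R₀ + R₁ - (1 - h2 D) - 2 * δ by linarith))
        rw [e]; linarith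
      linarith
    have t2 : 2 * (2 : ℝ) ^ (-(n * (h2 (star q D) - h2 D - 2 * δ))) / (M₀ * coverProb D ε x) ≤
        4 * (2 : ℝ) ^ (-(n * δ)) := by
      rw [div_le_iff₀ (by have := hcov0 x hx; positivity)]
      have : (2 : ℝ) ^ (-(n * δ)) * ((2 : ℝ) ^ (n * R₀) *
          (1 / 2 * (2 : ℝ) ^ (-(n * (1 - h2 D + δ))))) ≤
          (2 : ℝ) ^ (-(n * δ)) * (M₀ * coverProb D ε x) := by
        gcongr
      have h1 : (2 : ℝ) ^ (-(n * (h2 (star q D) - h2 D - 2 * δ))) ≤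
          2 * ((2 : ℝ) ^ (-(n * δ)) * ((2 : ℝ) ^ (n * R₀) *
          (1 / 2 * (2 : ℝ) ^ (-(n * (1 - h2 D + δ)))))) := by
        have e : 2 * ((2 : ℝ) ^ (-(n * δ)) * ((2 : ℝ) ^ (n * R₀) *
          (1 / 2 * (2 : ℝ) ^ (-(n * (1 - h2 D + δ)))))) =
            (2 : ℝ) ^ (n * (R₀ - (1 - h2 D) - 2 * δ)) := by
          have : (2 : ℝ) ^ (n * (R₀ - (1 - h2 D) - 2 * δ)) = (2 : ℝ) ^ (-(n * δ)) *
              ((2 : ℝ) ^ (n * R₀) * (2 : ℝ) ^ (-(n * (1 - h2 D + δ)))) := by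
            simp only [← Real.rpow_add (show (0 : ℝ) < 2 by norm_num)]; congr 1; ring
          rw [this]; ring
        rw [e, ← mul_neg]
        exact hmono _ _ (by linarith)
      linarith
    have t3 : 2 / (M₁ : ℝ) ≤ 2 * (2 : ℝ) ^ (-(n * δ)) := by
      rw [div_le_iff₀ (by positivity)]
      have : (2 : ℝ) ^ (-(n * δ)) * (2 : ℝ) ^ (n * δ) ≤ (2 : ℝ) ^ (-(n * δ)) * M₁ := by
        gcongr
        exact (hmono _ _ hδ4).trans hm1
      rw [← Real.rpow_add (by norm_num), neg_add_cancel, Real.rpow_zero] at this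
      linarith
    linarith
  have hP0 : (0 : ℝ) ≤ 40 * (2 : ℝ) ^ (-(n * δ)) := by positivity
  constructor
  -- A typical pair is within distance n (D + ε/2) of the source word, so it never causes an encoder
  -- error; only a covering failure remains and β = 0.
  · have := schemeProb_le (p := p) (β := 0) hp0.le (by linarith) hq0 hq1 hn hε hM₀p hM₁p
      (fun c₀ c₁ y z s => (n : ℝ) * (D + ε) < hammingDist (y + z) (c₀ s.1 + c₁ s.2)) hP0 le_rfl
      hcov0 hT fun x => by
        rw [mul_zero]
        refine (Finset.sum_eq_zero fun c₀ _ => Finset.sum_eq_zero fun c₁ _ => ?_).le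
        rw [Finset.sum_eq_zero fun z _ => ?_, mul_zero]
        rw [Finset.sum_eq_zero fun i _ => Finset.sum_eq_zero fun j _ => ?_, mul_zero]
        refine ind_not fun ⟨h1, h2'⟩ => ?_
        rw [sub_add_cancel, hammingDist_eq_weight] at h2'
        have := (abs_le.1 (h1.abs_weight_sub_le hn).2).2
        nlinarith
    simp only [mul_zero, add_zero] at this
    exact this
  · have hκ : (0 : ℝ) ≤ 4 / (n * ((ε' - ε) / 8) ^ 2) + 4 / (n * ((ε' - ε) / 8) ^ 2) +
          2 * (2 : ℝ) ^ (-(n * δ)) := by positivity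
    refine schemeProb_le (p := p) hp0.le (by linarith) hq0 hq1 hn hε hM₀p hM₁p _ hP0 hκ hcov0 hT
      fun x => ?_
    -- The midpoint of ε and ε' serves as the intermediate tolerance, which makes the two
    -- perturbation gaps equal.
    have hmid := sum_decError_le (M₀ := M₀) (M₁ := M₁) (ε := ε) (ε'' := (ε + ε') / 2) (ε' := ε') hn
      hp0 (by linarith) hq0 hq1 hD0 (by linarith) (by linarith) (by linarith) hL₂ (by linarith) x
    refine hmid.trans ?_
    have e1 : ((ε + ε') / 2 - ε) / 4 = (ε' - ε) / 8 := by ring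
    have e2 : (ε' - (ε + ε') / 2) / 4 = (ε' - ε) / 8 := by ring
    rw [e1, e2]
    have hc : 0 ≤ coverProb D ε x := Finset.sum_nonneg fun u _ =>
      mul_nonneg (iidProb_nonneg bern_half_nonneg u) (ind_nonneg _)
    have : M₀ * (2 : ℝ) ^ (-(n * (1 - h2 (star p D) - δ))) ≤ 2 * (2 : ℝ) ^ (-(n * δ)) := by
      calc M₀ * (2 : ℝ) ^ (-(n * (1 - h2 (star p D) - δ))) ≤
            2 * (2 : ℝ) ^ (n * R₀) * (2 : ℝ) ^ (-(n * (1 - h2 (star p D) - δ))) := by gcongr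
        _ = 2 * (2 : ℝ) ^ (n * (R₀ - (1 - h2 (star p D)) + δ)) := by
            rw [mul_assoc, ← Real.rpow_add (by norm_num)]; congr 2; ring
        _ ≤ 2 * (2 : ℝ) ^ (-(n * δ)) := by
            rw [← mul_neg]
            exact mul_le_mul_of_nonneg_left (hmono _ _ (by linarith)) (by norm_num)
    gcongr

/-- For rates inside the region both error probabilities vanish. -/
lemma exists_tendsto_errorProb {p q D R₀ R₁ : ℝ} (hp0 : 0 < p) (hp : p < 1 / 2) (hD0 : 0 ≤ D)
    (hD1 : D < 1 / 2) (hq0 : 0 ≤ q) (hq1 : q ≤ 1) (hpq : h2 (star p D) < h2 (star q D))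
    (hR : (R₀, R₁) ∈ rateRegion p q D) (hR₀ : R₀ < 1 - h2 (star p D)) :
    ∃ ε₀ : ℝ, 0 < ε₀ ∧ ∀ ε ε' : ℝ, 0 < ε → ε < ε' → ε' < ε₀ →
      Tendsto (encErrorProb p q D R₀ R₁ ε) atTop (𝓝 0) ∧
      Tendsto (decErrorProb p q D R₀ R₁ ε ε') atTop (𝓝 0) := by
  obtain ⟨ε₀, δ, h0, hδ, h⟩ := exists_errorProb_le hp0 hp hD0 hD1 hq0 hq1 hpq hR hR₀
  refine ⟨ε₀, h0, fun ε ε' hε hεε' hε' => ?_⟩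
  have hb := h ε ε' hε hεε' hε'
  have l1 := tendsto_const_div_nat_mul ((ε / 8) ^ 2) 4
  have l2 := tendsto_const_div_nat_mul (((ε' - ε) / 8) ^ 2) 4
  have l3 := tendsto_two_rpow_neg hδ
  constructor
  · refine squeeze_zero' (Eventually.of_forall fun n =>
      schemeProb_nonneg hp0.le (by linarith) hq0 hq1 _) (hb.mono fun n h => h.1) ?_
    simpa using l1.add (l3.const_mul 40)
  · refine squeeze_zero' (Eventually.of_forall fun n =>
      schemeProb_nonneg hp0.le (by linarith) hq0 hq1 _) (hb.mono fun n h => h.2) ?_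
    simpa using l1.add ((l3.const_mul 40).add (((l2.add l2).add (l3.const_mul 2)).const_mul 4))

/-! ### Fixed superposition codes -/

/-- Weights may vanish, as for B(q) codewords with q = 0. If all values exceeded S, every weight
would have to be zero. -/
lemma exists_le_of_sum_mul_le {X : Type*} [Fintype X] {w Φ : X → ℝ} {S : ℝ} (hw0 : ∀ x, 0 ≤ w x)
    (hw : ∑ x, w x = 1) (h : ∑ x, w x * Φ x ≤ S) : ∃ x, Φ x ≤ S := by
  by_contra! hlt
  have h1 : ∑ x, w x * (Φ x - S) ≤ 0 := by
    simp only [mul_sub, Finset.sum_sub_distrib, ← Finset.sum_mul, hw]; linarith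
  have h2 : ∀ x ∈ Finset.univ, 0 ≤ w x * (Φ x - S) := fun x _ =>
    mul_nonneg (hw0 x) (by linarith [hlt x])
  have h3 := (Finset.sum_eq_zero_iff_of_nonneg h2).1 (le_antisymm h1 (Finset.sum_nonneg h2))
  have h4 : ∀ x, w x = 0 := fun x => by
    rcases mul_eq_zero.1 (h3 x (Finset.mem_univ x)) with h | h
    · exact h
    · linarith [hlt x]
  simp [h4] at hw

lemma orAll_nonempty {α : Type} [Fintype α] [Nonempty α] (A : α → Prop) : (orAll A).Nonempty := by
  unfold orAll
  split_ifs with h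
  · obtain ⟨a, ha⟩ := h
    exact ⟨a, by simpa using ha⟩
  · exact Finset.univ_nonempty

lemma mem_orAll_of_exists {α : Type} [Fintype α] {A : α → Prop} (h : ∃ a, A a) {a : α}
    (ha : a ∈ orAll A) : A a := by
  unfold orAll at ha
  rw [if_pos h] at ha
  simpa using ha

lemma WZCode.mul_distortion {n : ℕ} {M : Type} (C : WZCode n M) (p : ℝ) :
    n * C.distortion p = ∑ y : Word n, ∑ z : Word n, iidProb (bern (1 / 2)) y *
      iidProb (bern p) z * (hammingDist (y + z) (C.dec (C.enc (y + z)) y) : ℝ) := by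
  rcases Nat.eq_zero_or_pos n with rfl | hn
  · have : ∀ x y : Word 0, hammingDist x y = 0 := fun x y => by
      rw [hammingDist_eq_zero]; exact Subsingleton.elim _ _
    simp [this]
  · have : (n : ℝ) ≠ 0 := by positivity
    simp only [WZCode.distortion, Finset.mul_sum]
    refine Finset.sum_congr rfl fun y _ => Finset.sum_congr rfl fun z _ => ?_
    field_simp

/-- The random coding argument: some fixed superposition code has distortion at most that of the
test channel plus the error probabilities of the scheme. -/
lemma exists_superpositionCode {p q D R₀ R₁ ε ε' : ℝ} {n : ℕ} (hn : 0 < n) (hp0 : 0 ≤ p)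
    (hp1 : p ≤ 1) (hq0 : 0 ≤ q) (hq1 : q ≤ 1) (hD : 0 ≤ D + ε) :
    ∃ C : WZCode n (Fin (codeSize R₁ n)), IsSuperpositionCode p D ε ε' (codeSize R₀ n) C ∧
      C.distortion p ≤ D + ε + (encErrorProb p q D R₀ R₁ ε n + decErrorProb p q D R₀ R₁ ε ε' n) := by
  have h1 := iidProb_nonneg (n := n) bern_half_nonneg
  have h2 := iidProb_nonneg (n := n) (bern_nonneg hq0 hq1)
  have h3 := iidProb_nonneg (n := n) (bern_nonneg hp0 hp1)
  have hα := sum_iidProb (n := n) (sum_bern (1 / 2))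
  have hq := sum_iidProb (n := n) (sum_bern q)
  have hp := sum_iidProb (n := n) (sum_bern p)
  have hn' : (0 : ℝ) < n := by exact_mod_cast hn
  set M₀ := codeSize R₀ n with hM₀
  set M₁ := codeSize R₁ n with hM₁
  have : Nonempty (Fin M₀) := ⟨⟨0, codeSize_pos R₀ n⟩⟩
  have : Nonempty (Fin M₁) := ⟨⟨0, codeSize_pos R₁ n⟩⟩
  set Ee : (Fin M₀ → Word n) → (Fin M₁ → Word n) → Word n → Word n → Fin M₀ × Fin M₁ → Prop :=
    fun c₀ c₁ y z s => (n : ℝ) * (D + ε) < hammingDist (y + z) (c₀ s.1 + c₁ s.2) with hEe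
  set Ed : (Fin M₀ → Word n) → (Fin M₁ → Word n) → Word n → Word n → Fin M₀ × Fin M₁ → Prop :=
    fun c₀ c₁ y _ s => ¬(DecTypical p D ε' c₀ (y - c₁ s.2) s.1 ∧
      ∀ i, DecTypical p D ε' c₀ (y - c₁ s.2) i → i = s.1) with hEd
  have he : encErrorProb p q D R₀ R₁ ε n = schemeProb p q D ε n M₀ M₁ Ee := rfl
  have hd : decErrorProb p q D R₀ R₁ ε ε' n = schemeProb p q D ε n M₀ M₁ Ed := rfl
  set Φ : (Fin M₀ → Word n) × (Fin M₁ → Word n) → ℝ := fun c =>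
    ∑ x : Word n, iidProb (bern (1 / 2)) x * ∑ z : Word n, iidProb (bern p) z *
      (choiceAvg D ε c.1 c.2 x (Ee c.1 c.2 (x - z) z) +
        choiceAvg D ε c.1 c.2 x (Ed c.1 c.2 (x - z) z)) with hΦ
  have hS : ∑ c : (Fin M₀ → Word n) × (Fin M₁ → Word n),
      ((∏ i, iidProb (bern (1 / 2)) (c.1 i)) * (∏ j, iidProb (bern q) (c.2 j))) * Φ c =
      encErrorProb p q D R₀ R₁ ε n + decErrorProb p q D R₀ R₁ ε ε' n := by
    rw [he, hd, schemeProb_eq, schemeProb_eq, ← Finset.sum_add_distrib]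
    simp only [← mul_add, ← Finset.sum_add_distrib]
    rw [Fintype.sum_prod_type]
    simp only [hΦ, Finset.mul_sum]
    rw [Finset.sum_congr rfl fun c₀ _ => Finset.sum_comm, Finset.sum_comm]
    refine Finset.sum_congr rfl fun x _ => Finset.sum_congr rfl fun c₀ _ =>
      Finset.sum_congr rfl fun c₁ _ => Finset.sum_congr rfl fun z _ => ?_
    ring
  obtain ⟨⟨c₀, c₁⟩, hc⟩ := exists_le_of_sum_mul_le
    (fun c : (Fin M₀ → Word n) × (Fin M₁ → Word n) =>
      mul_nonneg (Finset.prod_nonneg fun i _ => h1 (c.1 i))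
        (Finset.prod_nonneg fun j _ => h2 (c.2 j)))
    (by rw [Fintype.sum_prod_type]; exact sum_codebooks_one hα hq) hS.le
  -- The random selection is removed separately for each x, since the encoder sees x only: some
  -- admissible pair does no worse than the uniform choice, on average over z.
  have hsel : ∀ x : Word n, ∃ s ∈ encChoices D ε c₀ c₁ x,
      ∑ z : Word n, iidProb (bern p) z *
        (ind (Ee c₀ c₁ (x - z) z s) + ind (Ed c₀ c₁ (x - z) z s)) ≤
      ∑ z : Word n, iidProb (bern p) z *
        (choiceAvg D ε c₀ c₁ x (Ee c₀ c₁ (x - z) z) +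
          choiceAvg D ε c₀ c₁ x (Ed c₀ c₁ (x - z) z)) := by
    intro x
    have hne : (encChoices D ε c₀ c₁ x).Nonempty := orAll_nonempty _
    have hcard : (0 : ℝ) < (encChoices D ε c₀ c₁ x).card := by exact_mod_cast hne.card_pos
    refine Finset.exists_le_of_sum_le hne ?_
    rw [Finset.sum_const, nsmul_eq_mul, Finset.sum_comm, Finset.mul_sum]
    refine (Finset.sum_congr rfl fun z _ => ?_).le
    rw [choiceAvg_eq_sum, choiceAvg_eq_sum, ← Finset.mul_sum, Finset.sum_add_distrib]
    field_simp
  choose s hs hs' using hsel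
  have hdec : ∀ w : Word n, ∃ i, i ∈ decChoices p D ε' c₀ w := fun w => orAll_nonempty _
  choose T hT using hdec
  refine ⟨⟨fun x => (s x).2, fun j y => y + (c₀ (T (y - c₁ j)) - (y - c₁ j))⟩,
    ⟨c₀, c₁, s, T, hs, hT, fun _ => rfl, fun _ _ => rfl⟩, ?_⟩
  -- Distortion is at most 1 on an error and at most D + ε otherwise.
  have hpt : ∀ x z : Word n, (hammingDist x (x - z + (c₀ (T (x - z - c₁ (s x).2)) -
      (x - z - c₁ (s x).2))) : ℝ) / n ≤
      D + ε + (ind (Ee c₀ c₁ (x - z) z (s x)) + ind (Ed c₀ c₁ (x - z) z (s x))) := by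
    intro x z
    have hle : (hammingDist x (x - z + (c₀ (T (x - z - c₁ (s x).2)) -
        (x - z - c₁ (s x).2))) : ℝ) / n ≤ 1 := by
      rw [div_le_one hn']
      have := hammingDist_le_card_fintype (x := x) (y := x - z + (c₀ (T (x - z - c₁ (s x).2)) -
        (x - z - c₁ (s x).2)))
      rw [Fintype.card_fin] at this
      exact_mod_cast this
    by_cases hEd' : Ed c₀ c₁ (x - z) z (s x)
    · rw [ind_of hEd']; linarith [ind_nonneg (Ee c₀ c₁ (x - z) z (s x))]
    by_cases hEe' : Ee c₀ c₁ (x - z) z (s x)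
    · rw [ind_of hEe']; linarith [ind_nonneg (Ed c₀ c₁ (x - z) z (s x))]
    rw [ind_not hEd', ind_not hEe', add_zero, add_zero, div_le_iff₀ hn']
    simp only [hEd, not_not] at hEd'
    simp only [hEe, not_lt, sub_add_cancel] at hEe'
    -- Without a decoder error a typical word exists, so T must pick one, and by uniqueness it is
    -- the encoder's. The reconstruction then telescopes to c₀ + c₁.
    have hTs : T (x - z - c₁ (s x).2) = (s x).1 :=
      hEd'.2 _ (mem_orAll_of_exists ⟨_, hEd'.1⟩ (hT _))
    have e : x - z + (c₀ (s x).1 - (x - z - c₁ (s x).2)) = c₀ (s x).1 + c₁ (s x).2 := by abel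
    rw [hTs, e]
    linarith
  unfold WZCode.distortion
  have hx : ∑ y : Word n, ∑ z : Word n, iidProb (bern (1 / 2)) y * iidProb (bern p) z *
      ((hammingDist (y + z) (y + (c₀ (T (y - c₁ (s (y + z)).2)) -
        (y - c₁ (s (y + z)).2))) : ℝ) / n) =
      ∑ x : Word n, iidProb (bern (1 / 2)) x * ∑ z : Word n, iidProb (bern p) z *
        ((hammingDist x (x - z + (c₀ (T (x - z - c₁ (s x).2)) -
          (x - z - c₁ (s x).2))) : ℝ) / n) := by
    simp only [Finset.mul_sum]
    rw [Finset.sum_comm]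
    conv_rhs => rw [Finset.sum_comm]
    refine Finset.sum_congr rfl fun z _ => ?_
    rw [← Equiv.sum_comp (Equiv.subRight z)]
    refine Finset.sum_congr rfl fun x _ => ?_
    simp only [Equiv.subRight_apply, sub_add_cancel, iidProb_half]
    ring
  refine hx.trans_le ?_
  calc _ ≤ ∑ x : Word n, iidProb (bern (1 / 2)) x * (D + ε + ∑ z : Word n, iidProb (bern p) z *
        (choiceAvg D ε c₀ c₁ x (Ee c₀ c₁ (x - z) z) +
          choiceAvg D ε c₀ c₁ x (Ed c₀ c₁ (x - z) z))) := by
        refine Finset.sum_le_sum fun x _ => mul_le_mul_of_nonneg_left ?_ (h1 x)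
        refine (Finset.sum_le_sum fun z _ => mul_le_mul_of_nonneg_left (hpt x z) (h3 z)).trans ?_
        simp only [mul_add (iidProb _ _) (D + ε), Finset.sum_add_distrib, ← Finset.sum_mul, hp,
          one_mul]
        exact add_le_add_right (hs' x) _
    _ = D + ε + Φ (c₀, c₁) := by
        simp only [mul_add (iidProb _ _) (D + ε), Finset.sum_add_distrib, ← Finset.sum_mul, hα,
          one_mul, hΦ]
    _ ≤ _ := by linarith

/-! ### Time-sharing -/

lemma sum_word_add {m k : ℕ} (F : Word (m + k) → ℝ) :
    ∑ x, F x = ∑ u : Word m, ∑ v : Word k, F (Fin.append u v) := by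
  rw [← Fintype.sum_prod_type']
  exact ((Fin.appendEquiv m k).sum_comp F).symm

lemma iidProb_append {m k : ℕ} (P : ZMod 2 → ℝ) (u : Word m) (v : Word k) :
    iidProb P (Fin.append u v : Word (m + k)) = iidProb P u * iidProb P v := by
  simp [iidProb, Fin.prod_univ_add]

lemma hammingDist_append {m k : ℕ} (x : Word (m + k)) (u : Word m) (v : Word k) :
    hammingDist x (Fin.append u v : Word (m + k)) =
      hammingDist (fun i => x (Fin.castAdd k i)) u + hammingDist (fun i => x (Fin.natAdd m i)) v := by
  rw [hammingDist, Finset.card_filter, Fin.sum_univ_add, hammingDist, hammingDist,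
    Finset.card_filter, Finset.card_filter]
  simp only [Fin.append_left, Fin.append_right]

lemma append_add_append {m k : ℕ} (u u' : Word m) (v v' : Word k) :
    (fun i => ((Fin.append u v : Word (m + k)) + (Fin.append u' v' : Word (m + k)))
      (Fin.castAdd k i)) = u + u' ∧
    (fun i => ((Fin.append u v : Word (m + k)) + (Fin.append u' v' : Word (m + k)))
      (Fin.natAdd m i)) = v + v' := by
  constructor <;> funext i <;> simp

lemma mul_distortion_timeShare {m k : ℕ} {M M' : Type} (C : WZCode m M) (C' : WZCode k M')
    (p : ℝ) : ((m + k : ℕ) : ℝ) * (timeShare C C').distortion p =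
      m * C.distortion p + k * C'.distortion p := by
  have hα : ∀ n, ∑ u : Word n, iidProb (bern (1 / 2)) u = 1 := fun n => sum_iidProb (sum_bern _)
  have hp : ∀ n, ∑ u : Word n, iidProb (bern p) u = 1 := fun n => sum_iidProb (sum_bern _)
  rw [WZCode.mul_distortion, WZCode.mul_distortion, WZCode.mul_distortion]
  simp only [sum_word_add, iidProb_append, timeShare, hammingDist_append,
    (append_add_append _ _ _ _).1, (append_add_append _ _ _ _).2, Fin.append_left, Fin.append_right]
  have e : ∀ (u : Word m) (v : Word k) (u' : Word m) (v' : Word k) (a b : ℕ),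
      iidProb (bern (1 / 2)) u * iidProb (bern (1 / 2)) v * (iidProb (bern p) u' *
        iidProb (bern p) v') * ((a + b : ℕ) : ℝ) =
      (iidProb (bern (1 / 2)) u * iidProb (bern p) u' * a) *
        (iidProb (bern (1 / 2)) v * iidProb (bern p) v') +
      (iidProb (bern (1 / 2)) v * iidProb (bern p) v' * b) *
        (iidProb (bern (1 / 2)) u * iidProb (bern p) u') := by
    intros; push_cast; ring
  have swap : ∀ G : Word m → Word k → Word m → Word k → ℝ, ∑ u, ∑ v, ∑ u', ∑ v', G u v u' v' =
      ∑ u, ∑ u', ∑ v, ∑ v', G u v u' v' := fun G =>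
    Finset.sum_congr rfl fun u _ => Finset.sum_comm
  simp only [e]
  rw [swap]
  simp only [Finset.sum_add_distrib, ← Finset.mul_sum, ← Finset.sum_mul, hα, hp, mul_one]

lemma mul_distortion_sideInfoCode (k : ℕ) (p : ℝ) : k * (sideInfoCode k).distortion p = k * p := by
  rw [WZCode.mul_distortion]
  have h : ∀ y z : Word k, (hammingDist (y + z) y : ℝ) = ∑ i, ind (z i = 1) := fun y z => by
    rw [hammingDist_eq_weight, add_sub_cancel_left, weight]
  have h' := sum_pi_sum (ι := Fin k) (sum_bern p) fun _ a => ind (a = 1)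
  have e : ∑ a : ZMod 2, bern p a * ind (a = 1) = p := by
    rw [sum_zmod_two]; simp [ind]
  simp only [e, Finset.sum_const, Finset.card_univ, Fintype.card_fin, nsmul_eq_mul] at h'
  simp only [sideInfoCode, h, mul_assoc]
  simp only [← Finset.mul_sum]
  rw [← Finset.sum_mul, sum_iidProb (sum_bern _), one_mul]
  exact h'

/-- For every rate above `R1star` there are superposition codes whose distortion is close to
the test distortion. -/
lemma exists_superposition_parameters {p q D η : ℝ} (hp0 : 0 < p) (hp : p < 1 / 2) (hD0 : 0 ≤ D)
    (hD1 : D < 1 / 2) (hq0 : 0 ≤ q) (hq1 : q ≤ 1) (hpq : h2 (star p D) < h2 (star q D))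
    (hη : 0 < η) :
    ∃ R₀ ε ε' : ℝ, (R₀, R1star p D + η) ∈ rateRegion p q D ∧ 0 < ε ∧ ε < ε' ∧ ε' < η ∧
      ∀ᶠ n : ℕ in atTop, ∃ C : WZCode n (Fin (codeSize (R1star p D + η) n)),
        IsSuperpositionCode p D ε ε' (codeSize R₀ n) C ∧ C.distortion p ≤ D + η := by
  obtain ⟨R₀, hR, hR₀⟩ := exists_rate_lt hpq (show R1star p D < R1star p D + η by linarith)
  obtain ⟨ε₀, h0, h⟩ := exists_tendsto_errorProb hp0 hp hD0 hD1 hq0 hq1 hpq hR hR₀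
  obtain ⟨ε', hε'0, hε'⟩ := exists_between (lt_min h0 (half_pos hη))
  have hε'1 := hε'.trans_le (min_le_left _ _)
  have hε'2 := hε'.trans_le (min_le_right _ _)
  obtain ⟨t1, t2⟩ := h (ε' / 2) ε' (by linarith) (by linarith) hε'1
  -- The distortion excess is ε = ε'/2 plus the two error probabilities; since ε' < η/2, it is below
  -- η once those sum to at most η/2.
  refine ⟨R₀, ε' / 2, ε', hR, by linarith, by linarith, by linarith, ?_⟩
  have ht := t1.add t2
  rw [add_zero] at ht
  filter_upwards [ht.eventually (ge_mem_nhds (half_pos hη)), eventually_gt_atTop 0] with n hn hn0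
  obtain ⟨C, hC, hC'⟩ := exists_superpositionCode (p := p) (q := q) (D := D) (R₀ := R₀)
    (R₁ := R1star p D + η) (ε := ε' / 2) (ε' := ε') hn0 hp0.le (by linarith) hq0 hq1
    (by linarith)
  exact ⟨C, hC, by linarith⟩

lemma R1star_pos {p D : ℝ} (hp0 : 0 < p) (hp : p < 1 / 2) (hD0 : 0 ≤ D) (hD1 : D < 1 / 2) :
    0 < R1star p D := by
  rw [R1star_eq]; exact div_pos (gainNats_pos hp0 hp hD0 hD1) log_two_pos

lemma codeSize_le_rpow {R S : ℝ} {m n : ℕ} (hR : 0 ≤ R) (h : m * R + 1 ≤ n * S) :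
    (codeSize R m : ℝ) ≤ (2 : ℝ) ^ (n * S) := by
  refine (codeSize_le hR m).trans ?_
  rw [mul_comm, ← Real.rpow_add_one (by norm_num)]
  exact Real.rpow_le_rpow_of_exponent_le (by norm_num) h

lemma wzAchievable_R1star {p D : ℝ} (hp0 : 0 < p) (hp : p < 1 / 2) (hD0 : 0 ≤ D)
    (hD1 : D < 1 / 2) : WZAchievable p (R1star p D) D := by
  intro η hη
  obtain ⟨R₀, ε, ε', -, -, -, -, hev⟩ := exists_superposition_parameters hp0 hp hD0 hD1
    (q := 1 / 2) (by norm_num) (by norm_num) (h2_star_half hp hD1) (half_pos hη)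
  have hlarge : ∀ᶠ n : ℕ in atTop, 2 / η ≤ n := tendsto_natCast_atTop_atTop.eventually_ge_atTop _
  filter_upwards [hev, hlarge] with n hn hn2
  obtain ⟨C, -, hC⟩ := hn
  refine ⟨_, C, codeSize_le_rpow (by linarith [R1star_pos hp0 hp hD0 hD1]) ?_, by linarith⟩
  rw [div_le_iff₀ hη] at hn2
  linarith

/-- Time-sharing between superposition codes and the code of rate zero. -/
lemma exists_timeShare_parameters {p q D' t η : ℝ} (hp0 : 0 < p) (hp : p < 1 / 2) (hD0 : 0 ≤ D')
    (hDp : D' < p) (ht0 : 0 ≤ t) (ht1 : t ≤ 1) (hq0 : 0 ≤ q) (hq1 : q ≤ 1)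
    (hpq : h2 (star p D') < h2 (star q D')) (hη : 0 < η) :
    ∃ R₀ R₁ ε ε' : ℝ, (R₀, R₁) ∈ rateRegion p q D' ∧ R₁ < R1star p D' + η ∧
      0 < ε ∧ ε < ε' ∧ ε' < η ∧
      ∀ᶠ n : ℕ in atTop,
        ∃ C : WZCode ⌊t * n⌋₊ (Fin (codeSize R₁ ⌊t * n⌋₊)),
          IsSuperpositionCode p D' ε ε' (codeSize R₀ ⌊t * n⌋₊) C ∧
          (Nat.card (Fin (codeSize R₁ ⌊t * n⌋₊) × Unit) : ℝ) ≤
            (2 : ℝ) ^ ((n : ℝ) * (t * R1star p D' + (1 - t) * 0 + η)) ∧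
          (timeShare C (sideInfoCode (n - ⌊t * n⌋₊))).distortion p ≤
            t * D' + (1 - t) * p + η := by
  obtain ⟨R₀, ε, ε', hR, hε, hεε', hε', hev⟩ := exists_superposition_parameters hp0 hp hD0
    (by linarith) hq0 hq1 hpq (half_pos hη)
  have hpos := R1star_pos hp0 hp hD0 (show D' < 1 / 2 by linarith)
  refine ⟨R₀, R1star p D' + η / 2, ε, ε', hR, by linarith, hε, hεε', by linarith, ?_⟩
  -- Then n η/2 ≥ 1, which absorbs both the factor 2 from rounding up the codebook size and the
  -- letter lost in the floor of t n.
  have hlarge : ∀ᶠ n : ℕ in atTop, 2 / η ≤ n := tendsto_natCast_atTop_atTop.eventually_ge_atTop _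
  have hcode : ∀ᶠ n : ℕ in atTop, ∃ C : WZCode ⌊t * n⌋₊ (Fin (codeSize (R1star p D' + η / 2) ⌊t * n⌋₊)),
      IsSuperpositionCode p D' ε ε' (codeSize R₀ ⌊t * n⌋₊) C ∧
        ⌊t * n⌋₊ * C.distortion p ≤ ⌊t * n⌋₊ * (D' + η / 2) := by
    rcases ht0.eq_or_lt with rfl | htpos
    -- For t = 0 the first block is always empty, so the asymptotic existence statement says nothing
    -- about it; any codebooks of empty words do.
    · refine Eventually.of_forall fun n => ?_
      have hz : ⌊(0 : ℝ) * n⌋₊ = 0 := by simp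
      rw [hz]
      have : Nonempty (Fin (codeSize R₀ 0)) := ⟨⟨0, codeSize_pos R₀ 0⟩⟩
      have : Nonempty (Fin (codeSize (R1star p D' + η / 2) 0)) := ⟨⟨0, codeSize_pos _ 0⟩⟩
      have c₀ : Fin (codeSize R₀ 0) → Word 0 := 0
      have c₁ : Fin (codeSize (R1star p D' + η / 2) 0) → Word 0 := 0
      choose s hs using fun x : Word 0 =>
        (orAll_nonempty _ : (encChoices D' ε c₀ c₁ x).Nonempty)
      choose T hT using fun w : Word 0 => (orAll_nonempty _ : (decChoices p D' ε' c₀ w).Nonempty)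
      exact ⟨⟨fun x => (s x).2, fun j y => y + (c₀ (T (y - c₁ j)) - (y - c₁ j))⟩,
        ⟨c₀, c₁, s, T, hs, hT, fun _ => rfl, fun _ _ => rfl⟩, by simp⟩
    · have hm : Tendsto (fun n : ℕ => ⌊t * n⌋₊) atTop atTop :=
        tendsto_nat_floor_atTop.comp (tendsto_natCast_atTop_atTop.const_mul_atTop htpos)
      filter_upwards [hm.eventually hev] with n hn
      obtain ⟨C, hC, hC'⟩ := hn
      exact ⟨C, hC, by gcongr⟩
  filter_upwards [hcode, hlarge, eventually_gt_atTop 0] with n hn hn2 hn0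
  obtain ⟨C, hC, hCd⟩ := hn
  have hn' : (0 : ℝ) < n := by exact_mod_cast hn0
  have hfl : (⌊t * n⌋₊ : ℝ) ≤ t * n := Nat.floor_le (by positivity)
  have hfl' : t * n < ⌊t * n⌋₊ + 1 := Nat.lt_floor_add_one _
  have hmn : ⌊t * n⌋₊ ≤ n := by
    have : (⌊t * n⌋₊ : ℝ) ≤ n := hfl.trans (by nlinarith)
    exact_mod_cast this
  rw [div_le_iff₀ hη] at hn2
  refine ⟨C, hC, ?_, ?_⟩
  · have : Nat.card (Fin (codeSize (R1star p D' + η / 2) ⌊t * n⌋₊) × Unit) =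
        codeSize (R1star p D' + η / 2) ⌊t * n⌋₊ := by simp
    rw [this]
    refine codeSize_le_rpow (by linarith) ?_
    have h1 : ⌊t * n⌋₊ * (R1star p D' + η / 2) ≤ t * n * (R1star p D' + η / 2) := by gcongr
    have h2 : t * n * (η / 2) ≤ 1 * n * (η / 2) := by gcongr
    linarith
  · have hts := mul_distortion_timeShare C (sideInfoCode (n - ⌊t * n⌋₊)) p
    have hcast : ((⌊t * n⌋₊ + (n - ⌊t * n⌋₊) : ℕ) : ℝ) = n := by rw [Nat.add_sub_cancel' hmn]
    rw [mul_distortion_sideInfoCode, hcast, Nat.cast_sub hmn] at hts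
    refine le_of_mul_le_mul_left ?_ hn'
    rw [hts]
    nlinarith

lemma WZCode.exists_fin {n : ℕ} {M : Type} [Fintype M] (C : WZCode n M) (p : ℝ) :
    ∃ C' : WZCode n (Fin (Nat.card M)), C'.distortion p = C.distortion p := by
  rw [Nat.card_eq_fintype_card]
  refine ⟨⟨fun x => Fintype.equivFin M (C.enc x), fun j y => C.dec ((Fintype.equivFin M).symm j) y⟩,
    ?_⟩
  simp [WZCode.distortion]

lemma wzAchievable_chord {p D' t : ℝ} (hp0 : 0 < p) (hp : p < 1 / 2) (hD0 : 0 ≤ D')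
    (hDp : D' < p) (ht0 : 0 ≤ t) (ht1 : t ≤ 1) :
    WZAchievable p (t * R1star p D' + (1 - t) * 0) (t * D' + (1 - t) * p) := by
  intro η hη
  obtain ⟨R₀, R₁, ε, ε', -, -, -, -, -, hev⟩ := exists_timeShare_parameters hp0 hp hD0 hDp ht0 ht1
    (q := 1 / 2) (by norm_num) (by norm_num) (h2_star_half hp (by linarith)) hη
  filter_upwards [hev] with n hn
  obtain ⟨C, -, h1, h2⟩ := hn
  obtain ⟨C', hC'⟩ := (timeShare C (sideInfoCode (n - ⌊t * n⌋₊))).exists_fin p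
  have hmn : ⌊t * n⌋₊ + (n - ⌊t * n⌋₊) = n := by
    refine Nat.add_sub_cancel' ?_
    have : (⌊t * n⌋₊ : ℝ) ≤ n := (Nat.floor_le (by positivity)).trans
      (mul_le_of_le_one_left (by positivity) ht1)
    exact_mod_cast this
  -- The concatenated code has length m + (n - m), which equals n only propositionally; the
  -- existence statement is formulated at that length and then transported.
  have hex : ∃ (M : ℕ) (C : WZCode (⌊t * n⌋₊ + (n - ⌊t * n⌋₊)) (Fin M)),
      (M : ℝ) ≤ (2 : ℝ) ^ ((n : ℝ) * (t * R1star p D' + (1 - t) * 0 + η)) ∧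
        C.distortion p ≤ t * D' + (1 - t) * p + η := ⟨_, C', h1, hC'.trans_le h2⟩
  rwa [hmn] at hex

end SuperpositionWZ

open SuperpositionWZ
theorem mainTheorem3 (p : ℝ) (hp0 : 0 < p) (hp : p < 1 / 2) :
    -- the rate region, and what it guarantees
    (∀ D : ℝ, 0 ≤ D → D < 1 / 2 →
      (∃ q : ℝ, 0 ≤ q ∧ q ≤ 1 ∧ h2 (star p D) < h2 (star q D)) ∧
      ∀ q : ℝ, 0 ≤ q → q ≤ 1 → h2 (star p D) < h2 (star q D) →
        {R₁ : ℝ | ∃ R₀ : ℝ, (R₀, R₁) ∈ rateRegion p q D} = Set.Ioi (R1star p D) ∧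
        {R₁ : ℝ | ∃ R₀ : ℝ, (R₀, R₁) ∈ rateRegion p q D ∧ R₀ < 1 - h2 (star p D)} =
          Set.Ioi (R1star p D) ∧
        ∀ R₀ R₁ : ℝ, (R₀, R₁) ∈ rateRegion p q D → R₀ < 1 - h2 (star p D) →
          ∃ ε₀ : ℝ, 0 < ε₀ ∧ ∀ ε ε' : ℝ, 0 < ε → ε < ε' → ε' < ε₀ →
            Tendsto (encErrorProb p q D R₀ R₁ ε) atTop (𝓝 0) ∧
            Tendsto (decErrorProb p q D R₀ R₁ ε ε') atTop (𝓝 0)) ∧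
    -- the threshold distortion, and the Wyner-Ziv rate-distortion function
    (∃! D' : ℝ, IsThreshold p D') ∧
    ∀ D' : ℝ, IsThreshold p D' →
      (∀ D : ℝ, 0 ≤ D → D ≤ D' → IsWZRate p D (R1star p D)) ∧
      ∀ D : ℝ, D' < D → D ≤ p → ∀ t : ℝ, t = (p - D) / (p - D') →
        D = t * D' + (1 - t) * p ∧
        IsWZRate p D (t * R1star p D' + (1 - t) * 0) ∧
        -- time-sharing of superposition codes with the zero-rate code attains it
        ∀ q : ℝ, 0 ≤ q → q ≤ 1 → h2 (star p D') < h2 (star q D') → ∀ η : ℝ, 0 < η →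
          ∃ R₀ R₁ ε ε' : ℝ, (R₀, R₁) ∈ rateRegion p q D' ∧ R₁ < R1star p D' + η ∧
            0 < ε ∧ ε < ε' ∧ ε' < η ∧
            ∀ᶠ n : ℕ in atTop,
              ∃ C : WZCode ⌊t * n⌋₊ (Fin (codeSize R₁ ⌊t * n⌋₊)),
                IsSuperpositionCode p D' ε ε' (codeSize R₀ ⌊t * n⌋₊) C ∧
                (Nat.card (Fin (codeSize R₁ ⌊t * n⌋₊) × Unit) : ℝ) ≤
                  (2 : ℝ) ^ ((n : ℝ) * (t * R1star p D' + (1 - t) * 0 + η)) ∧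
                (timeShare C (sideInfoCode (n - ⌊t * n⌋₊))).distortion p ≤ D + η := by
  refine ⟨fun D hD0 hD1 => ⟨⟨1 / 2, by norm_num, by norm_num, h2_star_half hp hD1⟩,
    fun q hq0 hq1 hpq => ⟨setOf_rate_eq_Ioi hpq, setOf_rate_lt_eq_Ioi hpq, fun R₀ R₁ hR hR₀ =>
      exists_tendsto_errorProb hp0 hp hD0 hD1 hq0 hq1 hpq hR hR₀⟩⟩,
    existsUnique_isThreshold hp0 hp, fun D' hD' => ⟨fun D hD0 hD1 => ⟨?_, ?_⟩, ?_⟩⟩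
  · exact wzAchievable_R1star hp0 hp hD0 (by linarith [hD'.2.1])
  · exact fun R hR => hR.R1star_le hp0 hp hD' hD0 hD1
  · intro D hD hDp t ht
    have hpD : 0 < p - D' := by linarith [hD'.2.1]
    have ht0 : 0 ≤ t := ht ▸ div_nonneg (by linarith) hpD.le
    have ht1 : t ≤ 1 := by rw [ht, div_le_one hpD]; linarith
    have hDt : D = t * D' + (1 - t) * p := by
      have : t * (p - D') = p - D := by rw [ht, div_mul_cancel₀ _ hpD.ne']
      linarith
    refine ⟨hDt, ⟨?_, fun R hR => ?_⟩, fun q hq0 hq1 hpq η hη => ?_⟩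
    · have := wzAchievable_chord hp0 hp hD'.1.le hD'.2.1 ht0 ht1
      rwa [← hDt] at this
    · rw [mul_zero, add_zero]
      exact WZAchievable.chord_le hp0 hp hD' hR hDt
    · rw [hDt]
      exact exists_timeShare_parameters hp0 hp hD'.1.le hD'.2.1 ht0 ht1 hq0 hq1 hpq hη
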